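/- Let $d\ge 1$ and let $a:\mathbb{R}^d\to[0,\infty)$ have all moments finite, i.e. $\int |x|^n a(x)\,dx<\infty$ for all $n=0,1,2,\dots$ Put $a^{(0)}=\int a(x)\,dx$, $a^{(1)}_i=\int x_i a(x)\,dx$, $a^{(2)}_{ij}=\int x_ix_ja(x)\,dx$. Let $\Gamma$ be the space of locally finite subsets of $\mathbb{R}^d$ with the Borel $\sigma$-algebra of the vague topology, write $\langle f,\gamma\rangle=\sum_{x\in\gamma}f(x)$, and let $\Theta\subset\Gamma$ be the set of those $\gamma$ for which there is $m\in\mathbb{N}$ with $|\gamma\cap B(n)|\le m\,\mathrm{vol}(B(n))$ for all $n\ge1$, where $B(n)$ is the closed ball of radius $n$ around $0$. For a non-negative bounded measurable $z$, let $\pi_z$ be the Poisson measure on $\Gamma$ with intensity $z\,dx$, i.e. the probability measure with $\int_\Gamma e^{\langle\varphi,\gamma\rangle}\pi_z(d\gamma)=\exp\big(\int (e^{\varphi(x)}-1)z(x)\,dx\big)$ for all real $\varphi\in\mathcal{D}(\mathbb{R}^d)=C_c^\infty(\mathbb{R}^d)$. The free Kawasaki dynamics with jump kernel $a$ is the process $(\mathbf{X}_t)_{t\ge0}$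 that starts at $\gamma\in\Theta$ and in which the particles move independently, each as the Markov jump process with generator $Af(x)=\int a(x-y)(f(y)-f(x))\,dy$ (that is, at the times of a Poisson process of rate $a^{(0)}$ the particle jumps from $x$ to $y$ with density $a(x-y)/a^{(0)}$); $\mathbf{E}_\gamma$ is the corresponding expectation. For $\varphi\in\mathcal{D}(\mathbb{R}^d)$ real, $\varepsilon>0$ and $\kappa\in\{1,2\}$ let $n^{(\varepsilon)}_t(\varphi,\mathbf{X})=\varepsilon^d\langle\varphi(\varepsilon\,\cdot),\mathbf{X}_{\varepsilon^{-\kappa}t}\rangle$, and let $\hat\varphi(k)=(2\pi)^{-d/2}\int e^{-i\langle x,k\rangle}\varphi(x)\,dx$. Then for every non-negative bounded measurable function $z$ on $\mathbb{R}^d$ (with no assumption on its Fourier transform), every $t\ge0$ and every real $\varphi\in\mathcal{D}(\mathbb{R}^d)$, the Laplace transforms below are finite (for every $\varepsilon>0$ in 1 and 2, for every $0<\varepsilon\le1$ in 3), and: 1. If $a^{(1)}\ne0$, then with $\kappa=1$ $$\lim_{\varepsilon\to0^+}\int_\Theta\pi_{z(\varepsilon\cdot)}(d\gamma)\,\mathbf{E}_\gamma\big[e^{n^{(\varepsilon)}_t(\varphi,\mathbf{X})}\big]=\exp\Big(\int_{\mathbb{R}^d}z(x+ta^{(1)})\varphi(x)\,dx\Big).$$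 2. If $a^{(1)}=0$, then with $\kappa=2$ $$\lim_{\varepsilon\to0^+}\int_\Theta\pi_{z(\varepsilon\cdot)}(d\gamma)\,\mathbf{E}_\gamma\big[e^{n^{(\varepsilon)}_t(\varphi,\mathbf{X})}\big]=\exp\Big(\frac1{(2\pi)^{d/2}}\int_{\mathbb{R}^d}dx\,z(x)\int_{\mathbb{R}^d}dk\,e^{i\langle k,x\rangle}e^{-\frac t2\langle a^{(2)}k,k\rangle}\hat\varphi(k)\Big).$$ 3. (Weak asymmetry.) Let $p$ and $q$ be the even and the odd part of $a$, and for $0<\varepsilon\le1$ let $\mathbf{X}$ now be the free Kawasaki dynamics with jump kernel $a_\varepsilon=p+\varepsilon q$. If $a^{(1)}\neq0$, then with $\kappa=2$ $$\lim_{\varepsilon\to0^+}\int_\Theta\pi_{z(\varepsilon\cdot)}(d\gamma)\,\mathbf{E}_\gamma\big[e^{n^{(\varepsilon)}_t(\varphi,\mathbf{X})}\big]=\exp\Big(\frac1{(2\pi)^{d/2}}\int_{\mathbb{R}^d}dx\,z(x)\int_{\mathbb{R}^d}dk\,e^{i\langle k,x\rangle}e^{-it\langle a^{(1)},k\rangle-\frac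 t2\langle a^{(2)}k,k\rangle}\hat\varphi(k)\Big).$$ -/

import Mathlib

open MeasureTheory Filter Topology

namespace Kawasaki

open ProbabilityTheory
open scoped CompactlySupported ENNReal

noncomputable section

/-! ### Configurations -/

/-- The Euclidean space `ℝ^d`. -/
abbrev E (d : ℕ) : Type := EuclideanSpace ℝ (Fin d)

/-- The configuration space `Γ`: all locally finite subsets of `ℝ^d`. -/
def Config (d : ℕ) : Type :=
  {γ : Set (E d) // ∀ K : Set (E d), IsCompact K → (γ ∩ K).Finite}

/-- The pairing `⟨f, γ⟩ = ∑_{x ∈ γ} f x`. -/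
def pairing {d : ℕ} (f : E d → ℝ) (γ : Config d) : ℝ := ∑' x : γ.1, f x

/-- The vague topology: the weakest topology for which `γ ↦ ⟨f, γ⟩` is continuous for every
continuous `f` with compact support. -/
instance (d : ℕ) : TopologicalSpace (Config d) :=
  ⨅ f : C_c(E d, ℝ),
    TopologicalSpace.induced (fun γ : Config d => pairing f γ) inferInstance

/-- The Borel `σ`-algebra of the vague topology. -/
instance (d : ℕ) : MeasurableSpace (Config d) := borel (Config d)

/-- The set `Θ` of admissible configurations: for some `m`,
`|γ ∩ B(n)| ≤ m vol(B(n))` for all `n = 1, 2, …`, where `B(n)` is the closed ball of radius `n`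
centred at the origin. -/
def Theta (d : ℕ) : Set (Config d) :=
  {γ | ∃ m : ℕ, ∀ n : ℕ, 1 ≤ n →
    ((γ.1 ∩ Metric.closedBall (0 : E d) n).ncard : ℝ)
      ≤ m * volume.real (Metric.closedBall (0 : E d) n)}

/-- Real test functions: smooth functions with compact support. -/
def IsTestFunction {d : ℕ} (φ : E d → ℝ) : Prop :=
  ContDiff ℝ (⊤ : ℕ∞) φ ∧ HasCompactSupport φ

/-! ### Poisson measures -/

/-- `π` is a probability measure on `Γ` with the Laplace transform of the Poisson measure of
intensity `z dx`. -/
def IsPoisson {d : ℕ} (z : E d → ℝ) (π : Measure (Config d)) : Prop :=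
  IsProbabilityMeasure π ∧
    ∀ φ : E d → ℝ, IsTestFunction φ →
      ∫⁻ γ, ENNReal.ofReal (Real.exp (pairing φ γ)) ∂π
        = ENNReal.ofReal (Real.exp (∫ x, (Real.exp (φ x) - 1) * z x))

open Classical in
/-- The Poisson measure `π_z` on `Γ`: the probability measure with the above Laplace transform
(the zero measure should there be none). -/
def poisson {d : ℕ} (z : E d → ℝ) : Measure (Config d) :=
  if h : ∃ π : Measure (Config d), IsPoisson z π then h.choose else 0

/-! ### The one-particle jump process -/

/-- The total jump rate `a^{(0)} = ∫ a`. -/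
def jumpRate {d : ℕ} (a : E d → ℝ) : ℝ := ∫ x, a x

open Classical in
/-- The probability measure with density `a / a^{(0)}`; if `a` vanishes almost everywhere no jump
ever happens, and the value is then irrelevant (a Dirac measure). -/
def stepLaw {d : ℕ} (a : E d → ℝ) : Measure (E d) :=
  if jumpRate a = 0 then Measure.dirac 0
  else volume.withDensity (fun x => ENNReal.ofReal (a x / jumpRate a))

/-- The sample space of one particle: sequences of pairs (unit-rate waiting time, step). -/
abbrev Sample (d : ℕ) : Type := ℕ → ℝ × E d

/-- All the waiting times are exponential with parameter one, all the steps have density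
`a / a^{(0)}`, and everything is independent. -/
def sampleMeasure {d : ℕ} (a : E d → ℝ) : Measure (Sample d) :=
  Measure.infinitePi fun _ : ℕ => (expMeasure 1).prod (stepLaw a)

/-- The Poisson process `Z_t` of parameter `a^{(0)}`: the number of arrivals up to time
`a^{(0)} t` for the unit-rate waiting times. -/
def jumpCount {d : ℕ} (a : E d → ℝ) (t : ℝ) (ω : Sample d) : ℕ :=
  {n : ℕ | ∑ i ∈ Finset.range (n + 1), (ω i).1 ≤ jumpRate a * t}.ncard

/-- The jump process `X_t = Y_{Z_t}` started at `x`, where `(Y_k)` is the random walk started at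
`x` with transition density `(y, y') ↦ a (y - y') / a^{(0)}`, so that the `k`-th jump is minus
the `k`-th step. Its generator is `A f x = ∫ a (x - y) (f y - f x) dy`. -/
def jumpProcess {d : ℕ} (a : E d → ℝ) (x : E d) (t : ℝ) (ω : Sample d) : E d :=
  x - ∑ k ∈ Finset.range (jumpCount a t ω), (ω k).2

/-! ### The free Kawasaki dynamics -/

/-- The sample measure of the infinite particle system started at `γ`: independent copies of the
one-particle sample, one for each point of `γ`. -/
def systemMeasure {d : ℕ} (a : E d → ℝ) (γ : Config d) : Measure (γ.1 → Sample d) :=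
  Measure.infinitePi fun _ : γ.1 => sampleMeasure a

open Classical in
/-- The free Kawasaki process `𝐗_t` started at `γ`: the set of the positions at time `t` of the
particles, each of which performs its own jump process. (If that set is not locally finite, which
for `γ ∈ Θ` has probability zero, the value is the empty configuration.) -/
def kawasaki {d : ℕ} (a : E d → ℝ) (γ : Config d) (t : ℝ) (ω : γ.1 → Sample d) : Config d :=
  if h : ∀ K : Set (E d), IsCompact K →
      (Set.range (fun x : γ.1 => jumpProcess a x t (ω x)) ∩ K).Finite then
    ⟨Set.range fun x : γ.1 => jumpProcess a x t (ω x), h⟩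
  else ⟨∅, fun K _ => by simp⟩

/-- The scaled empirical field
`n_t^{(ε)}(φ, 𝐗) = ε^d ⟨φ(ε ·), 𝐗_{ε^{-κ} t}⟩` of the process started at `γ`. -/
def scaledField {d : ℕ} (a : E d → ℝ) (κ : ℕ) (ε t : ℝ) (φ : E d → ℝ) (γ : Config d)
    (ω : γ.1 → Sample d) : ℝ :=
  pairing (fun x => ε ^ d * φ (ε • x)) (kawasaki a γ ((ε ^ κ)⁻¹ * t) ω)

/-- The Laplace transform of the scaled empirical field,
`∫_Θ π_{z(ε ·)}(dγ) 𝐄_γ [exp (n_t^{(ε)}(φ, 𝐗))]`, as an element of `[0, ∞]`. -/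
def scaledLaplace {d : ℕ} (a : E d → ℝ) (z : E d → ℝ) (κ : ℕ) (t : ℝ) (φ : E d → ℝ) (ε : ℝ) :
    ℝ≥0∞ :=
  ∫⁻ γ in Theta d,
    (∫⁻ ω, ENNReal.ofReal (Real.exp (scaledField a κ ε t φ γ ω)) ∂(systemMeasure a γ))
    ∂(poisson fun x => z (ε • x))

/-! ### Moments, Fourier transform, weak asymmetry -/

/-- `a^{(1)}_i = ∫ x_i a(x) dx`. -/
def firstMoment {d : ℕ} (a : E d → ℝ) : E d := WithLp.toLp 2 fun i => ∫ x : E d, x i * a x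

/-- `a^{(2)}_{ij} = ∫ x_i x_j a(x) dx`. -/
def secondMoment {d : ℕ} (a : E d → ℝ) : Matrix (Fin d) (Fin d) ℝ :=
  Matrix.of fun i j => ∫ x : E d, x i * x j * a x

/-- The quadratic form `⟨M k, k⟩`. -/
def quadForm {d : ℕ} (M : Matrix (Fin d) (Fin d) ℝ) (k : E d) : ℝ :=
  ∑ i, ∑ j, M i j * k i * k j

/-- `φ̂(k) = (2π)^{-d/2} ∫ e^{-i⟨x, k⟩} φ(x) dx`. -/
def fourierHat {d : ℕ} (φ : E d → ℝ) (k : E d) : ℂ :=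
  (((2 * Real.pi) ^ (-(d : ℝ) / 2) : ℝ) : ℂ) *
    ∫ x : E d, Complex.exp (-Complex.I * (inner ℝ x k : ℝ)) * (φ x : ℂ)

/-- `(2π)^{-d/2} ∫ dx z(x) ∫ dk e^{i⟨k, x⟩} e^{-i t ⟨b, k⟩ - (t/2) ⟨M k, k⟩} φ̂(k)`. -/
def gaussianPairing {d : ℕ} (z : E d → ℝ) (b : E d) (M : Matrix (Fin d) (Fin d) ℝ) (t : ℝ)
    (φ : E d → ℝ) : ℂ :=
  (((2 * Real.pi) ^ (-(d : ℝ) / 2) : ℝ) : ℂ) *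
    ∫ x : E d, (z x : ℂ) *
      ∫ k : E d, Complex.exp (Complex.I * (inner ℝ k x : ℝ)) *
        Complex.exp (-Complex.I * t * (inner ℝ b k : ℝ) - (t / 2) * (quadForm M k : ℝ)) *
        fourierHat φ k

/-- The even part `p` of `a`. -/
def evenPart {d : ℕ} (a : E d → ℝ) (x : E d) : ℝ := (a x + a (-x)) / 2

/-- The odd part `q` of `a`. -/
def oddPart {d : ℕ} (a : E d → ℝ) (x : E d) : ℝ := (a x - a (-x)) / 2

/-- The weakly asymmetric jump kernel `a_ε = p + ε q`. -/
def weakKernel {d : ℕ} (a : E d → ℝ) (ε : ℝ) (x : E d) : ℝ := evenPart a x + ε * oddPart a x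

end

end Kawasaki

open Kawasaki

namespace Kawasaki

open ProbabilityTheory
open scoped CompactlySupported ENNReal

/-! Independence reduces everything to one particle, and the one-particle problem is a weak limit
theorem for the displacement. Let `ν` be the law of the sum of the steps made up to a given time and
put g(x) = ∫ (exp f(x - s) - 1) ν(ds), which is `smear ν f`. For fixed γ ∈ Θ, independence gives
E_γ[exp ⟨f, X⟩] = ∏_{x ∈ γ} (1 + g(x)) (`lintegral_exp_kawasaki`). Averaging this product over the
Poisson measure gives exp ∫ g z (`lintegral_exp_tsum_log`), the Laplace transform of the Poisson
measure at log(1 + g). Since g has in general no compact support, this second step needs a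
truncation.

For f = ε^d φ(ε ·) and intensity z(ε ·), Fubini and the substitution y = εx turn the exponent into
the average, over the displacement s, of s ↦ ∫ z(y) ψ_ε(y - εs) dy with ψ_ε = ε^{-d}(exp(ε^d φ) - 1)
(`integral_smear_eq`). Replacing ψ_ε by φ costs O(ε^d) uniformly in s. The function s ↦ ∫ z(y) φ(y -
s) dy is bounded and continuous although z is only bounded and measurable. Hence weak convergence of
the scaled displacement suffices, and no Fourier transform of z is needed
(`tendsto_integral_smear`).

The displacement is compound Poisson, so after scaling its characteristic function at k is exp(t
ε^{-κ} ∫ a(x)(e^{iε⟨x,k⟩} - 1) dx). Taylor expansion yields the exponent i⟨a^{(1)}, k⟩ for κ = 1 and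
-⟨a^{(2)}k, k⟩/2 for κ = 2 and a^{(1)} = 0. For the weakly asymmetric kernel it yields the sum of
the two, since the odd part carries an extra factor ε. By Lévy's theorem the limit laws are a Dirac
mass or a Gaussian, and Fourier inversion identifies the Gaussian average with the double integral
of the statement (`gaussianPairing_eq`).

To give this a meaning on configurations, one also needs that Poisson measures exist
(`exists_isPoisson`) and charge only Θ (`ae_mem_Theta`), and that from γ ∈ Θ the moved particles
almost surely form a locally finite set without coincidences (`ae_finite_norm_le`, `ae_injective`).
-/

/-! ### Pairings and the Borel structure of the vague topology -/

theorem Config.finite_support {d : ℕ} (γ : Config d) {f : E d → ℝ} (hf : HasCompactSupport f) :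
    (Function.support fun x : γ.1 => f x).Finite := by
  refine Set.Finite.of_finite_image (f := Subtype.val) ?_ Subtype.val_injective.injOn
  refine (γ.2 (tsupport f) hf).subset ?_
  rintro _ ⟨x, hx, rfl⟩
  exact ⟨x.2, subset_tsupport f hx⟩

theorem Config.summable {d : ℕ} (γ : Config d) {f : E d → ℝ} (hf : HasCompactSupport f) :
    Summable fun x : γ.1 => f x :=
  summable_of_hasFiniteSupport (γ.finite_support hf)

/-- Countability lets almost sure statements about single particles or pairs hold simultaneously,
and makes limits along finite sets of particles accessible to monotone and dominated convergence. -/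
instance {d : ℕ} (γ : Config d) : Countable γ.1 := by
  have h : γ.1 = ⋃ n : ℕ, γ.1 ∩ Metric.closedBall 0 n := by
    ext x
    simp only [Set.mem_iUnion, Set.mem_inter_iff, Metric.mem_closedBall, dist_zero_right]
    exact ⟨fun hx => ⟨⌈‖x‖⌉₊, hx, Nat.le_ceil _⟩, fun ⟨_, hx, _⟩ => hx⟩
  rw [Set.countable_coe_iff, h]
  exact Set.countable_iUnion fun n => (γ.2 _ (isCompact_closedBall _ _)).countable

theorem abs_pairing_sub_le {d : ℕ} {f g χ : E d → ℝ} (hf : HasCompactSupport f)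
    (hg : HasCompactSupport g) (hχ : HasCompactSupport χ) {δ : ℝ}
    (h : ∀ x, |f x - g x| ≤ δ * χ x) (γ : Config d) :
    |pairing f γ - pairing g γ| ≤ δ * pairing χ γ := by
  have hfs := γ.summable hf
  have hgs := γ.summable hg
  have hχs := (γ.summable hχ).mul_left δ
  unfold pairing
  rw [← hfs.tsum_sub hgs, ← tsum_mul_left, abs_le]
  constructor
  · rw [← tsum_neg]
    exact hχs.neg.tsum_le_tsum (fun x => (abs_le.1 (h x)).1) (hfs.sub hgs)
  · exact (hfs.sub hgs).tsum_le_tsum (fun x => (abs_le.1 (h x)).2) hχs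

theorem continuous_pairing {d : ℕ} {f : E d → ℝ} (hf : Continuous f) (hc : HasCompactSupport f) :
    Continuous (pairing f : Config d → ℝ) :=
  continuous_iInf_dom (i := (⟨⟨f, hf⟩, hc⟩ : C_c(E d, ℝ))) continuous_induced_dom

instance (d : ℕ) : BorelSpace (Config d) := ⟨rfl⟩

theorem measurable_pairing {d : ℕ} {f : E d → ℝ} (hf : Continuous f) (hc : HasCompactSupport f) :
    Measurable (pairing f : Config d → ℝ) :=
  (continuous_pairing hf hc).measurable

/-- A smooth cutoff function: one on the ball of radius `n + 1`, zero outside that of radius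
`n + 2`. -/
noncomputable def cutoff (d n : ℕ) : ContDiffBump (0 : E d) :=
  ⟨n + 1, n + 2, by positivity, by linarith⟩

theorem cutoff_eq_one {d n : ℕ} {x : E d} (hx : ‖x‖ ≤ n + 1) : cutoff d n x = 1 :=
  (cutoff d n).one_of_mem_closedBall (by simpa [cutoff] using hx)

theorem cutoff_eq_zero {d n : ℕ} {x : E d} (hx : n + 2 ≤ ‖x‖) : cutoff d n x = 0 :=
  (cutoff d n).zero_of_le_dist (by simpa [cutoff] using hx)

/-- Continuous functions vanishing outside a given ball form a separable space. The cutoffs are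
added to the family so that the error of an approximation is itself controlled by pairings with
members of the family. -/
theorem exists_countable_family (d : ℕ) : ∃ S : Set C(E d, ℝ), S.Countable ∧
    (∀ f ∈ S, HasCompactSupport f) ∧ (∀ n, ∃ g ∈ S, ∀ x, g x = cutoff d n x) ∧
    ∀ f : C(E d, ℝ), HasCompactSupport f → ∃ n : ℕ, ∀ δ > 0, ∃ g ∈ S,
      ∀ x, |f x - g x| ≤ δ * cutoff d n x := by
  let A : ℕ → Set C(E d, ℝ) := fun n => {f | ∀ x, (n : ℝ) < ‖x‖ → f x = 0}
  have hA : ∀ n, ∀ f ∈ A n, HasCompactSupport f := by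
    intro n f hf
    refine HasCompactSupport.intro (isCompact_closedBall (0 : E d) n) fun x hx => hf x ?_
    simpa using hx
  choose D hDc hDd using fun n => TopologicalSpace.exists_countable_dense (A n)
  let X : ℕ → C(E d, ℝ) := fun n => ⟨cutoff d n, (cutoff d n).continuous⟩
  refine ⟨(⋃ n, Subtype.val '' D n) ∪ Set.range X, ?_, ?_, ?_, ?_⟩
  · exact (Set.countable_iUnion fun n => (hDc n).image _).union (Set.countable_range X)
  · rintro f (hf | ⟨n, rfl⟩)
    · obtain ⟨n, g, -, rfl⟩ := Set.mem_iUnion.1 hf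
      exact hA n _ g.2
    · exact (cutoff d n).hasCompactSupport
  · exact fun n => ⟨X n, Or.inr ⟨n, rfl⟩, fun x => rfl⟩
  · intro f hf
    obtain ⟨r, hr⟩ := hf.isCompact.isBounded.subset_closedBall (0 : E d)
    obtain ⟨n, hn⟩ := exists_nat_ge r
    refine ⟨n, fun δ hδ => ?_⟩
    have hfA : f ∈ A n := by
      intro x hx
      by_contra h0
      have := hr (subset_tsupport f h0)
      simp at this
      linarith
    let K : Set (E d) := Metric.closedBall 0 n
    have : CompactSpace K := isCompact_iff_compactSpace.mp (isCompact_closedBall _ _)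
    -- Density is in the compact-open topology, which gives uniform closeness on the ball of radius
    -- `n`; outside that ball both functions vanish.
    have hcont : Continuous fun g : A n => (g.1.restrict K) :=
      (ContinuousMap.continuous_restrict K).comp continuous_subtype_val
    have hopen : IsOpen {g : A n | dist (f.restrict K) (g.1.restrict K) < δ} :=
      isOpen_lt (continuous_const.dist hcont) continuous_const
    obtain ⟨g, hg, hgD⟩ := (hDd n).inter_open_nonempty _ hopen ⟨⟨f, hfA⟩, by simpa using hδ⟩
    refine ⟨g, Or.inl (Set.mem_iUnion.2 ⟨n, g, hgD, rfl⟩), fun x => ?_⟩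
    by_cases hx : ‖x‖ ≤ n
    · rw [cutoff_eq_one (by linarith), mul_one]
      have := ContinuousMap.dist_apply_le_dist (f := f.restrict K) (g := g.1.restrict K)
        ⟨x, by simpa [K] using hx⟩
      exact this.trans (le_of_lt hg)
    · rw [hfA x (not_le.1 hx), g.2 x (not_le.1 hx)]
      simpa using mul_nonneg hδ.le (cutoff d n).nonneg

/-- A map into the configuration space is measurable as soon as its pairings with continuous
functions of compact support are. -/
theorem measurable_config {d : ℕ} {Ω : Type*} [MeasurableSpace Ω] {F : Ω → Config d}
    (h : ∀ f : E d → ℝ, Continuous f → HasCompactSupport f →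
      Measurable fun ω => pairing f (F ω)) : Measurable F := by
  obtain ⟨S, hSc, hS, hScut, hSd⟩ := exists_countable_family d
  have : Countable S := hSc
  let Ψ : Config d → (S → ℝ) := fun γ f => pairing f.1 γ
  -- The vague topology is already induced by the countably many pairings `Ψ`. Since `S` is
  -- countable, the Borel sets of `S → ℝ` are the product ones, so measurability can be tested on
  -- each pairing.
  have htop : (inferInstance : TopologicalSpace (Config d)) =
      TopologicalSpace.induced Ψ inferInstance := by
    apply le_antisymm
    · rw [← continuous_iff_le_induced]
      exact continuous_pi fun f => continuous_pairing f.1.continuous (hS _ f.2)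
    · refine le_iInf fun f => ?_
      rw [← continuous_iff_le_induced]
      let _ : TopologicalSpace (Config d) := TopologicalSpace.induced Ψ inferInstance
      have hΨ₀ : Continuous Ψ := continuous_induced_dom
      have hΨ : ∀ g ∈ S, Continuous[TopologicalSpace.induced Ψ inferInstance, _]
          (fun γ : Config d => pairing g γ) := fun g hg =>
        (continuous_apply (⟨g, hg⟩ : S)).comp hΨ₀
      obtain ⟨n, hn⟩ := hSd f.toContinuousMap f.hasCompactSupport
      obtain ⟨χ, hχS, hχ⟩ := hScut n
      have hcχ : HasCompactSupport (cutoff d n) := (cutoff d n).hasCompactSupport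
      have hχ' : Continuous[TopologicalSpace.induced Ψ inferInstance, _]
          (fun γ : Config d => pairing (cutoff d n) γ) := by
        have := hΨ χ hχS
        rwa [show (χ : E d → ℝ) = cutoff d n from funext hχ] at this
      refine continuous_iff_continuousAt.2 fun γ₀ => ?_
      refine Metric.tendsto_nhds.2 fun e he => ?_
      set c := pairing (cutoff d n) γ₀ with hc
      have hc0 : 0 ≤ c := tsum_nonneg fun x => (cutoff d n).nonneg
      -- Where the cutoff pairing is below `c + 1`, this tolerance makes each of the two
      -- approximation errors at most `e / 4`; the variation of the pairing with `g` adds less than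
      -- another `e / 4`.
      obtain ⟨g, hgS, hg⟩ := hn (e / (4 * (c + 1))) (by positivity)
      have hb : ∀ γ : Config d, |pairing f γ - pairing g γ|
          ≤ e / (4 * (c + 1)) * pairing (cutoff d n) γ := fun γ =>
        abs_pairing_sub_le f.hasCompactSupport (hS g hgS) hcχ hg γ
      have h1 : ∀ᶠ γ in 𝓝 γ₀, pairing (cutoff d n) γ < c + 1 :=
        hχ'.continuousAt.eventually (gt_mem_nhds (by simp [hc]))
      have h2 : ∀ᶠ γ in 𝓝 γ₀, dist (pairing g γ) (pairing g γ₀) < e / 4 :=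
        Metric.tendsto_nhds.1 (hΨ g hgS).continuousAt _ (by positivity)
      filter_upwards [h1, h2] with γ h1 h2
      have key : ∀ y ≤ c + 1, e / (4 * (c + 1)) * y ≤ e / 4 := by
        intro y hy
        calc e / (4 * (c + 1)) * y ≤ e / (4 * (c + 1)) * (c + 1) := by gcongr
          _ = e / 4 := by field_simp
      have a1 := (hb γ).trans (key _ h1.le)
      have a2 := (hb γ₀).trans (key _ (by rw [← hc]; linarith))
      rw [Real.dist_eq] at h2 ⊢
      rw [abs_le] at a1 a2
      rw [abs_lt] at h2 ⊢
      constructor <;> linarith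
  have hmeas : (inferInstance : MeasurableSpace (Config d)) =
      MeasurableSpace.comap Ψ inferInstance := by
    change @borel (Config d) inferInstance = _
    rw [htop, borel_comap, (inferInstance : BorelSpace (S → ℝ)).measurable_eq]
  have hF : @Measurable Ω (Config d) _ (MeasurableSpace.comap Ψ inferInstance) F :=
    measurable_comap_iff.2
      (measurable_pi_lambda _ fun f => h f.1 f.1.continuous (hS _ f.2))
  rw [← hmeas] at hF
  exact hF

/-! ### A Poisson number of independent points -/

/-- The law of a Poisson number and an independent sequence of independent points of law `ρ`. -/
noncomputable def markedPoisson {𝓧 : Type*} [MeasurableSpace 𝓧] (r : NNReal) (ρ : Measure 𝓧) :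
    Measure (ℕ × (ℕ → 𝓧)) :=
  (poissonMeasure r).prod (Measure.infinitePi fun _ : ℕ => ρ)

instance {𝓧 : Type*} [MeasurableSpace 𝓧] (r : NNReal) (ρ : Measure 𝓧) [IsProbabilityMeasure ρ] :
    IsProbabilityMeasure (markedPoisson r ρ) := by
  unfold markedPoisson; infer_instance

theorem lintegral_infinitePi_prod_range {𝓧 : Type*} [MeasurableSpace 𝓧] (ρ : Measure 𝓧)
    [IsProbabilityMeasure ρ] {h : 𝓧 → ℝ≥0∞} (hh : Measurable h) (n : ℕ) :
    ∫⁻ y, ∏ k ∈ Finset.range n, h (y k) ∂(Measure.infinitePi fun _ : ℕ => ρ)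
      = (∫⁻ x, h x ∂ρ) ^ n := by
  have hi : iIndepFun (fun (i : ℕ) (y : ℕ → 𝓧) => h (y i)) (Measure.infinitePi fun _ : ℕ => ρ) :=
    iIndepFun_infinitePi (X := fun _ => h) fun _ => hh
  rw [lintegral_prod_eq_prod_lintegral_of_indepFun _ _ hi (fun i => by fun_prop)]
  have : ∀ i : ℕ, ∫⁻ y, h (y i) ∂(Measure.infinitePi fun _ : ℕ => ρ) = ∫⁻ x, h x ∂ρ := fun i =>
    (measurePreserving_eval_infinitePi (fun _ : ℕ => ρ) i).lintegral_comp hh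
  simp [this]

theorem lintegral_markedPoisson {𝓧 : Type*} [MeasurableSpace 𝓧] (r : NNReal) (ρ : Measure 𝓧)
    [IsProbabilityMeasure ρ] {F : ℕ × (ℕ → 𝓧) → ℝ≥0∞} (hF : Measurable F) :
    ∫⁻ ω, F ω ∂(markedPoisson r ρ)
      = ∑' n : ℕ, ENNReal.ofReal (Real.exp (-r) * r ^ n / n.factorial) *
          ∫⁻ y, F (n, y) ∂(Measure.infinitePi fun _ : ℕ => ρ) := by
  rw [markedPoisson, lintegral_prod _ hF.aemeasurable, lintegral_countable']
  simp_rw [poissonMeasure_singleton, mul_comm]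

theorem measurable_prod_range {𝓧 : Type*} [MeasurableSpace 𝓧] {h : 𝓧 → ℝ≥0∞}
    (hh : Measurable h) :
    Measurable fun ω : ℕ × (ℕ → 𝓧) => ∏ k ∈ Finset.range ω.1, h (ω.2 k) :=
  measurable_from_prod_countable_right fun n =>
    Finset.measurable_fun_prod (Finset.range n) fun k _ => hh.comp (measurable_pi_apply k)

theorem measurable_sum_range {𝓧 V : Type*} [MeasurableSpace 𝓧] [AddCommMonoid V]
    [MeasurableSpace V] [MeasurableAdd₂ V] {h : 𝓧 → V} (hh : Measurable h) :
    Measurable fun ω : ℕ × (ℕ → 𝓧) => ∑ k ∈ Finset.range ω.1, h (ω.2 k) :=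
  measurable_from_prod_countable_right fun n =>
    Finset.measurable_fun_sum (Finset.range n) fun k _ => hh.comp (measurable_pi_apply k)

/-- The Laplace functional of a Poisson number of independent points. -/
theorem lintegral_markedPoisson_prod {𝓧 : Type*} [MeasurableSpace 𝓧] (r : NNReal) (ρ : Measure 𝓧)
    [IsProbabilityMeasure ρ] {h : 𝓧 → ℝ≥0∞} (hh : Measurable h) {m : ℝ} (hm : 0 ≤ m)
    (hint : ∫⁻ x, h x ∂ρ = ENNReal.ofReal m) :
    ∫⁻ ω, ∏ k ∈ Finset.range ω.1, h (ω.2 k) ∂(markedPoisson r ρ)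
      = ENNReal.ofReal (Real.exp (r * (m - 1))) := by
  rw [lintegral_markedPoisson r ρ (measurable_prod_range hh)]
  have hs : HasSum (fun n : ℕ => Real.exp (-r) * (r * m) ^ n / n.factorial)
      (Real.exp (r * (m - 1))) := by
    have := (NormedSpace.expSeries_div_hasSum_exp ((r : ℝ) * m)).mul_left (Real.exp (-r))
    rw [← Real.exp_eq_exp_ℝ, ← Real.exp_add] at this
    convert! this using 1
    · ext n; ring
    · ring_nf
  rw [← hs.tsum_eq, ENNReal.ofReal_tsum_of_nonneg (fun n => by positivity) hs.summable]
  refine tsum_congr fun n => ?_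
  rw [lintegral_infinitePi_prod_range ρ hh, hint, ← ENNReal.ofReal_pow hm,
    ← ENNReal.ofReal_mul (by positivity)]
  congr 1
  ring

/-! ### Existence of Poisson measures -/

/-- The spherical shell `n ≤ ‖x‖ < n + 1`. -/
def shell (d n : ℕ) : Set (E d) := Metric.ball 0 (n + 1) \ Metric.ball 0 n

theorem mem_shell {d n : ℕ} {x : E d} : x ∈ shell d n ↔ ⌊‖x‖⌋₊ = n := by
  rw [Nat.floor_eq_iff (norm_nonneg x)]
  simp [shell, and_comm]

theorem measurableSet_shell (d n : ℕ) : MeasurableSet (shell d n) :=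
  measurableSet_ball.diff measurableSet_ball

theorem volume_shell_lt_top (d n : ℕ) : volume (shell d n) < ⊤ :=
  (measure_mono Set.sdiff_subset).trans_lt measure_ball_lt_top

theorem volume_shell_ne_zero {d : ℕ} (hd : 1 ≤ d) (n : ℕ) : volume (shell d n) ≠ 0 := by
  have : Nonempty (Fin d) := ⟨⟨0, hd⟩⟩
  rw [shell, measure_sdiff (Metric.ball_subset_ball (by linarith)) measurableSet_ball.nullMeasurableSet
    measure_ball_lt_top.ne, Ne, tsub_eq_zero_iff_le, not_le,
    Measure.addHaar_ball _ _ (by positivity), Measure.addHaar_ball (r := (n : ℝ) + 1) _ _ (by positivity)]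
  refine ENNReal.mul_lt_mul_left (Metric.measure_ball_pos _ _ one_pos).ne' measure_ball_lt_top.ne ?_
  rw [ENNReal.ofReal_lt_ofReal_iff (by positivity), finrank_euclideanSpace_fin]
  exact pow_lt_pow_left₀ (by linarith) (by positivity) (by lia)

open Classical in
/-- The law of one point in the `n`-th shell of a Poisson process with intensity `m`. -/
noncomputable def shellLaw {d : ℕ} (m : Measure (E d)) (n : ℕ) : Measure (E d) :=
  if m (shell d n) = 0 then cond volume (shell d n) else cond m (shell d n)

section existence

variable {d : ℕ} {m : Measure (E d)}

theorem isProbabilityMeasure_shellLaw (hd : 1 ≤ d) (hm : ∀ n, m (shell d n) ≠ ⊤) (n : ℕ) :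
    IsProbabilityMeasure (shellLaw m n) := by
  unfold shellLaw
  split_ifs with h
  · exact cond_isProbabilityMeasure_of_finite (volume_shell_ne_zero hd n)
      (volume_shell_lt_top d n).ne
  · exact cond_isProbabilityMeasure_of_finite h (hm n)

/-- On a shell of mass zero the law defaults to normalised Lebesgue measure, so both branches are
absolutely continuous. The absence of atoms makes the sampled points distinct. -/
theorem shellLaw_singleton (hd : 1 ≤ d) (hac : m ≪ volume) (n : ℕ) (x : E d) :
    shellLaw m n {x} = 0 := by
  have : Nonempty (Fin d) := ⟨⟨0, hd⟩⟩
  unfold shellLaw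
  split_ifs with h
  · exact cond_absolutelyContinuous (measure_singleton x)
  · exact cond_absolutelyContinuous (hac (measure_singleton x))

theorem ae_shellLaw (n : ℕ) : ∀ᵐ x ∂(shellLaw m n), x ∈ shell d n := by
  unfold shellLaw
  split_ifs with h
  · exact ae_cond_mem (measurableSet_shell d n)
  · exact ae_cond_mem (measurableSet_shell d n)

/-- The factor `m (shell d n)` undoes the normalisation and makes the identity trivial on null
shells, where the default law is irrelevant. -/
theorem lintegral_shellLaw (hm : ∀ n, m (shell d n) ≠ ⊤) (n : ℕ) (f : E d → ℝ≥0∞) :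
    m (shell d n) * ∫⁻ x, f x ∂(shellLaw m n) = ∫⁻ x in shell d n, f x ∂m := by
  unfold shellLaw
  split_ifs with h
  · rw [h, zero_mul, Measure.restrict_eq_zero.2 h, lintegral_zero_measure]
  · rw [ProbabilityTheory.cond, lintegral_smul_measure, smul_eq_mul, ← mul_assoc, ENNReal.mul_inv_cancel h (hm n),
      one_mul]

/-- The law of the numbers and positions of the points of a Poisson process in all shells. -/
noncomputable def shellSample (m : Measure (E d)) : Measure (ℕ → ℕ × (ℕ → E d)) :=
  Measure.infinitePi fun n => markedPoisson (m (shell d n)).toNNReal (shellLaw m n)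

/-- The points are in their shells and distinct. -/
def regular (d : ℕ) : Set (ℕ → ℕ × (ℕ → E d)) :=
  {ω | (∀ n j, (ω n).2 j ∈ shell d n) ∧ ∀ n i j, i ≠ j → (ω n).2 i ≠ (ω n).2 j}

theorem measurableSet_regular (d : ℕ) : MeasurableSet (regular d) := by
  have h : regular d = (⋂ n, ⋂ j, {ω | (ω n).2 j ∈ shell d n}) ∩
      ⋂ (n : ℕ) (i : ℕ) (j : ℕ) (_ : i ≠ j), {ω | (ω n).2 i ≠ (ω n).2 j} := by
    ext ω
    simp [regular]
  rw [h]
  refine MeasurableSet.inter ?_ ?_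
  · refine .iInter fun n => .iInter fun j => ?_
    exact (by fun_prop : Measurable fun ω : ℕ → ℕ × (ℕ → E d) => (ω n).2 j) (measurableSet_shell d n)
  · refine .iInter fun n => .iInter fun i => .iInter fun j => .iInter fun _ => ?_
    exact (measurableSet_eq_fun (by fun_prop) (by fun_prop)).compl

/-- Two coordinates have joint law ρ ⊗ ρ, and the diagonal is null by Fubini because its sections
are points. -/
theorem ae_infinitePi_ne {ρ : Measure (E d)} [IsProbabilityMeasure ρ] (hρ : ∀ x, ρ {x} = 0)
    {i j : ℕ} (hij : i ≠ j) : ∀ᵐ y ∂(Measure.infinitePi fun _ : ℕ => ρ), y i ≠ y j := by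
  have h := Measure.infinitePi_map_eval_prod (P := fun _ : ℕ => ρ) hij
  have h2 : ∀ᵐ p ∂(ρ.prod ρ), p.1 ≠ p.2 := by
    have hD : MeasurableSet {p : E d × E d | p.1 ≠ p.2} :=
      (measurableSet_eq_fun measurable_fst measurable_snd).compl
    rw [Measure.ae_prod_iff_ae_ae hD]
    refine ae_of_all _ fun x => ?_
    rw [ae_iff]
    simpa [eq_comm] using hρ x
  rw [← h] at h2
  exact ae_of_ae_map (f := fun y : ℕ → E d => (y i, y j)) (by fun_prop) h2

theorem ae_regular (hd : 1 ≤ d) (hac : m ≪ volume) (hm : ∀ n, m (shell d n) ≠ ⊤) :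
    ∀ᵐ ω ∂(shellSample m), ω ∈ regular d := by
  have := isProbabilityMeasure_shellLaw hd hm
  -- A property holding almost surely for the sequence of positions, whatever the number of points,
  -- passes to the `n`-th component of the whole sample.
  have key : ∀ n, ∀ p : ℕ × (ℕ → E d) → Prop,
      (∀ᵐ y ∂(Measure.infinitePi fun _ : ℕ => shellLaw m n), ∀ k, p (k, y)) →
      ∀ᵐ ω ∂(shellSample m), p (ω n) := by
    intro n p hp
    refine (measurePreserving_eval_infinitePi
      (fun n => markedPoisson (m (shell d n)).toNNReal (shellLaw m n)) n).quasiMeasurePreserving.ae ?_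
    have h2 := (Measure.quasiMeasurePreserving_snd
      (μ := poissonMeasure (m (shell d n)).toNNReal)
      (ν := Measure.infinitePi fun _ : ℕ => shellLaw m n)).ae hp
    filter_upwards [h2] with q hq using hq q.1
  refine Filter.Eventually.and ?_ ?_
  · refine ae_all_iff.2 fun n => ae_all_iff.2 fun j => ?_
    refine key n (fun q => q.2 j ∈ shell d n) ?_
    have := (measurePreserving_eval_infinitePi
      (fun _ : ℕ => shellLaw m n) j).quasiMeasurePreserving.ae (ae_shellLaw n)
    filter_upwards [this] with y hy using fun _ => hy
  · refine ae_all_iff.2 fun n => ae_all_iff.2 fun i => ae_all_iff.2 fun j => ?_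
    refine eventually_imp_distrib_left.2 fun hij => ?_
    refine key n (fun q => q.2 i ≠ q.2 j) ?_
    filter_upwards [ae_infinitePi_ne (shellLaw_singleton hd hac n) hij] with y hy using fun _ => hy

/-- The points present in the sample `ω`. -/
def samplePoints (ω : ℕ → ℕ × (ℕ → E d)) : Set (E d) := {x | ∃ n, ∃ j < (ω n).1, (ω n).2 j = x}

/-- The points of the first `R` shells. -/
def sampleIndex (ω : ℕ → ℕ × (ℕ → E d)) (R : ℕ) : Finset ((_ : ℕ) × ℕ) :=
  (Finset.range R).sigma fun n => Finset.range (ω n).1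

theorem samplePoints_eq {ω : ℕ → ℕ × (ℕ → E d)} (hω : ω ∈ regular d) {R : ℕ} {x : E d}
    (hx : x ∈ samplePoints ω) (hxR : ‖x‖ < R) : ∃ p ∈ sampleIndex ω R, (ω p.1).2 p.2 = x := by
  obtain ⟨n, j, hj, rfl⟩ := hx
  have hn := mem_shell.1 (hω.1 n j)
  refine ⟨⟨n, j⟩, ?_, rfl⟩
  simp only [sampleIndex, Finset.mem_sigma, Finset.mem_range]
  refine ⟨?_, hj⟩
  rw [← hn]
  exact (Nat.floor_lt (norm_nonneg _)).2 hxR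

theorem samplePoints_locallyFinite {ω : ℕ → ℕ × (ℕ → E d)} (hω : ω ∈ regular d) (K : Set (E d))
    (hK : IsCompact K) : (samplePoints ω ∩ K).Finite := by
  obtain ⟨r, hr⟩ := hK.isBounded.subset_closedBall (0 : E d)
  obtain ⟨R, hR⟩ := exists_nat_gt r
  refine ((sampleIndex ω R).finite_toSet.image fun p => (ω p.1).2 p.2).subset ?_
  rintro x ⟨hx, hxK⟩
  have := hr hxK
  simp only [Metric.mem_closedBall, dist_zero_right] at this
  exact samplePoints_eq hω hx (this.trans_lt hR)

open Classical in
/-- The configuration made of the points present in a sample. -/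
noncomputable def sampleConfig (ω : ℕ → ℕ × (ℕ → E d)) : Config d :=
  if h : ω ∈ regular d then ⟨samplePoints ω, samplePoints_locallyFinite h⟩
  else ⟨∅, fun K _ => by simp⟩

/-- On a regular sample different labels carry different points: shells are disjoint, and points of
one shell are distinct. So passing to the underlying set loses no multiplicity. -/
theorem pairing_sampleConfig {ω : ℕ → ℕ × (ℕ → E d)} (hω : ω ∈ regular d) {f : E d → ℝ} {R : ℕ}
    (hf : ∀ x, (R : ℝ) ≤ ‖x‖ → f x = 0) :
    pairing f (sampleConfig ω) = ∑ n ∈ Finset.range R, ∑ j ∈ Finset.range (ω n).1, f ((ω n).2 j) := by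
  classical
  have hval : (sampleConfig ω).1 = samplePoints ω := congrArg Subtype.val (dif_pos hω)
  rw [pairing, tsum_subtype, hval, tsum_eq_sum (s := (sampleIndex ω R).image fun p => (ω p.1).2 p.2),
    Finset.sum_image, sampleIndex, Finset.sum_sigma]
  · refine Finset.sum_congr rfl fun n _ => Finset.sum_congr rfl fun j hj => ?_
    exact Set.indicator_of_mem (s := samplePoints ω) ⟨n, j, Finset.mem_range.1 hj, rfl⟩ f
  · rintro ⟨n, i⟩ - ⟨n', j⟩ - h
    have h1 := mem_shell.1 (hω.1 n i)
    have h2 := mem_shell.1 (hω.1 n' j)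
    dsimp only at h
    have hn : n = n' := by rw [← h1, ← h2, h]
    subst hn
    by_contra hne
    exact hω.2 n i j (fun hij => hne (by rw [hij])) h
  · intro x hx
    by_cases hxs : x ∈ samplePoints ω
    · rw [Set.indicator_of_mem hxs]
      refine hf x (not_lt.1 fun hlt => hx ?_)
      obtain ⟨p, hp, hpx⟩ := samplePoints_eq hω hxs hlt
      exact Finset.mem_image.2 ⟨p, hp, hpx⟩
    · exact Set.indicator_of_notMem hxs _

theorem exists_nat_bound_support {f : E d → ℝ} (hf : HasCompactSupport f) :
    ∃ R : ℕ, ∀ x, (R : ℝ) ≤ ‖x‖ → f x = 0 := by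
  obtain ⟨r, hr⟩ := hf.isCompact.isBounded.subset_closedBall (0 : E d)
  obtain ⟨R, hR⟩ := exists_nat_gt r
  refine ⟨R, fun x hx => ?_⟩
  by_contra h0
  have := hr (subset_tsupport f h0)
  simp at this
  linarith

theorem measurable_sampleConfig : Measurable (sampleConfig (d := d)) := by
  classical
  refine measurable_config fun f hf hc => ?_
  obtain ⟨R, hR⟩ := exists_nat_bound_support hc
  have : (fun ω => pairing f (sampleConfig ω)) = (regular d).indicator
      fun ω => ∑ n ∈ Finset.range R, ∑ j ∈ Finset.range (ω n).1, f ((ω n).2 j) := by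
    ext ω
    by_cases hω : ω ∈ regular d
    · rw [Set.indicator_of_mem hω, pairing_sampleConfig hω hR]
    · have hval : (sampleConfig ω).1 = ∅ := congrArg Subtype.val (dif_neg hω)
      rw [Set.indicator_of_notMem hω, pairing, tsum_subtype, hval]
      simp
  rw [this]
  refine Measurable.indicator ?_ (measurableSet_regular d)
  refine Finset.measurable_fun_sum _ fun n _ => ?_
  exact (measurable_sum_range hf.measurable).comp (measurable_pi_apply n)

/-- The shells are independent. A shell of mass r in which e^φ has mean μ contributes exp(r(μ - 1)),
and r(μ - 1) is the integral of e^φ - 1 over the shell. -/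
theorem lintegral_exp_pairing_sampleConfig (hd : 1 ≤ d) (hac : m ≪ volume)
    (hm : ∀ n, m (shell d n) ≠ ⊤) {φ : E d → ℝ} (hφ : Continuous φ) (hc : HasCompactSupport φ)
    {R : ℕ} (hR : ∀ x, (R : ℝ) ≤ ‖x‖ → φ x = 0) :
    ∫⁻ ω, ENNReal.ofReal (Real.exp (pairing φ (sampleConfig ω))) ∂(shellSample m)
      = ENNReal.ofReal (Real.exp
          (∑ n ∈ Finset.range R, ∫ x in shell d n, (Real.exp (φ x) - 1) ∂m)) := by
  have := isProbabilityMeasure_shellLaw hd hm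
  have hmeas : Measurable fun x => ENNReal.ofReal (Real.exp (φ x)) := by
    have := hφ.measurable
    fun_prop
  let X : ℕ × (ℕ → E d) → ℝ≥0∞ :=
    fun q => ∏ j ∈ Finset.range q.1, ENNReal.ofReal (Real.exp (φ (q.2 j)))
  have hX : Measurable X := measurable_prod_range hmeas
  have h1 : ∀ᵐ ω ∂(shellSample m), ENNReal.ofReal (Real.exp (pairing φ (sampleConfig ω)))
      = ∏ n ∈ Finset.range R, X (ω n) := by
    filter_upwards [ae_regular hd hac hm] with ω hω
    rw [pairing_sampleConfig hω hR, Real.exp_sum, ENNReal.ofReal_prod_of_nonneg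
      (fun _ _ => Real.exp_nonneg _)]
    refine Finset.prod_congr rfl fun n _ => ?_
    rw [Real.exp_sum, ENNReal.ofReal_prod_of_nonneg (fun _ _ => Real.exp_nonneg _)]
  have hi : iIndepFun (fun n (ω : ℕ → ℕ × (ℕ → E d)) => X (ω n)) (shellSample m) :=
    iIndepFun_infinitePi (X := fun _ => X) fun _ => hX
  obtain ⟨M, hM⟩ : ∃ M, ∀ x, |φ x| ≤ M := by
    obtain ⟨M, hM⟩ := hφ.bounded_above_of_compact_support hc
    exact ⟨M, hM⟩
  have hbd : ∀ {μ : Measure (E d)} [IsFiniteMeasure μ],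
      Integrable (fun x => Real.exp (φ x)) μ := by
    intro μ _
    refine Integrable.of_bound (C := Real.exp M) (by fun_prop) (ae_of_all _ fun x => ?_)
    rw [Real.norm_eq_abs, Real.abs_exp]
    exact Real.exp_le_exp.2 ((le_abs_self _).trans (hM x))
  rw [lintegral_congr_ae h1, lintegral_prod_eq_prod_lintegral_of_indepFun _ _ hi
    (fun n => hX.comp (measurable_pi_apply n)), Real.exp_sum,
    ENNReal.ofReal_prod_of_nonneg (fun _ _ => Real.exp_nonneg _)]
  refine Finset.prod_congr rfl fun n _ => ?_
  have h2 : ∫⁻ ω, X (ω n) ∂(shellSample m)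
      = ∫⁻ q, X q ∂(markedPoisson (m (shell d n)).toNNReal (shellLaw m n)) :=
    (measurePreserving_eval_infinitePi
      (fun n => markedPoisson (m (shell d n)).toNNReal (shellLaw m n)) n).lintegral_comp hX
  have h3 : ∫⁻ x, ENNReal.ofReal (Real.exp (φ x)) ∂(shellLaw m n)
      = ENNReal.ofReal (∫ x, Real.exp (φ x) ∂(shellLaw m n)) :=
    (ofReal_integral_eq_lintegral_ofReal hbd (ae_of_all _ fun _ => Real.exp_nonneg _)).symm
  rw [h2, lintegral_markedPoisson_prod _ _ hmeas (integral_nonneg fun _ => Real.exp_nonneg _) h3]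
  congr 2
  have : IsFiniteMeasure (m.restrict (shell d n)) := ⟨by simpa using (hm n).lt_top⟩
  rw [integral_sub hbd (integrable_const _), integral_const, mul_sub, mul_one]
  have h4 := lintegral_shellLaw hm n (fun x => ENNReal.ofReal (Real.exp (φ x)))
  rw [h3, ← ofReal_integral_eq_lintegral_ofReal hbd (ae_of_all _ fun _ => Real.exp_nonneg _)] at h4
  have h5 := congrArg ENNReal.toReal h4
  rw [ENNReal.toReal_mul, ENNReal.toReal_ofReal (integral_nonneg fun _ => Real.exp_nonneg _),
    ENNReal.toReal_ofReal (integral_nonneg fun _ => Real.exp_nonneg _)] at h5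
  rw [← h5]
  simp [measureReal_def, ENNReal.coe_toNNReal_eq_toReal]

end existence

/-- The image of the shell sample works: the shells tile the space, and only the first `R` of them
meet the support of a given test function. -/
theorem exists_isPoisson {d : ℕ} (hd : 1 ≤ d) {z : E d → ℝ} (hz : Measurable z)
    (hz0 : ∀ x, 0 ≤ z x) {C : ℝ} (hC : ∀ x, z x ≤ C) : ∃ π : Measure (Config d), IsPoisson z π := by
  set m : Measure (E d) := volume.withDensity fun x => ENNReal.ofReal (z x) with hm_def
  have hac : m ≪ volume := withDensity_absolutelyContinuous _ _
  have hm : ∀ n, m (shell d n) ≠ ⊤ := by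
    intro n
    rw [hm_def, withDensity_apply _ (measurableSet_shell d n)]
    refine ((setLIntegral_mono measurable_const (g := fun _ => ENNReal.ofReal C) fun x _ =>
      ENNReal.ofReal_le_ofReal (hC x)).trans_lt ?_).ne
    rw [setLIntegral_const]
    exact ENNReal.mul_lt_top ENNReal.ofReal_lt_top (volume_shell_lt_top d n)
  have := isProbabilityMeasure_shellLaw hd hm
  have : IsProbabilityMeasure (shellSample m) := by unfold shellSample; infer_instance
  refine ⟨(shellSample m).map sampleConfig,
    Measure.isProbabilityMeasure_map measurable_sampleConfig.aemeasurable, fun φ hφ => ?_⟩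
  obtain ⟨R, hR⟩ := exists_nat_bound_support hφ.2
  have hφm := measurable_pairing hφ.1.continuous hφ.2
  rw [lintegral_map (by fun_prop) measurable_sampleConfig,
    lintegral_exp_pairing_sampleConfig hd hac hm hφ.1.continuous hφ.2 hR]
  congr 2
  have hcu : HasCompactSupport fun x => (Real.exp (φ x) - 1) * z x := by
    refine HasCompactSupport.mul_right ?_
    exact hφ.2.comp_left (g := fun y => Real.exp y - 1) (by simp)
  have hint : Integrable fun x => (Real.exp (φ x) - 1) * z x := by
    have h1 : Integrable fun x => Real.exp (φ x) - 1 :=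
      Continuous.integrable_of_hasCompactSupport
        ((Real.continuous_exp.comp hφ.1.continuous).sub continuous_const)
        (hφ.2.comp_left (g := fun y => Real.exp y - 1) (by simp))
    refine h1.mul_bdd (c := C) hz.aestronglyMeasurable (ae_of_all _ fun x => ?_)
    rw [Real.norm_of_nonneg (hz0 x)]
    exact hC x
  have h1 : ∀ n, ∫ x in shell d n, (Real.exp (φ x) - 1) ∂m
      = ∫ x in shell d n, (Real.exp (φ x) - 1) * z x := by
    intro n
    rw [hm_def, setIntegral_withDensity_eq_setIntegral_toReal_smul₀ (by fun_prop)
      (ae_of_all _ fun _ => ENNReal.ofReal_lt_top) _ (measurableSet_shell d n)]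
    refine integral_congr_ae (ae_of_all _ fun x => ?_)
    simp [ENNReal.toReal_ofReal (hz0 x), mul_comm]
  simp_rw [h1]
  rw [← integral_biUnion_finset _ (fun n _ => measurableSet_shell d n) _
    (fun n _ => hint.integrableOn)]
  · refine setIntegral_eq_integral_of_forall_compl_eq_zero fun x hx => ?_
    have : (R : ℝ) ≤ ‖x‖ := by
      by_contra hlt
      refine hx (Set.mem_biUnion (x := ⌊‖x‖⌋₊) ?_ (mem_shell.2 rfl))
      simpa using (Nat.floor_lt (norm_nonneg _)).2 (not_le.1 hlt)
    simp [hR x this]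
  · intro i _ j _ hij
    refine Set.disjoint_left.2 fun x hi hj => hij ?_
    rw [← mem_shell.1 hi, ← mem_shell.1 hj]

/-- Only the Laplace transform on test functions is used afterwards, so it does not matter which
measure the choice in `poisson` selects. -/
theorem isPoisson_poisson {d : ℕ} (hd : 1 ≤ d) {z : E d → ℝ} (hz : Measurable z)
    (hz0 : ∀ x, 0 ≤ z x) {C : ℝ} (hC : ∀ x, z x ≤ C) : IsPoisson z (poisson z) := by
  have h := exists_isPoisson hd hz hz0 hC
  rw [poisson, dif_pos h]
  exact h.choose_spec

/-! ### Poisson configurations are almost surely in Θ -/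

theorem ncard_le_pairing {d : ℕ} (γ : Config d) (k : ℕ) :
    ((γ.1 ∩ Metric.closedBall (0 : E d) ((k : ℝ) + 1)).ncard : ℝ) ≤ pairing (cutoff d k) γ := by
  have hfin := γ.2 _ (isCompact_closedBall (0 : E d) ((k : ℝ) + 1))
  have hs : Summable (γ.1.indicator (cutoff d k)) :=
    summable_subtype_iff_indicator.1 (γ.summable (cutoff d k).hasCompactSupport)
  rw [pairing, tsum_subtype, Set.ncard_eq_toFinset_card _ hfin]
  calc (hfin.toFinset.card : ℝ) = ∑ x ∈ hfin.toFinset, γ.1.indicator (cutoff d k) x := by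
        rw [Finset.card_eq_sum_ones, Nat.cast_sum]
        refine Finset.sum_congr rfl fun x hx => ?_
        have hx' : x ∈ γ.1 ∩ Metric.closedBall (0 : E d) ((k : ℝ) + 1) := by simpa using hx
        rw [Set.indicator_of_mem hx'.1, cutoff_eq_one (by simpa using hx'.2)]
        simp
    _ ≤ _ := hs.sum_le_tsum _ fun x _ => Set.indicator_nonneg (fun _ _ => (cutoff d k).nonneg) x

theorem isTestFunction_cutoff (d n : ℕ) : IsTestFunction (cutoff d n) :=
  ⟨(cutoff d n).contDiff, (cutoff d n).hasCompactSupport⟩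

theorem volume_real_closedBall {d : ℕ} (hd : 1 ≤ d) {r : ℝ} (hr : 0 ≤ r) :
    volume.real (Metric.closedBall (0 : E d) r)
      = r ^ d * volume.real (Metric.closedBall (0 : E d) 1) := by
  have : Nonempty (Fin d) := ⟨⟨0, hd⟩⟩
  rw [measureReal_def, measureReal_def, Measure.addHaar_closedBall _ _ hr,
    Measure.addHaar_closedBall _ _ zero_le_one, ENNReal.toReal_mul, ENNReal.toReal_mul,
    ENNReal.toReal_ofReal (by positivity), ENNReal.toReal_ofReal (by positivity)]
  simp

theorem volume_real_closedBall_one_pos (d : ℕ) :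
    0 < volume.real (Metric.closedBall (0 : E d) 1) :=
  ENNReal.toReal_pos (Metric.measure_closedBall_pos _ _ one_pos).ne'
    measure_closedBall_lt_top.ne

/-- The exponential Markov (Chernoff) inequality. -/
theorem measure_lt_pairing_le {d : ℕ} {z : E d → ℝ} {π : Measure (Config d)} (hπ : IsPoisson z π)
    {φ : E d → ℝ} (hφ : IsTestFunction φ) (c : ℝ) :
    π {γ | c < pairing φ γ}
      ≤ ENNReal.ofReal (Real.exp ((∫ x, (Real.exp (φ x) - 1) * z x) - c)) := by
  have hm := measurable_pairing hφ.1.continuous hφ.2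
  have h1 := mul_meas_ge_le_lintegral (μ := π)
    (f := fun γ => ENNReal.ofReal (Real.exp (pairing φ γ))) (by fun_prop)
    (ENNReal.ofReal (Real.exp c))
  rw [hπ.2 φ hφ] at h1
  have h2 : π {γ | c < pairing φ γ}
      ≤ π {γ | ENNReal.ofReal (Real.exp c) ≤ ENNReal.ofReal (Real.exp (pairing φ γ))} :=
    measure_mono fun γ (hγ : c < pairing φ γ) =>
      ENNReal.ofReal_le_ofReal (Real.exp_le_exp.2 hγ.le)
  rw [Real.exp_sub, ENNReal.ofReal_div_of_pos (Real.exp_pos _),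
    ENNReal.le_div_iff_mul_le (Or.inl (by simpa using Real.exp_pos c)) (Or.inl ENNReal.ofReal_ne_top),
    mul_comm]
  exact (mul_le_mul_right h2 _).trans h1

/-- Chernoff's bound makes the probability of too many points in the ball of radius k + 1
exponentially small in k. By Borel–Cantelli only finitely many radii are bad, and a larger constant
absorbs them. -/
theorem ae_mem_Theta {d : ℕ} (hd : 1 ≤ d) {z : E d → ℝ} (hz0 : ∀ x, 0 ≤ z x)
    {C : ℝ} (hC : ∀ x, z x ≤ C) {π : Measure (Config d)} (hπ : IsPoisson z π) :
    ∀ᵐ γ ∂π, γ ∈ Theta d := by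
  have hC0 : 0 ≤ C := (hz0 0).trans (hC 0)
  set v := volume.real (Metric.closedBall (0 : E d) 1) with hv_def
  have hv : 0 < v := volume_real_closedBall_one_pos d
  set V : ℕ → ℝ := fun k => volume.real (Metric.closedBall (0 : E d) ((k : ℝ) + 1)) with hV_def
  have hV : ∀ k, V k = ((k : ℝ) + 1) ^ d * v := fun k => volume_real_closedBall hd (by positivity)
  have hV0 : ∀ k, 0 < V k := fun k => by rw [hV]; positivity
  -- The exponent integral is at most `2 * C * 2 ^ d * V k`: e - 1 ≤ 2, and the cutoff lives on
  -- radius k + 2 ≤ 2(k + 1). The extra `1` leaves the decay exp(-`V k`).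
  obtain ⟨m, hm⟩ := exists_nat_ge (2 * C * 2 ^ d + 1)
  have hI : ∀ k, ∫ x, (Real.exp (cutoff d k x) - 1) * z x ≤ 2 * C * 2 ^ d * V k := by
    intro k
    have h1 : ∫ x, (Real.exp (cutoff d k x) - 1) * z x
        ≤ ∫ x, (Metric.closedBall (0 : E d) ((k : ℝ) + 2)).indicator (fun _ => 2 * C) x := by
      refine integral_mono_of_nonneg (ae_of_all _ fun x => ?_) ?_ (ae_of_all _ fun x => ?_)
      · have := Real.one_le_exp ((cutoff d k).nonneg (x := x))
        exact mul_nonneg (by linarith) (hz0 x)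
      · exact (integrable_indicator_iff measurableSet_closedBall).2
          (integrableOn_const measure_closedBall_lt_top.ne)
      · by_cases hx : ‖x‖ ≤ (k : ℝ) + 2
        · rw [Set.indicator_of_mem (by simpa using hx)]
          have h3 : Real.exp (cutoff d k x) ≤ Real.exp 1 :=
            Real.exp_le_exp.2 (cutoff d k).le_one
          have h4 := Real.exp_one_lt_d9
          exact mul_le_mul (by linarith) (hC x) (hz0 x) (by norm_num)
        · rw [Set.indicator_of_notMem (by simpa using hx)]
          simp [cutoff_eq_zero (not_le.1 hx).le]
    refine h1.trans ?_
    rw [integral_indicator measurableSet_closedBall, setIntegral_const, smul_eq_mul,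
      volume_real_closedBall hd (by positivity), hV, ← hv_def]
    have h2 : ((k : ℝ) + 2) ^ d ≤ 2 ^ d * ((k : ℝ) + 1) ^ d := by
      rw [← mul_pow]
      exact pow_le_pow_left₀ (by positivity) (by linarith) d
    calc ((k : ℝ) + 2) ^ d * v * (2 * C) ≤ (2 ^ d * ((k : ℝ) + 1) ^ d) * v * (2 * C) := by gcongr
      _ = _ := by ring
  have hb : ∀ k, π {γ | m * V k < pairing (cutoff d k) γ}
      ≤ ENNReal.ofReal (Real.exp (-v) ^ k) := by
    intro k
    refine (measure_lt_pairing_le hπ (isTestFunction_cutoff d k) _).trans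
      (ENNReal.ofReal_le_ofReal ?_)
    rw [← Real.exp_nat_mul]
    refine Real.exp_le_exp.2 ?_
    have h1 := hI k
    have h2 : (2 * C * 2 ^ d + 1) * V k ≤ m * V k := mul_le_mul_of_nonneg_right hm (hV0 k).le
    have h3 : (k : ℝ) * v ≤ V k := by
      rw [hV]
      gcongr
      calc (k : ℝ) ≤ (k : ℝ) + 1 := by linarith
        _ ≤ ((k : ℝ) + 1) ^ d := le_self_pow₀ (by linarith [(Nat.cast_nonneg k : (0 : ℝ) ≤ k)]) (by lia)
    linarith
  have hsum : ∑' k, π {γ | m * V k < pairing (cutoff d k) γ} ≠ ⊤ := by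
    refine ne_top_of_le_ne_top ?_ (ENNReal.tsum_le_tsum hb)
    rw [← ENNReal.ofReal_tsum_of_nonneg (fun k => by positivity)
      (summable_geometric_of_lt_one (Real.exp_nonneg _) (by simpa using hv))]
    exact ENNReal.ofReal_ne_top
  filter_upwards [ae_finite_setOfPred_mem hsum] with γ hγ
  have hγ' : {k : ℕ | m * V k < pairing (cutoff d k) γ}.Finite := hγ
  set N : ℕ → ℝ := fun k => pairing (cutoff d k) γ with hN_def
  have hN0 : ∀ k, 0 ≤ N k := fun k => tsum_nonneg fun x => (cutoff d k).nonneg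
  -- The sum of the density ratios over the finitely many exceptional radii dominates each of them.
  obtain ⟨M, hM⟩ := exists_nat_ge ((m : ℝ) + ∑ k ∈ hγ'.toFinset, N k / V k)
  refine ⟨M, fun n hn => ?_⟩
  obtain ⟨k, rfl⟩ : ∃ k, n = k + 1 := ⟨n - 1, by lia⟩
  push_cast
  refine (ncard_le_pairing γ k).trans ?_
  change N k ≤ M * V k
  have hs0 : 0 ≤ ∑ k ∈ hγ'.toFinset, N k / V k :=
    Finset.sum_nonneg fun j _ => div_nonneg (hN0 j) (hV0 j).le
  by_cases hk : m * V k < N k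
  · have h1 : N k / V k ≤ ∑ k ∈ hγ'.toFinset, N k / V k :=
      Finset.single_le_sum (f := fun k => N k / V k)
        (fun j _ => div_nonneg (hN0 j) (hV0 j).le) (by simpa using hk)
    rw [← div_le_iff₀ (hV0 k)]
    have : (0 : ℝ) ≤ m := Nat.cast_nonneg m
    linarith
  · exact (not_lt.1 hk).trans (mul_le_mul_of_nonneg_right (by linarith) (hV0 k).le)

/-! ### Poisson processes from exponential waiting times -/

instance : IsProbabilityMeasure (expMeasure 1) := isProbabilityMeasure_expMeasure one_pos

/-- The law of independent unit-rate waiting times. -/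
noncomputable def waitingLaw : Measure (ℕ → ℝ) := Measure.infinitePi fun _ : ℕ => expMeasure 1

instance : IsProbabilityMeasure waitingLaw := by unfold waitingLaw; infer_instance

/-- The distribution function of the sum of `n` unit-rate waiting times. -/
noncomputable def arrivalCdf (n : ℕ) (x : ℝ) : ℝ :=
  1 - Real.exp (-x) * ∑ k ∈ Finset.range n, x ^ k / k.factorial

theorem arrivalCdf_nonneg (n : ℕ) {x : ℝ} (hx : 0 ≤ x) : 0 ≤ arrivalCdf n x := by
  have h := mul_le_mul_of_nonneg_left (Real.sum_le_exp_of_nonneg hx n) (Real.exp_nonneg (-x))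
  rw [← Real.exp_add, neg_add_cancel, Real.exp_zero] at h
  unfold arrivalCdf
  linarith

theorem arrivalCdf_sub (n : ℕ) (x : ℝ) :
    arrivalCdf n x - arrivalCdf (n + 1) x = Real.exp (-x) * x ^ n / n.factorial := by
  unfold arrivalCdf
  rw [Finset.sum_range_succ]
  ring

theorem tendsto_arrivalCdf (x : ℝ) : Tendsto (fun n => arrivalCdf n x) atTop (𝓝 0) := by
  have h := (NormedSpace.expSeries_div_hasSum_exp x).tendsto_sum_nat
  rw [← Real.exp_eq_exp_ℝ] at h
  have h2 := (h.const_mul (Real.exp (-x))).const_sub 1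
  rwa [← Real.exp_add, neg_add_cancel, Real.exp_zero, sub_self] at h2

/-- The renewal recursion obtained by conditioning on one waiting time. As e^{-s} e^{-(x-s)} =
e^{-x} does not depend on s, the integrand has an elementary antiderivative. -/
theorem arrivalCdf_succ (n : ℕ) {x : ℝ} (hx : 0 ≤ x) :
    ∫ s in Set.Icc 0 x, Real.exp (-s) * arrivalCdf n (x - s) = arrivalCdf (n + 1) x := by
  rw [integral_Icc_eq_integral_Ioc, ← intervalIntegral.integral_of_le hx]
  have hderiv : ∀ s ∈ Set.uIcc 0 x, HasDerivAt (fun s => -Real.exp (-s) + Real.exp (-x) *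
      ∑ k ∈ Finset.range n, (x - s) ^ (k + 1) / (k + 1).factorial)
      (Real.exp (-s) * arrivalCdf n (x - s)) s := by
    intro s _
    have h1 : HasDerivAt (fun s : ℝ => -Real.exp (-s)) (Real.exp (-s)) s := by
      have h := (hasDerivAt_neg s).exp.fun_neg
      simpa using h
    have h2 : HasDerivAt (fun s : ℝ => ∑ k ∈ Finset.range n, (x - s) ^ (k + 1) / (k + 1).factorial)
        (∑ k ∈ Finset.range n, -((x - s) ^ k / k.factorial)) s := by
      refine HasDerivAt.fun_sum fun k _ => ?_
      have h3 := (((hasDerivAt_id s).const_sub x).pow (k + 1)).div_const ((k + 1).factorial : ℝ)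
      convert! h3 using 1
      rw [Nat.factorial_succ]
      push_cast
      have : (k.factorial : ℝ) ≠ 0 := by positivity
      have : ((k : ℝ) + 1) ≠ 0 := by positivity
      simp only [id]
      field_simp
    convert! h1.add (h2.const_mul (Real.exp (-x))) using 1
    rw [Finset.sum_neg_distrib, arrivalCdf, mul_sub, mul_one, ← mul_assoc, ← Real.exp_add,
      show -s + -(x - s) = -x by ring]
    ring
  have hcont : Continuous fun s => Real.exp (-s) * arrivalCdf n (x - s) := by
    unfold arrivalCdf
    fun_prop
  rw [intervalIntegral.integral_eq_sub_of_hasDerivAt hderiv (hcont.intervalIntegrable _ _)]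
  simp only [sub_self, neg_zero, Real.exp_zero, sub_zero, arrivalCdf]
  rw [Finset.sum_range_succ']
  simp
  ring

theorem map_sum_range_succ_infinitePi {V : Type*} [AddCommMonoid V] [MeasurableSpace V]
    [MeasurableAdd₂ V] (ρ : Measure V) [IsProbabilityMeasure ρ] (n : ℕ) :
    (Measure.infinitePi fun _ : ℕ => ρ).map (fun y => ∑ k ∈ Finset.range (n + 1), y k)
      = (Measure.infinitePi fun _ : ℕ => ρ).map (fun y => ∑ k ∈ Finset.range n, y k) ∗ ρ := by
  have hi : iIndepFun (fun (i : ℕ) (y : ℕ → V) => y i) (Measure.infinitePi fun _ : ℕ => ρ) :=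
    iIndepFun_infinitePi (X := fun _ => id) fun _ => measurable_id
  have h := hi.indepFun_finsetSum_of_notMem (fun i => measurable_pi_apply i)
    (s := Finset.range n) (i := n) (by simp)
  have h2 := h.map_add_eq_map_conv_map (by fun_prop) (by fun_prop)
  rw [Measure.infinitePi_map_eval] at h2
  convert! h2 using 2
  · ext y
    simp [Finset.sum_range_succ]
  · congr 1
    ext y
    simp

theorem expMeasure_eq : expMeasure 1 = volume.withDensity (exponentialPDF 1) := rfl

theorem measurable_exponentialPDF : Measurable (exponentialPDF 1) :=
  (measurable_exponentialPDFReal 1).ennreal_ofReal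

/-- Induction on `n`: the last waiting time enters by convolution, and its exponential density
reduces the claim to `arrivalCdf_succ`. -/
theorem map_sum_waitingLaw_Iic (n : ℕ) (x : ℝ) :
    waitingLaw.map (fun T => ∑ k ∈ Finset.range n, T k) (Set.Iic x)
      = if 0 ≤ x then ENNReal.ofReal (arrivalCdf n x) else 0 := by
  induction n generalizing x with
  | zero =>
    simp only [Finset.range_zero, Finset.sum_empty, arrivalCdf, mul_zero, sub_zero,
      ENNReal.ofReal_one]
    rw [Measure.map_const, measure_univ, one_smul, Measure.dirac_apply' _ measurableSet_Iic]
    by_cases h : 0 ≤ x <;> simp [h]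
  | succ n ih =>
    have : IsProbabilityMeasure (waitingLaw.map (fun T => ∑ k ∈ Finset.range n, T k)) :=
      Measure.isProbabilityMeasure_map (by fun_prop)
    have hfm : Measurable fun s : ℝ =>
        waitingLaw.map (fun T => ∑ k ∈ Finset.range n, T k) (Set.Iic (x - s)) := by
      have : Antitone fun s : ℝ =>
          waitingLaw.map (fun T => ∑ k ∈ Finset.range n, T k) (Set.Iic (x - s)) :=
        fun s t hst => measure_mono (Set.Iic_subset_Iic.2 (by linarith))
      exact this.measurable
    have h1 : waitingLaw.map (fun T => ∑ k ∈ Finset.range (n + 1), T k) (Set.Iic x)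
        = ∫⁻ s, waitingLaw.map (fun T => ∑ k ∈ Finset.range n, T k) (Set.Iic (x - s))
            ∂(expMeasure 1) := by
      unfold waitingLaw at this ⊢
      rw [map_sum_range_succ_infinitePi, Measure.conv_comm, ← lintegral_indicator_one measurableSet_Iic,
        Measure.lintegral_conv (measurable_one.indicator measurableSet_Iic)]
      refine lintegral_congr fun s => ?_
      rw [← lintegral_indicator_one measurableSet_Iic]
      refine lintegral_congr fun y => ?_
      simp only [Set.indicator_apply, Set.mem_Iic, le_sub_iff_add_le', Pi.one_apply]
    rw [h1, expMeasure_eq, lintegral_withDensity_eq_lintegral_mul _ measurable_exponentialPDF hfm]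
    have h2 : ∀ s : ℝ, (exponentialPDF 1 * fun s : ℝ =>
          waitingLaw.map (fun T => ∑ k ∈ Finset.range n, T k) (Set.Iic (x - s))) s
        = (Set.Icc 0 x).indicator
            (fun s => ENNReal.ofReal (Real.exp (-s) * arrivalCdf n (x - s))) s := by
      intro s
      rw [Pi.mul_apply, ih, exponentialPDF_eq]
      by_cases h0 : 0 ≤ s
      · by_cases hx : s ≤ x
        · rw [Set.indicator_of_mem (Set.mem_Icc.2 ⟨h0, hx⟩), if_pos h0, if_pos (by linarith),
            ← ENNReal.ofReal_mul (by positivity)]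
          simp
        · rw [Set.indicator_of_notMem (fun h => hx h.2), if_pos h0,
            if_neg (by linarith), mul_zero]
      · rw [Set.indicator_of_notMem (fun h => h0 h.1), if_neg h0]
        simp
    rw [lintegral_congr h2, lintegral_indicator measurableSet_Icc]
    by_cases hx : 0 ≤ x
    · rw [if_pos hx, ← arrivalCdf_succ n hx, ofReal_integral_eq_lintegral_ofReal]
      · refine Continuous.integrableOn_Icc ?_
        unfold arrivalCdf
        fun_prop
      · refine (ae_restrict_mem measurableSet_Icc).mono fun s hs => ?_
        exact mul_nonneg (Real.exp_nonneg _) (arrivalCdf_nonneg n (by linarith [hs.2]))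
    · rw [if_neg hx, Set.Icc_eq_empty hx]
      simp

/-- The number of arrivals up to time `x`. -/
noncomputable def arrivalCount (x : ℝ) (T : ℕ → ℝ) : ℕ :=
  {n : ℕ | ∑ i ∈ Finset.range (n + 1), T i ≤ x}.ncard

/-- There are countably many finite sets of indices, and each is the value on a measurable event.
The level 0 also receives the infinite sets, whose `ncard` is 0 by convention. -/
theorem measurable_ncard {Ω : Type*} [MeasurableSpace Ω] {p : ℕ → Ω → Prop}
    (hp : ∀ n, MeasurableSet {ω | p n ω}) : Measurable fun ω => {n : ℕ | p n ω}.ncard := by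
  have hF : ∀ F : Finset ℕ, MeasurableSet {ω | {n : ℕ | p n ω} = ↑F} := by
    intro F
    have : {ω | {n : ℕ | p n ω} = ↑F}
        = (⋂ n ∈ F, {ω | p n ω}) ∩ ⋂ (n : ℕ) (_ : n ∉ F), {ω | p n ω}ᶜ := by
      ext ω
      simp only [Set.mem_ofPred_eq, Set.ext_iff, Set.mem_inter_iff, Set.mem_iInter,
        Set.mem_compl_iff, Finset.mem_coe]
      grind
    rw [this]
    exact (Finset.measurableSet_biInter _ fun n _ => hp n).inter
      (.iInter fun n => .iInter fun _ => (hp n).compl)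
  refine measurable_to_countable' fun k => ?_
  have : (fun ω => {n : ℕ | p n ω}.ncard) ⁻¹' {k}
      = (⋃ (F : Finset ℕ) (_ : F.card = k), {ω | {n : ℕ | p n ω} = ↑F}) ∪
        (if k = 0 then (⋃ F : Finset ℕ, {ω | {n : ℕ | p n ω} = ↑F})ᶜ else ∅) := by
    ext ω
    by_cases hfin : {n : ℕ | p n ω}.Finite
    · obtain ⟨F, hF⟩ := hfin.exists_finset_coe
      have h2 : (ω ∈ (if k = 0 then (⋃ F : Finset ℕ, {ω | {n : ℕ | p n ω} = ↑F})ᶜ else ∅)) ↔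
          False := by
        split_ifs
        · simp [← hF]
        · simp
      rw [Set.mem_union, h2, or_false]
      simp [← hF]
    · have h3 : ∀ F : Finset ℕ, {n : ℕ | p n ω} ≠ ↑F := fun F h => hfin (h ▸ F.finite_toSet)
      have h4 : {n : ℕ | p n ω}.ncard = 0 := Set.Infinite.ncard hfin
      by_cases hk : k = 0
      · simp [h3, hk, h4]
      · simp [h3, hk, h4, Ne.symm hk]
  rw [this]
  refine (MeasurableSet.iUnion fun F => .iUnion fun _ => hF F).union ?_
  split_ifs
  · exact (MeasurableSet.iUnion fun F => hF F).compl
  · exact .empty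

theorem measurable_arrivalCount (x : ℝ) : Measurable (arrivalCount x) :=
  measurable_ncard fun _ => measurableSet_le
    (Finset.measurable_fun_sum _ fun i _ => measurable_pi_apply i) measurable_const

theorem waitingLaw_sum_le (n : ℕ) {x : ℝ} (hx : 0 ≤ x) :
    waitingLaw {T | ∑ k ∈ Finset.range n, T k ≤ x} = ENNReal.ofReal (arrivalCdf n x) := by
  have h := map_sum_waitingLaw_Iic n x
  rw [if_pos hx, Measure.map_apply (by fun_prop) measurableSet_Iic] at h
  exact h

theorem ae_waitingLaw_nonneg : ∀ᵐ T ∂waitingLaw, ∀ n, 0 ≤ T n := by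
  refine ae_all_iff.2 fun n => ?_
  have h : ∀ᵐ s ∂(expMeasure 1), 0 ≤ s := by
    rw [expMeasure_eq, ae_withDensity_iff measurable_exponentialPDF]
    refine ae_of_all _ fun s hs => ?_
    by_contra h
    exact hs (exponentialPDF_of_neg (not_le.1 h))
  exact (measurePreserving_eval_infinitePi (fun _ : ℕ => expMeasure 1) n).quasiMeasurePreserving.ae h

/-- No explosion: the probability that all partial sums stay below x is at most `arrivalCdf n x` for
every n, which tends to 0. -/
theorem ae_waitingLaw_exists {x : ℝ} (hx : 0 ≤ x) :
    ∀ᵐ T ∂waitingLaw, ∃ n, x < ∑ k ∈ Finset.range n, T k := by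
  rw [ae_iff]
  simp only [not_exists, not_lt]
  have hle : ∀ n, waitingLaw {T | ∀ m, ∑ k ∈ Finset.range m, T k ≤ x}
      ≤ ENNReal.ofReal (arrivalCdf n x) := fun m => by
    rw [← waitingLaw_sum_le m hx]
    exact measure_mono fun T hT => hT m
  have hlim := (ENNReal.continuous_ofReal.tendsto 0).comp (tendsto_arrivalCdf x)
  rw [ENNReal.ofReal_zero] at hlim
  exact le_antisymm (ge_of_tendsto' hlim hle) zero_le

theorem lt_ncard_iff_of_isLowerSet {A : Set ℕ} (hA : IsLowerSet A) (hfin : A.Finite) (k : ℕ) :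
    k < A.ncard ↔ k ∈ A := by
  obtain ⟨m, rfl⟩ : ∃ m, A = Set.Iio m := by
    rcases hA.eq_univ_or_Iio with h | ⟨m, h⟩
    · exact absurd (h ▸ hfin) Set.infinite_univ.not_finite
    · exact ⟨m, h⟩
  rw [Set.ncard_eq_toFinset_card']
  simp

/-- Almost surely the waiting times are nonnegative and their sums exceed x, so the indices counted
form a finite initial segment of ℕ. Index n stands for the arrival n + 1, whence the shift in the
successor case. -/
theorem ae_le_arrivalCount_iff {x : ℝ} (hx : 0 ≤ x) : ∀ᵐ T ∂waitingLaw, ∀ k,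
    k ≤ arrivalCount x T ↔ ∑ i ∈ Finset.range k, T i ≤ x := by
  filter_upwards [ae_waitingLaw_nonneg, ae_waitingLaw_exists hx] with T h0 ⟨N, hN⟩ k
  have hmono : Monotone fun n => ∑ i ∈ Finset.range n, T i := monotone_nat_of_le_succ fun n => by
    rw [Finset.sum_range_succ]
    linarith [h0 n]
  cases k with
  | zero => simpa using hx
  | succ k =>
    rw [Nat.succ_le_iff, arrivalCount, lt_ncard_iff_of_isLowerSet]
    · rfl
    · exact fun a b hab (ha : _ ≤ x) => (hmono (Nat.succ_le_succ hab)).trans ha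
    · refine (Set.finite_Iio N).subset fun n (hn : _ ≤ x) => ?_
      by_contra h
      have : N ≤ n + 1 := by simp at h; lia
      linarith [hmono this]

/-- The tail probabilities of the count are `arrivalCdf`, and consecutive differences of these are
the Poisson weights. -/
theorem map_arrivalCount {x : ℝ} (hx : 0 ≤ x) :
    waitingLaw.map (arrivalCount x) = poissonMeasure x.toNNReal := by
  have hA : ∀ k, waitingLaw (arrivalCount x ⁻¹' Set.Ici k) = ENNReal.ofReal (arrivalCdf k x) := by
    intro k
    rw [← waitingLaw_sum_le k hx]
    refine measure_congr ?_
    filter_upwards [ae_le_arrivalCount_iff hx] with T hT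
    exact propext (hT k)
  refine Measure.ext_of_singleton fun k => ?_
  have hk : arrivalCount x ⁻¹' {k}
      = (arrivalCount x ⁻¹' Set.Ici k) \ (arrivalCount x ⁻¹' Set.Ici (k + 1)) := by
    ext T
    simp only [Set.mem_preimage, Set.mem_singleton_iff, Set.mem_sdiff, Set.mem_Ici]
    lia
  rw [Measure.map_apply (measurable_arrivalCount x) (measurableSet_singleton k),
    poissonMeasure_singleton, Real.coe_toNNReal x hx, ← arrivalCdf_sub,
    ENNReal.ofReal_sub _ (arrivalCdf_nonneg _ hx), ← hA, ← hA, hk]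
  exact measure_sdiff (Set.preimage_mono (Set.Ici_subset_Ici.2 (Nat.le_succ k)))
    ((measurable_arrivalCount x) measurableSet_Ici).nullMeasurableSet (measure_ne_top _ _)

/-! ### The law of the jump process -/

/-- Separates the waiting times from the steps: independent pairs are a pair of independent
sequences. The product measure is determined by finite cylinders, where this is the rearrangement of
a finite product. -/
theorem infinitePi_prod_eq_map {α β : Type*} [MeasurableSpace α] [MeasurableSpace β]
    (μ : Measure α) (ν : Measure β) [IsProbabilityMeasure μ] [IsProbabilityMeasure ν] :
    (Measure.infinitePi fun _ : ℕ => μ.prod ν)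
      = ((Measure.infinitePi fun _ : ℕ => μ).prod (Measure.infinitePi fun _ : ℕ => ν)).map
          fun p n => (p.1 n, p.2 n) := by
  symm
  have hzip : Measurable fun (p : (ℕ → α) × (ℕ → β)) (n : ℕ) => (p.1 n, p.2 n) := by fun_prop
  refine Measure.eq_infinitePi _ fun s t ht => ?_
  rw [Measure.map_apply hzip (.pi s.countable_toSet fun _ _ => ht _)]
  let e := MeasurableEquiv.arrowProdEquivProdArrow α β s
  let B : Set (s → α × β) := Set.univ.pi fun i => t i
  have hB : MeasurableSet B := .univ_pi fun i => ht i
  have hpre : (fun (p : (ℕ → α) × (ℕ → β)) (n : ℕ) => (p.1 n, p.2 n)) ⁻¹' (s : Set ℕ).pi t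
      = Prod.map s.restrict s.restrict ⁻¹' (e.symm ⁻¹' B) := by
    ext p
    simp only [Set.mem_preimage, Set.mem_pi, Finset.mem_coe, B, Set.mem_univ, true_imp_iff,
      Subtype.forall]
    rfl
  have h1 := measurePreserving_arrowProdEquivProdArrow α β s (fun _ => μ) (fun _ => ν)
  rw [hpre, ← Measure.map_apply (by fun_prop) (e.symm.measurable hB),
    ← Measure.map_prod_map _ _ (by fun_prop) (by fun_prop), Measure.infinitePi_map_restrict,
    Measure.infinitePi_map_restrict, ← h1.map_eq,
    Measure.map_apply h1.measurable (e.symm.measurable hB), ← Set.preimage_comp]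
  have h2 : (e.symm ∘ MeasurableEquiv.arrowProdEquivProdArrow α β s) ⁻¹' B = B := by
    ext p
    simp [e]
  rw [h2, Measure.pi_pi]
  exact Finset.prod_coe_sort s fun i => (μ.prod ν) (t i)

/-- The compound Poisson law. -/
noncomputable def compoundPoisson {V : Type*} [MeasurableSpace V] [AddCommMonoid V] (r : NNReal)
    (ρ : Measure V) : Measure V :=
  (markedPoisson r ρ).map fun q => ∑ k ∈ Finset.range q.1, q.2 k

/-- The sum of the steps made up to time `t`. -/
noncomputable def jumpSum {d : ℕ} (a : E d → ℝ) (t : ℝ) (ω : Sample d) : E d :=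
  ∑ k ∈ Finset.range (jumpCount a t ω), (ω k).2

theorem jumpProcess_eq {d : ℕ} (a : E d → ℝ) (x : E d) (t : ℝ) (ω : Sample d) :
    jumpProcess a x t ω = x - jumpSum a t ω := rfl

theorem jumpSum_eq {d : ℕ} (a : E d → ℝ) (t : ℝ) :
    jumpSum a t = (fun q : ℕ × (ℕ → E d) => ∑ k ∈ Finset.range q.1, q.2 k) ∘
      fun ω : Sample d => (arrivalCount (jumpRate a * t) (fun n => (ω n).1), fun n => (ω n).2) := rfl

theorem measurable_jumpSum {d : ℕ} (a : E d → ℝ) (t : ℝ) : Measurable (jumpSum a t) := by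
  rw [jumpSum_eq]
  refine (measurable_sum_range measurable_id).comp (Measurable.prodMk ?_ (by fun_prop))
  exact (measurable_arrivalCount _).comp (by fun_prop)

/-- The number of jumps depends on the waiting times alone, hence is a Poisson variable independent
of the steps. -/
theorem map_jumpSum {d : ℕ} (a : E d → ℝ) [IsProbabilityMeasure (stepLaw a)] {t : ℝ}
    (ht : 0 ≤ jumpRate a * t) :
    (sampleMeasure a).map (jumpSum a t)
      = compoundPoisson (jumpRate a * t).toNNReal (stepLaw a) := by
  have hc := measurable_arrivalCount (jumpRate a * t)
  have hs : Measurable fun q : ℕ × (ℕ → E d) => ∑ k ∈ Finset.range q.1, q.2 k :=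
    measurable_sum_range measurable_id
  have hzip : Measurable fun (p : (ℕ → ℝ) × (ℕ → E d)) (n : ℕ) => (p.1 n, p.2 n) := by fun_prop
  rw [sampleMeasure, infinitePi_prod_eq_map, Measure.map_map (measurable_jumpSum a t) hzip]
  have : jumpSum a t ∘ (fun (p : (ℕ → ℝ) × (ℕ → E d)) (n : ℕ) => (p.1 n, p.2 n))
      = (fun q : ℕ × (ℕ → E d) => ∑ k ∈ Finset.range q.1, q.2 k) ∘
        Prod.map (arrivalCount (jumpRate a * t)) id := rfl
  rw [this, ← Measure.map_map hs (by fun_prop), ← Measure.map_prod_map _ _ hc measurable_id,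
    Measure.map_id, compoundPoisson, markedPoisson, ← map_arrivalCount ht]
  rfl

/-! ### Moments, characteristic function and atoms of compound Poisson laws -/

theorem measurable_sumFst {V : Type*} [MeasurableSpace V] [AddCommMonoid V] [MeasurableAdd₂ V] :
    Measurable fun q : ℕ × (ℕ → V) => ∑ k ∈ Finset.range q.1, q.2 k :=
  measurable_sum_range measurable_id

/-- Bound every term by the largest one. The loss is polynomial in `n`, which Poisson weights
absorb. -/
theorem norm_sum_pow_le {V : Type*} [NormedAddCommGroup V] {n m : ℕ} (hm : m ≠ 0) (y : ℕ → V) :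
    ‖∑ k ∈ Finset.range n, y k‖ ^ m ≤ n ^ m * ∑ k ∈ Finset.range n, ‖y k‖ ^ m := by
  rcases Nat.eq_zero_or_pos n with rfl | hn
  · simp [hm]
  · obtain ⟨j, hj, hmax⟩ := Finset.exists_max_image (Finset.range n) (fun k => ‖y k‖)
      ⟨0, Finset.mem_range.2 hn⟩
    have h1 : ‖∑ k ∈ Finset.range n, y k‖ ≤ n * ‖y j‖ := by
      refine (norm_sum_le _ _).trans ((Finset.sum_le_card_nsmul _ _ _ hmax).trans ?_)
      simp
    calc _ ≤ (n * ‖y j‖) ^ m := pow_le_pow_left₀ (norm_nonneg _) h1 m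
      _ = n ^ m * ‖y j‖ ^ m := mul_pow _ _ _
      _ ≤ _ := by
        gcongr
        exact Finset.single_le_sum (f := fun k => ‖y k‖ ^ m) (fun k _ => by positivity) hj

theorem lintegral_norm_sum_pow_le {V : Type*} [NormedAddCommGroup V] [MeasurableSpace V]
    [BorelSpace V] [SecondCountableTopology V] (ρ : Measure V) [IsProbabilityMeasure ρ] {m : ℕ} (hm : m ≠ 0)
    (hρ : Integrable (fun x => ‖x‖ ^ m) ρ) (n : ℕ) :
    ∫⁻ y, ENNReal.ofReal (‖∑ k ∈ Finset.range n, y k‖ ^ m) ∂(Measure.infinitePi fun _ : ℕ => ρ)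
      ≤ ENNReal.ofReal ((n : ℝ) ^ (m + 1) * ∫ x, ‖x‖ ^ m ∂ρ) := by
  have hM : ∫⁻ x, ENNReal.ofReal (‖x‖ ^ m) ∂ρ = ENNReal.ofReal (∫ x, ‖x‖ ^ m ∂ρ) :=
    (ofReal_integral_eq_lintegral_ofReal hρ (ae_of_all _ fun x => pow_nonneg (norm_nonneg x) m)).symm
  have hk : ∀ k, ∫⁻ y, ENNReal.ofReal (‖y k‖ ^ m) ∂(Measure.infinitePi fun _ : ℕ => ρ)
      = ENNReal.ofReal (∫ x, ‖x‖ ^ m ∂ρ) := fun k => by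
    rw [← hM]
    exact (measurePreserving_eval_infinitePi (fun _ : ℕ => ρ) k).lintegral_comp
      (f := fun x => ENNReal.ofReal (‖x‖ ^ m)) (by fun_prop)
  calc _ ≤ ∫⁻ y, ENNReal.ofReal (n ^ m) * ∑ k ∈ Finset.range n, ENNReal.ofReal (‖y k‖ ^ m)
        ∂(Measure.infinitePi fun _ : ℕ => ρ) := by
        refine lintegral_mono fun y => ?_
        rw [← ENNReal.ofReal_sum_of_nonneg (fun k _ => pow_nonneg (norm_nonneg _) m),
          ← ENNReal.ofReal_mul (pow_nonneg n.cast_nonneg m)]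
        exact ENNReal.ofReal_le_ofReal (norm_sum_pow_le hm y)
    _ = ENNReal.ofReal (n ^ m) * ∑ k ∈ Finset.range n, ENNReal.ofReal (∫ x, ‖x‖ ^ m ∂ρ) := by
        rw [lintegral_const_mul _ (by fun_prop), lintegral_finsetSum _ (fun k _ => by fun_prop)]
        simp only [hk]
    _ = _ := by
        rw [Finset.sum_const, Finset.card_range, nsmul_eq_mul, pow_succ, mul_assoc,
          ENNReal.ofReal_mul (pow_nonneg n.cast_nonneg m), ENNReal.ofReal_mul n.cast_nonneg,
          ENNReal.ofReal_natCast]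

/-- n^m ≤ m! e^n reduces the series to the exponential series at r·e. -/
theorem summable_poisson_moment (r : NNReal) (m : ℕ) :
    Summable fun n : ℕ => Real.exp (-r) * r ^ n / n.factorial * (n : ℝ) ^ m := by
  refine Summable.of_nonneg_of_le (fun n => by positivity) (fun n => ?_)
    ((NormedSpace.expSeries_div_hasSum_exp ((r : ℝ) * Real.exp 1)).summable.mul_left
      (Real.exp (-r) * m.factorial))
  have h3 : (n : ℝ) ^ m ≤ m.factorial * Real.exp 1 ^ n := by
    have := Real.pow_div_factorial_le_exp (n : ℝ) (Nat.cast_nonneg n) m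
    rw [div_le_iff₀ (by positivity)] at this
    rw [← Real.exp_nat_mul, mul_one, mul_comm]
    exact this
  refine (mul_le_mul_of_nonneg_left h3 (by positivity)).trans (le_of_eq ?_)
  rw [mul_pow]
  ring

section compound

variable {V : Type*} [NormedAddCommGroup V] [MeasurableSpace V] [BorelSpace V]
  [SecondCountableTopology V] (r : NNReal) (ρ : Measure V) [IsProbabilityMeasure ρ]

instance : IsProbabilityMeasure (compoundPoisson r ρ) :=
  Measure.isProbabilityMeasure_map measurable_sumFst.aemeasurable

theorem lintegral_compoundPoisson {f : V → ℝ≥0∞} (hf : Measurable f) :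
    ∫⁻ x, f x ∂(compoundPoisson r ρ)
      = ∑' n : ℕ, ENNReal.ofReal (Real.exp (-r) * r ^ n / n.factorial) *
          ∫⁻ y, f (∑ k ∈ Finset.range n, y k) ∂(Measure.infinitePi fun _ : ℕ => ρ) := by
  rw [compoundPoisson, lintegral_map hf measurable_sumFst]
  exact lintegral_markedPoisson r ρ (hf.comp measurable_sumFst)

/-- Given n jumps the characteristic function is the n-th power of that of one step; the Poisson
weights sum these powers to an exponential. -/
theorem charFun_compoundPoisson [InnerProductSpace ℝ V] (k : V) :
    charFun (compoundPoisson r ρ) k = Complex.exp (r * (charFun ρ k - 1)) := by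
  rw [charFun_apply, compoundPoisson, integral_map measurable_sumFst.aemeasurable (by fun_prop),
    markedPoisson, integral_prod]
  · have h : ∀ n : ℕ, ∫ y, Complex.exp (inner ℝ (∑ j ∈ Finset.range n, y j) k * Complex.I)
        ∂(Measure.infinitePi fun _ : ℕ => ρ) = charFun ρ k ^ n := by
      intro n
      have hi : iIndepFun (fun (i : ℕ) (y : ℕ → V) => y i) (Measure.infinitePi fun _ : ℕ => ρ) :=
        iIndepFun_infinitePi (X := fun _ => id) fun _ => measurable_id
      have h1 := (hi.restrict (Finset.range n)).charFun_map_fun_finsetSum_eq_prod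
        (fun i _ => (measurable_pi_apply i).aemeasurable)
      have h2 := congrFun h1 k
      rw [charFun_apply, integral_map (by fun_prop) (by fun_prop)] at h2
      rw [h2]
      simp [Measure.infinitePi_map_eval]
    simp only [h]
    rw [integral_poissonMeasure]
    have hs := (NormedSpace.expSeries_div_hasSum_exp ((r : ℂ) * charFun ρ k)).mul_left
      (Complex.exp (-(r : ℂ)))
    rw [← Complex.exp_eq_exp_ℂ, ← Complex.exp_add] at hs
    rw [show (r : ℂ) * (charFun ρ k - 1) = -r + r * charFun ρ k by ring, ← hs.tsum_eq]
    refine tsum_congr fun n => ?_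
    rw [Complex.real_smul]
    push_cast
    ring
  · refine Integrable.of_bound (C := 1) ?_ (ae_of_all _ fun q => ?_)
    · exact (Measurable.comp (g := fun v : V => Complex.exp (inner ℝ v k * Complex.I))
        (by fun_prop) measurable_sumFst).aestronglyMeasurable
    · exact (Complex.norm_exp_ofReal_mul_I _).le

/-- Without a jump the sum is 0, which differs from c; with at least one jump the last step has no
atoms. The alternative `r = 0` covers a kernel vanishing almost everywhere, whose step law is a
Dirac mass. -/
theorem compoundPoisson_singleton (h : r = 0 ∨ ∀ x, ρ {x} = 0) {c : V} (hc : c ≠ 0) :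
    compoundPoisson r ρ {c} = 0 := by
  have hm : MeasurableSet {c} := measurableSet_singleton c
  rw [← lintegral_indicator_one hm, lintegral_compoundPoisson _ _ (measurable_one.indicator hm),
    ENNReal.tsum_eq_zero]
  rintro (_ | n)
  · rw [lintegral_congr (g := fun _ => 0) fun y => by simp [hc.symm]]
    simp
  · rcases h with h | h
    · simp [h]
    · rw [← lintegral_map (f := ({c} : Set V).indicator 1)
        (measurable_one.indicator hm) (by fun_prop), map_sum_range_succ_infinitePi,
        Measure.lintegral_conv (measurable_one.indicator hm)]
      refine mul_eq_zero_of_right _ ?_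
      have h0 : ∀ x, ∫⁻ y, ({c} : Set V).indicator 1 (x + y) ∂ρ = 0 := fun x => by
        rw [← h (c - x), ← lintegral_indicator_one (measurableSet_singleton _)]
        refine lintegral_congr fun y => ?_
        classical
        simp only [Set.indicator_apply, Set.mem_singleton_iff, Pi.one_apply, eq_sub_iff_add_eq']
      simp only [h0, lintegral_zero]

theorem integrable_norm_pow_compoundPoisson {m : ℕ} (hm : m ≠ 0)
    (hρ : Integrable (fun x => ‖x‖ ^ m) ρ) :
    Integrable (fun x => ‖x‖ ^ m) (compoundPoisson r ρ) := by
  refine ⟨by fun_prop, ?_⟩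
  rw [hasFiniteIntegral_iff_ofReal (ae_of_all _ fun x => pow_nonneg (norm_nonneg x) m),
    lintegral_compoundPoisson _ _ (by fun_prop)]
  have h2 : ∀ n : ℕ, ENNReal.ofReal (Real.exp (-r) * r ^ n / n.factorial) *
      ∫⁻ y, ENNReal.ofReal (‖∑ k ∈ Finset.range n, y k‖ ^ m) ∂(Measure.infinitePi fun _ : ℕ => ρ)
      ≤ ENNReal.ofReal (Real.exp (-r) * r ^ n / n.factorial * (n : ℝ) ^ (m + 1)) *
        ENNReal.ofReal (∫ x, ‖x‖ ^ m ∂ρ) := by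
    intro n
    refine (mul_le_mul_right (lintegral_norm_sum_pow_le ρ hm hρ n) _).trans (le_of_eq ?_)
    rw [ENNReal.ofReal_mul (by positivity), ENNReal.ofReal_mul (by positivity), mul_assoc]
  refine (ENNReal.tsum_le_tsum h2).trans_lt ?_
  rw [ENNReal.tsum_mul_right, ← ENNReal.ofReal_tsum_of_nonneg (fun n => by positivity)
    (summable_poisson_moment r (m + 1))]
  exact ENNReal.mul_lt_top ENNReal.ofReal_lt_top ENNReal.ofReal_lt_top

end compound

/-! ### The step law -/

section stepLaw

variable {d : ℕ} {a : E d → ℝ}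

theorem jumpRate_nonneg (ha : ∀ x, 0 ≤ a x) : 0 ≤ jumpRate a := integral_nonneg ha

theorem isProbabilityMeasure_stepLaw (ha : ∀ x, 0 ≤ a x) (hi : Integrable a) :
    IsProbabilityMeasure (stepLaw a) := by
  unfold stepLaw
  split_ifs with h
  · infer_instance
  · refine ⟨?_⟩
    rw [withDensity_apply _ .univ, Measure.restrict_univ,
      ← ofReal_integral_eq_lintegral_ofReal (hi.div_const _)
        (ae_of_all _ fun x => div_nonneg (ha x) (jumpRate_nonneg ha)), integral_div]
    change ENNReal.ofReal (jumpRate a / jumpRate a) = 1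
    rw [div_self h, ENNReal.ofReal_one]

/-- Keeping the factor `jumpRate a` on the left makes the formula hold also when a vanishes almost
everywhere. -/
theorem integral_stepLaw {F : Type*} [NormedAddCommGroup F] [NormedSpace ℝ F] [CompleteSpace F]
    (ha : ∀ x, 0 ≤ a x) (hi : Integrable a) (f : E d → F) :
    jumpRate a • ∫ x, f x ∂(stepLaw a) = ∫ x, a x • f x := by
  by_cases h : jumpRate a = 0
  · have h0 : a =ᵐ[volume] 0 := (integral_eq_zero_iff_of_nonneg ha hi).1 h
    rw [h, zero_smul]
    symm
    refine integral_eq_zero_of_ae ?_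
    filter_upwards [h0] with x hx
    simp [hx]
  · rw [stepLaw, if_neg h, integral_withDensity_eq_integral_toReal_smul₀
      (hi.div_const _).aestronglyMeasurable.aemeasurable.ennreal_ofReal
      (ae_of_all _ fun _ => ENNReal.ofReal_lt_top), ← integral_smul]
    refine integral_congr_ae (ae_of_all _ fun x => ?_)
    dsimp only
    rw [ENNReal.toReal_ofReal (div_nonneg (ha x) (jumpRate_nonneg ha)), smul_smul,
      mul_div_cancel₀ _ h]

theorem integrable_norm_pow_stepLaw (ha : ∀ x, 0 ≤ a x) (hi : Integrable a) {m : ℕ} 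
    (hm : Integrable fun x => ‖x‖ ^ m * a x) : Integrable (fun x => ‖x‖ ^ m) (stepLaw a) := by
  unfold stepLaw
  split_ifs with h
  · exact integrable_dirac (by simp)
  · rw [integrable_withDensity_iff_integrable_smul₀'
      (hi.div_const _).aestronglyMeasurable.aemeasurable.ennreal_ofReal
      (ae_of_all _ fun _ => ENNReal.ofReal_lt_top)]
    refine (hm.div_const (jumpRate a)).congr (ae_of_all _ fun x => ?_)
    dsimp only
    rw [ENNReal.toReal_ofReal (div_nonneg (ha x) (jumpRate_nonneg ha)), smul_eq_mul]
    ring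

theorem stepLaw_singleton (hd : 1 ≤ d) (h : jumpRate a ≠ 0) (x : E d) : stepLaw a {x} = 0 := by
  have : Nonempty (Fin d) := ⟨⟨0, hd⟩⟩
  rw [stepLaw, if_neg h]
  exact withDensity_absolutelyContinuous _ _ (measure_singleton x)

/-- The law of the displacement of one particle up to time `t`. -/
noncomputable def displacementLaw (a : E d → ℝ) (t : ℝ) : Measure (E d) :=
  compoundPoisson (jumpRate a * t).toNNReal (stepLaw a)

theorem displacementLaw_singleton (hd : 1 ≤ d) (ha : ∀ x, 0 ≤ a x) (hi : Integrable a) (t : ℝ)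
    {c : E d} (hc : c ≠ 0) : displacementLaw a t {c} = 0 := by
  have := isProbabilityMeasure_stepLaw ha hi
  refine compoundPoisson_singleton _ _ ?_ hc
  by_cases h : jumpRate a = 0
  · exact Or.inl (by simp [h])
  · exact Or.inr (stepLaw_singleton hd h)

theorem charFun_displacementLaw (ha : ∀ x, 0 ≤ a x) (hi : Integrable a) {t : ℝ} (ht : 0 ≤ t)
    (k : E d) : charFun (displacementLaw a t) k
      = Complex.exp (t * ∫ x, (a x : ℂ) * (Complex.exp (inner ℝ x k * Complex.I) - 1)) := by
  have := isProbabilityMeasure_stepLaw ha hi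
  rw [displacementLaw, charFun_compoundPoisson,
    Real.coe_toNNReal _ (mul_nonneg (jumpRate_nonneg ha) ht)]
  congr 1
  have h := integral_stepLaw ha hi fun x => Complex.exp (inner ℝ x k * Complex.I) - 1
  rw [integral_sub _ (integrable_const _), integral_const, probReal_univ, one_smul,
    ← charFun_apply] at h
  · simp only [Complex.real_smul] at h
    rw [← h]
    push_cast
    ring
  · exact Integrable.of_bound (C := 1) (by fun_prop)
      (ae_of_all _ fun x => (Complex.norm_exp_ofReal_mul_I _).le)

end stepLaw

/-! ### Smearing by the displacement law -/

/-- `∫ (exp f(x - s) - 1) ν(ds)`. -/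
noncomputable def smear {d : ℕ} (ν : Measure (E d)) (f : E d → ℝ) (x : E d) : ℝ :=
  ∫ s, (Real.exp (f (x - s)) - 1) ∂ν

section smear

variable {d : ℕ} {ν : Measure (E d)} [IsProbabilityMeasure ν] {f : E d → ℝ}

/-- The expected number of particles ending in the ball of radius R is finite: after a displacement
s they started in the ball of radius R + ‖s‖. There γ ∈ Θ has O((R + ‖s‖ + 2)^d) points, and ν has a
finite d-th moment. -/
theorem tsum_measure_norm_sub_le_ne_top (hd : 1 ≤ d) (hν : Integrable (fun s => ‖s‖ ^ d) ν)
    {γ : Config d} (hγ : γ ∈ Theta d) (R : ℕ) :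
    ∑' x : γ.1, ν {s | ‖(x : E d) - s‖ ≤ R} ≠ ⊤ := by
  obtain ⟨m, hm⟩ := hγ
  set v := volume.real (Metric.closedBall (0 : E d) 1) with hv_def
  have hcount : ∀ ρ : ℝ, 0 ≤ ρ →
      ∑' x : γ.1, {x : E d | ‖x‖ ≤ ρ}.indicator (1 : E d → ℝ≥0∞) x
        ≤ ENNReal.ofReal (m * ((ρ + 2) ^ d * v)) := by
    intro ρ hρ
    -- Θ controls only integer radii n ≥ 1, so ρ is rounded up to `⌈ρ⌉₊ + 1`, which is less than ρ +
    -- 2.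
    have hfin := γ.2 _ (isCompact_closedBall (0 : E d) (⌈ρ⌉₊ + 1 : ℕ))
    have h1 := hm (⌈ρ⌉₊ + 1) (by lia)
    rw [volume_real_closedBall hd (by positivity), ← hv_def] at h1
    have h2 : m * (((⌈ρ⌉₊ + 1 : ℕ) : ℝ) ^ d * v) ≤ m * ((ρ + 2) ^ d * v) := by
      have := Nat.ceil_lt_add_one hρ
      gcongr
      push_cast
      linarith
    calc ∑' x : γ.1, {x : E d | ‖x‖ ≤ ρ}.indicator (1 : E d → ℝ≥0∞) x
        = ∑' x, (γ.1 ∩ {x : E d | ‖x‖ ≤ ρ}).indicator (1 : E d → ℝ≥0∞) x := by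
          rw [tsum_subtype γ.1 ({x : E d | ‖x‖ ≤ ρ}.indicator (1 : E d → ℝ≥0∞))]
          simp only [Set.indicator_indicator]
      _ ≤ ∑' x, (γ.1 ∩ Metric.closedBall 0 (⌈ρ⌉₊ + 1 : ℕ)).indicator (1 : E d → ℝ≥0∞) x := by
          refine ENNReal.tsum_le_tsum fun x => Set.indicator_le_indicator_of_subset ?_
            (fun _ => zero_le) x
          rintro y ⟨hy, hyρ : ‖y‖ ≤ ρ⟩
          refine ⟨hy, ?_⟩
          rw [mem_closedBall_zero_iff]
          push_cast
          linarith [Nat.le_ceil ρ]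
      _ = ENNReal.ofReal ((γ.1 ∩ Metric.closedBall (0 : E d) (⌈ρ⌉₊ + 1 : ℕ)).ncard : ℝ) := by
          rw [← tsum_subtype, ENNReal.ofReal_natCast]
          simp only [Pi.one_apply]
          rw [ENNReal.tsum_set_one, ← hfin.cast_ncard_eq]
          simp
      _ ≤ _ := ENNReal.ofReal_le_ofReal (h1.trans h2)
  have hmeas : ∀ x : γ.1, Measurable fun s : E d =>
      {x : E d | ‖x‖ ≤ R + ‖s‖}.indicator (1 : E d → ℝ≥0∞) x := by
    intro x
    have : (fun s : E d => {x : E d | ‖x‖ ≤ R + ‖s‖}.indicator (1 : E d → ℝ≥0∞) x)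
        = {s : E d | ‖(x : E d)‖ ≤ R + ‖s‖}.indicator 1 := by
      ext s
      simp [Set.indicator_apply]
    rw [this]
    exact measurable_one.indicator (measurableSet_le (by fun_prop) (by fun_prop))
  have hle : ∑' x : γ.1, ν {s | ‖(x : E d) - s‖ ≤ R}
      ≤ ∫⁻ s, ENNReal.ofReal (m * ((R + ‖s‖ + 2) ^ d * v)) ∂ν := by
    calc ∑' x : γ.1, ν {s | ‖(x : E d) - s‖ ≤ R}
        ≤ ∑' x : γ.1, ∫⁻ s, {x : E d | ‖x‖ ≤ R + ‖s‖}.indicator (1 : E d → ℝ≥0∞) x ∂ν := by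
          refine ENNReal.tsum_le_tsum fun x => ?_
          rw [← lintegral_indicator_one (measurableSet_le (by fun_prop) (by fun_prop))]
          refine lintegral_mono fun s => ?_
          by_cases hs : s ∈ {s : E d | ‖(x : E d) - s‖ ≤ R}
          · rw [Set.indicator_of_mem hs, Set.indicator_of_mem]
            · simp
            · have := norm_sub_norm_le (x : E d) s
              have hs' : ‖(x : E d) - s‖ ≤ R := hs
              change ‖(x : E d)‖ ≤ R + ‖s‖
              linarith
          · rw [Set.indicator_of_notMem hs]
            exact zero_le
      _ = ∫⁻ s, ∑' x : γ.1, {x : E d | ‖x‖ ≤ R + ‖s‖}.indicator (1 : E d → ℝ≥0∞) x ∂ν :=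
          (lintegral_tsum fun x => (hmeas x).aemeasurable).symm
      _ ≤ _ := lintegral_mono fun s => hcount _ (by positivity)
  refine ne_top_of_le_ne_top ?_ hle
  have hint : Integrable (fun s => m * ((R + ‖s‖ + 2) ^ d * v)) ν := by
    refine Integrable.const_mul (Integrable.mul_const ?_ v) _
    refine (((integrable_const ((R + 2 : ℝ) ^ d)).add hν).const_mul (2 ^ (d - 1))).mono'
      (by fun_prop) (ae_of_all _ fun s => ?_)
    rw [Real.norm_of_nonneg (by positivity)]
    have := add_pow_le (a := (R + 2 : ℝ)) (b := ‖s‖) (by positivity) (by positivity) d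
    calc _ = (R + 2 + ‖s‖) ^ d := by ring
      _ ≤ _ := this
  rw [← ofReal_integral_eq_lintegral_ofReal hint (ae_of_all _ fun s => by positivity)]
  exact ENNReal.ofReal_ne_top

theorem exists_abs_bound (hf : Continuous f) (hc : HasCompactSupport f) :
    ∃ M, 0 ≤ M ∧ ∀ x, |f x| ≤ M := by
  obtain ⟨M, hM⟩ := hf.bounded_above_of_compact_support hc
  exact ⟨M, (norm_nonneg (f 0)).trans (hM 0), hM⟩

theorem abs_exp_sub_one_le_exp {y M : ℝ} (hy : |y| ≤ M) : |Real.exp y - 1| ≤ Real.exp M := by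
  have h1 : Real.exp y ≤ Real.exp M := Real.exp_le_exp.2 ((le_abs_self y).trans hy)
  have h2 := Real.exp_pos y
  have h3 : 1 ≤ Real.exp M := Real.one_le_exp ((abs_nonneg y).trans hy)
  rw [abs_le]
  constructor <;> linarith

theorem integrable_exp_sub (hf : Continuous f) {M : ℝ} (hM : ∀ x, |f x| ≤ M) (x : E d) :
    Integrable (fun s => Real.exp (f (x - s))) ν := by
  refine Integrable.of_bound (C := Real.exp M) (by fun_prop) (ae_of_all _ fun s => ?_)
  rw [Real.norm_eq_abs, Real.abs_exp]
  exact Real.exp_le_exp.2 ((le_abs_self _).trans (hM _))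

theorem one_add_smear (hf : Continuous f) {M : ℝ} (hM : ∀ x, |f x| ≤ M) (x : E d) :
    1 + smear ν f x = ∫ s, Real.exp (f (x - s)) ∂ν := by
  rw [smear, integral_sub (integrable_exp_sub hf hM x) (integrable_const _), integral_const,
    probReal_univ, one_smul]
  ring

theorem lintegral_exp_sub (hf : Continuous f) {M : ℝ} (hM : ∀ x, |f x| ≤ M) (x : E d) :
    ∫⁻ s, ENNReal.ofReal (Real.exp (f (x - s))) ∂ν = ENNReal.ofReal (1 + smear ν f x) := by
  rw [one_add_smear hf hM, ofReal_integral_eq_lintegral_ofReal (integrable_exp_sub hf hM x)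
    (ae_of_all _ fun s => Real.exp_nonneg _)]

/-- Keeps 1 + g away from 0, so that the product over particles can be written as the exponential of
a sum of logarithms. -/
theorem exp_neg_le_one_add_smear (hf : Continuous f) {M : ℝ} (hM : ∀ x, |f x| ≤ M) (x : E d) :
    Real.exp (-M) ≤ 1 + smear ν f x := by
  rw [one_add_smear hf hM]
  have := integral_mono (integrable_const (Real.exp (-M))) (integrable_exp_sub (ν := ν) hf hM x)
    fun s => Real.exp_le_exp.2 (neg_le_of_abs_le (hM (x - s)))
  simpa using this

/-- The integrand vanishes unless x - s lies in a ball containing the support of f, so |g(x)| is at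
most a constant times the probability of ending there. -/
theorem summable_abs_smear (hd : 1 ≤ d) (hν : Integrable (fun s => ‖s‖ ^ d) ν)
    (hf : Continuous f) (hc : HasCompactSupport f) {γ : Config d} (hγ : γ ∈ Theta d) :
    Summable fun x : γ.1 => |smear ν f x| := by
  obtain ⟨M, hM0, hM⟩ := exists_abs_bound hf hc
  obtain ⟨R, hR⟩ := exists_nat_bound_support hc
  refine Summable.of_nonneg_of_le (fun _ => abs_nonneg _) (fun x => ?_)
    ((ENNReal.summable_toReal (tsum_measure_norm_sub_le_ne_top hd hν hγ R)).mul_left (Real.exp M))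
  calc |smear ν f x| ≤ ∫ s, |Real.exp (f (x - s)) - 1| ∂ν := abs_integral_le_integral_abs
    _ ≤ ∫ s, {s | ‖(x : E d) - s‖ ≤ R}.indicator (fun _ => Real.exp M) s ∂ν := by
      refine integral_mono_of_nonneg (ae_of_all _ fun s => abs_nonneg _) ?_
        (ae_of_all _ fun s => ?_)
      · exact (integrable_const _).indicator (measurableSet_le (by fun_prop) (by fun_prop))
      · by_cases hs : s ∈ {s : E d | ‖(x : E d) - s‖ ≤ R}
        · rw [Set.indicator_of_mem hs]
          exact abs_exp_sub_one_le_exp (hM _)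
        · rw [Set.indicator_of_notMem hs]
          simp [hR _ (not_le.1 hs).le]
    _ = _ := by
      rw [integral_indicator (measurableSet_le (by fun_prop) (by fun_prop)), setIntegral_const,
        smul_eq_mul, mul_comm]
      rfl

theorem summable_log_one_add_smear (hd : 1 ≤ d) (hν : Integrable (fun s => ‖s‖ ^ d) ν)
    (hf : Continuous f) (hc : HasCompactSupport f) {γ : Config d} (hγ : γ ∈ Theta d) :
    Summable fun x : γ.1 => Real.log (1 + smear ν f x) :=
  Real.summable_log_one_add_of_summable (summable_abs_smear hd hν hf hc hγ).of_abs

end smear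

/-! ### The expectation for a fixed initial configuration -/

section system

variable {d : ℕ} {a : E d → ℝ} {γ : Config d} {t : ℝ}

theorem systemMeasure_map_eval [IsProbabilityMeasure (sampleMeasure a)] (x : γ.1) :
    MeasurePreserving (fun ω : γ.1 → Sample d => ω x) (systemMeasure a γ) (sampleMeasure a) :=
  measurePreserving_eval_infinitePi (fun _ : γ.1 => sampleMeasure a) x

theorem measurePreserving_jumpSum (ha : ∀ x, 0 ≤ a x) (hi : Integrable a) (ht : 0 ≤ t) :
    MeasurePreserving (jumpSum a t) (sampleMeasure a) (displacementLaw a t) := by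
  have := isProbabilityMeasure_stepLaw ha hi
  exact ⟨measurable_jumpSum a t, map_jumpSum a (mul_nonneg (jumpRate_nonneg ha) ht)⟩

theorem isProbabilityMeasure_sampleMeasure (ha : ∀ x, 0 ≤ a x) (hi : Integrable a) :
    IsProbabilityMeasure (sampleMeasure a) := by
  have := isProbabilityMeasure_stepLaw ha hi
  unfold sampleMeasure
  infer_instance

theorem isProbabilityMeasure_displacementLaw (ha : ∀ x, 0 ≤ a x) (hi : Integrable a) (t : ℝ) :
    IsProbabilityMeasure (displacementLaw a t) := by
  have := isProbabilityMeasure_stepLaw ha hi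
  unfold displacementLaw
  infer_instance

theorem measurePreserving_jumpSum_eval (ha : ∀ x, 0 ≤ a x) (hi : Integrable a) (ht : 0 ≤ t)
    (x : γ.1) :
    MeasurePreserving (fun ω : γ.1 → Sample d => jumpSum a t (ω x)) (systemMeasure a γ)
      (displacementLaw a t) := by
  have := isProbabilityMeasure_sampleMeasure ha hi
  exact (measurePreserving_jumpSum ha hi ht).comp (systemMeasure_map_eval x)

/-- Borel–Cantelli applied to the finite expected number of particles in a ball. It shows that the
default branch of `kawasaki` has probability zero. -/
theorem ae_finite_norm_le (hd : 1 ≤ d) (ha : ∀ x, 0 ≤ a x) (hi : Integrable a) (ht : 0 ≤ t)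
    (hν : Integrable (fun s => ‖s‖ ^ d) (displacementLaw a t)) (hγ : γ ∈ Theta d) :
    ∀ᵐ ω ∂(systemMeasure a γ), ∀ R : ℕ,
      {x : γ.1 | ‖(jumpProcess a x t (ω x))‖ ≤ R}.Finite := by
  have := isProbabilityMeasure_displacementLaw ha hi t
  refine ae_all_iff.2 fun R => ?_
  have h := tsum_measure_norm_sub_le_ne_top hd hν hγ R
  have h2 : ∀ x : γ.1, displacementLaw a t {s | ‖(x : E d) - s‖ ≤ R}
      = systemMeasure a γ {ω | ‖(jumpProcess a x t (ω x))‖ ≤ R} := fun x =>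
    ((measurePreserving_jumpSum_eval ha hi ht x).measure_preimage
      (measurableSet_le (by fun_prop) (by fun_prop)).nullMeasurableSet).symm
  simp only [h2] at h
  exact ae_finite_setOfPred_mem h

/-- A configuration is a set, so coinciding particles would be counted once. Two particles never
meet because the displacement law has no atom except possibly at 0. -/
theorem ae_injective (hd : 1 ≤ d) (ha : ∀ x, 0 ≤ a x) (hi : Integrable a) (ht : 0 ≤ t) :
    ∀ᵐ ω ∂(systemMeasure a γ), Function.Injective fun x : γ.1 => jumpProcess a x t (ω x) := by
  have := isProbabilityMeasure_sampleMeasure ha hi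
  have hS := measurePreserving_jumpSum ha hi ht
  have hmeas := measurable_jumpSum a t
  have key : ∀ x y : γ.1, x ≠ y → ∀ᵐ ω ∂(systemMeasure a γ),
      jumpProcess a x t (ω x) ≠ jumpProcess a y t (ω y) := by
    intro x y hxy
    have h := Measure.infinitePi_map_eval_prod (P := fun _ : γ.1 => sampleMeasure a) hxy
    have hxy' : (x : E d) - y ≠ 0 := fun h0 => hxy (Subtype.ext (sub_eq_zero.1 h0))
    have hnull : ∀ c : E d, c ≠ 0 → ∀ᵐ ω ∂(sampleMeasure a), jumpSum a t ω ≠ c := by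
      intro c hc
      refine hS.quasiMeasurePreserving.ae (p := fun s => s ≠ c) ?_
      rw [ae_iff]
      simpa using displacementLaw_singleton hd ha hi t hc
    have h2 : ∀ᵐ p ∂((sampleMeasure a).prod (sampleMeasure a)),
        jumpProcess a x t p.1 ≠ jumpProcess a y t p.2 := by
      rw [Measure.ae_prod_iff_ae_ae]
      · filter_upwards [hnull _ hxy'] with ω₁ hω₁
        -- A meeting forces the second displacement to equal y - x + S₁, with S₁ the first one.
        -- Excluding S₁ = x - y makes this target nonzero, hence not an atom.
        have hne : (y : E d) - x + jumpSum a t ω₁ ≠ 0 := fun h0 => hω₁ (by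
          rw [← sub_eq_zero, ← h0]; abel)
        filter_upwards [hnull _ hne] with ω₂ hω₂ heq
        rw [jumpProcess_eq, jumpProcess_eq] at heq
        refine hω₂ ?_
        have h3 : jumpSum a t ω₂ = y - (x - jumpSum a t ω₁) := by rw [heq]; abel
        rw [h3]
        abel
      · simp only [jumpProcess_eq]
        exact (measurableSet_eq_fun (by fun_prop) (by fun_prop)).compl
    rw [← h] at h2
    exact ae_of_ae_map (f := fun ω : γ.1 → Sample d => (ω x, ω y)) (by fun_prop) h2
  have h3 : ∀ᵐ ω ∂(systemMeasure a γ), ∀ x y : γ.1, x ≠ y →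
      jumpProcess a x t (ω x) ≠ jumpProcess a y t (ω y) :=
    ae_all_iff.2 fun x => ae_all_iff.2 fun y => eventually_imp_distrib_left.2 (key x y)
  filter_upwards [h3] with ω hω x y hxy
  by_contra hne
  exact hω x y hne hxy

theorem pairing_kawasaki {ω : γ.1 → Sample d}
    (hfin : ∀ R : ℕ, {x : γ.1 | ‖(jumpProcess a x t (ω x))‖ ≤ R}.Finite)
    (hinj : Function.Injective fun x : γ.1 => jumpProcess a x t (ω x)) (f : E d → ℝ) :
    pairing f (kawasaki a γ t ω) = ∑' x : γ.1, f (jumpProcess a x t (ω x)) := by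
  have h : ∀ K : Set (E d), IsCompact K →
      (Set.range (fun x : γ.1 => jumpProcess a x t (ω x)) ∩ K).Finite := by
    intro K hK
    obtain ⟨r, hr⟩ := hK.isBounded.subset_closedBall (0 : E d)
    refine ((hfin ⌈r⌉₊).image fun x : γ.1 => jumpProcess a x t (ω x)).subset ?_
    rintro _ ⟨⟨x, rfl⟩, hx⟩
    have := hr hx
    rw [mem_closedBall_zero_iff] at this
    exact ⟨x, this.trans (Nat.le_ceil r), rfl⟩
  have hval : (kawasaki a γ t ω).1 = Set.range fun x : γ.1 => jumpProcess a x t (ω x) :=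
    congrArg Subtype.val (dif_pos h)
  rw [pairing, tsum_subtype, hval, ← tsum_subtype, tsum_range f hinj]

theorem lintegral_prod_exp_system (ha : ∀ x, 0 ≤ a x) (hi : Integrable a) (ht : 0 ≤ t)
    {f : E d → ℝ} (hf : Continuous f) {M : ℝ} (hM : ∀ x, |f x| ≤ M) (F : Finset γ.1) :
    ∫⁻ ω, ∏ x ∈ F, ENNReal.ofReal (Real.exp (f (jumpProcess a x t (ω x)))) ∂(systemMeasure a γ)
      = ∏ x ∈ F, ENNReal.ofReal (1 + smear (displacementLaw a t) f x) := by
  have := isProbabilityMeasure_sampleMeasure ha hi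
  have := isProbabilityMeasure_displacementLaw ha hi t
  have hmeas := measurable_jumpSum a t
  have hfm := hf.measurable
  have hX : ∀ x : γ.1, Measurable fun ω : Sample d =>
      ENNReal.ofReal (Real.exp (f (jumpProcess a x t ω))) := fun x => by
    simp only [jumpProcess_eq]
    fun_prop
  have hind : iIndepFun (fun (x : γ.1) (ω : γ.1 → Sample d) =>
      ENNReal.ofReal (Real.exp (f (jumpProcess a x t (ω x))))) (systemMeasure a γ) :=
    iIndepFun_infinitePi (P := fun _ : γ.1 => sampleMeasure a)
      (X := fun (x : γ.1) ω => ENNReal.ofReal (Real.exp (f (jumpProcess a x t ω)))) hX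
  rw [lintegral_prod_eq_prod_lintegral_of_indepFun _ _ hind
    (fun x => (hX x).comp (measurable_pi_apply x))]
  refine Finset.prod_congr rfl fun x _ => ?_
  rw [← lintegral_exp_sub hf hM]
  exact (measurePreserving_jumpSum_eval ha hi ht x).lintegral_comp
    (f := fun s => ENNReal.ofReal (Real.exp (f (x - s)))) (by fun_prop)

/-- Compute the finite products by independence and let the finite set of particles grow. The
products for f need not be monotone, but those for |f| are; they dominate, and monotone convergence
bounds the mean of their supremum. -/
theorem lintegral_exp_kawasaki (hd : 1 ≤ d) (ha : ∀ x, 0 ≤ a x) (hi : Integrable a) (ht : 0 ≤ t)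
    (hν : Integrable (fun s => ‖s‖ ^ d) (displacementLaw a t)) (hγ : γ ∈ Theta d)
    {f : E d → ℝ} (hf : Continuous f) (hc : HasCompactSupport f) :
    ∫⁻ ω, ENNReal.ofReal (Real.exp (pairing f (kawasaki a γ t ω))) ∂(systemMeasure a γ)
      = ENNReal.ofReal (Real.exp
          (∑' x : γ.1, Real.log (1 + smear (displacementLaw a t) f x))) := by
  have := isProbabilityMeasure_sampleMeasure ha hi
  have := isProbabilityMeasure_displacementLaw ha hi t
  obtain ⟨M, hM0, hM⟩ := exists_abs_bound hf hc
  obtain ⟨R, hR⟩ := exists_nat_bound_support hc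
  have hmeas := measurable_jumpSum a t
  have habs : Continuous fun x => |f x| := hf.abs
  have hMabs : ∀ x, |(|f x|)| ≤ M := fun x => by rw [abs_abs]; exact hM x
  have hcabs : HasCompactSupport fun x => |f x| := hc.comp_left (g := abs) abs_zero
  let Φ : (E d → ℝ) → Finset γ.1 → (γ.1 → Sample d) → ℝ≥0∞ := fun f F ω =>
    ∏ x ∈ F, ENNReal.ofReal (Real.exp (f (jumpProcess a x t (ω x))))
  have hΦm : ∀ f : E d → ℝ, Continuous f → ∀ F, Measurable (Φ f F) := by
    intro f hf F
    have hfm := hf.measurable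
    refine Finset.measurable_fun_prod _ fun x _ => ?_
    simp only [jumpProcess_eq]
    fun_prop
  have hbound : ∫⁻ ω, ⨆ F, Φ (fun x => |f x|) F ω ∂(systemMeasure a γ) ≠ ⊤ := by
    rw [lintegral_iSup_directed fun F => (hΦm _ habs F).aemeasurable]
    · refine ne_top_of_le_ne_top (b := ENNReal.ofReal (Real.exp
        (∑' x : γ.1, |smear (displacementLaw a t) (fun x => |f x|) x|))) ENNReal.ofReal_ne_top ?_
      refine iSup_le fun F => ?_
      rw [lintegral_prod_exp_system ha hi ht habs hMabs]
      calc _ ≤ ∏ x ∈ F, ENNReal.ofReal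
            (Real.exp |smear (displacementLaw a t) (fun x => |f x|) x|) := by
            refine Finset.prod_le_prod' fun x _ => ENNReal.ofReal_le_ofReal ?_
            have h1 := Real.add_one_le_exp |smear (displacementLaw a t) (fun x => |f x|) x|
            have h2 := le_abs_self (smear (displacementLaw a t) (fun x => |f x|) x)
            linarith
        _ = ENNReal.ofReal (Real.exp
            (∑ x ∈ F, |smear (displacementLaw a t) (fun x => |f x|) x|)) := by
            rw [Real.exp_sum, ENNReal.ofReal_prod_of_nonneg fun _ _ => Real.exp_nonneg _]
        _ ≤ _ := by
            refine ENNReal.ofReal_le_ofReal (Real.exp_le_exp.2 ?_)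
            exact (summable_abs_smear hd hν habs hcabs hγ).sum_le_tsum _ fun _ _ => abs_nonneg _
    · refine Monotone.directed_le fun F G hFG ω => ?_
      refine Finset.prod_le_prod_of_subset_of_one_le' hFG fun x _ _ => ?_
      rw [← ENNReal.ofReal_one]
      exact ENNReal.ofReal_le_ofReal (Real.one_le_exp (abs_nonneg _))
  have hlim1 : Tendsto (fun F => ∫⁻ ω, Φ f F ω ∂(systemMeasure a γ)) atTop
      (𝓝 (∫⁻ ω, ENNReal.ofReal (Real.exp (pairing f (kawasaki a γ t ω))) ∂(systemMeasure a γ))) := by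
    refine tendsto_lintegral_filter_of_dominated_convergence
      (fun ω => ⨆ F, Φ (fun x => |f x|) F ω) (Eventually.of_forall fun F => hΦm f hf F)
      (Eventually.of_forall fun F => ae_of_all _ fun ω => ?_) hbound ?_
    · refine le_trans ?_ (le_iSup _ F)
      refine Finset.prod_le_prod' fun x _ => ENNReal.ofReal_le_ofReal ?_
      exact Real.exp_le_exp.2 (le_abs_self _)
    · filter_upwards [ae_finite_norm_le hd ha hi ht hν hγ, ae_injective hd ha hi ht]
        with ω hfin hinj
      rw [pairing_kawasaki hfin hinj f]
      have hsum : Summable fun x : γ.1 => f (jumpProcess a x t (ω x)) := by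
        refine summable_of_hasFiniteSupport ((hfin R).subset fun x hx => ?_)
        by_contra h
        exact hx (hR _ (not_le.1 h).le)
      have h1 := (ENNReal.continuous_ofReal.tendsto _).comp
        ((Real.continuous_exp.tendsto _).comp hsum.hasSum)
      refine h1.congr fun F => ?_
      simp only [Function.comp, Φ]
      rw [Real.exp_sum, ENNReal.ofReal_prod_of_nonneg fun _ _ => Real.exp_nonneg _]
  have hlim2 : Tendsto (fun F => ∫⁻ ω, Φ f F ω ∂(systemMeasure a γ)) atTop
      (𝓝 (ENNReal.ofReal (Real.exp
          (∑' x : γ.1, Real.log (1 + smear (displacementLaw a t) f x))))) := by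
    have h1 := (ENNReal.continuous_ofReal.tendsto _).comp ((Real.continuous_exp.tendsto _).comp
      (summable_log_one_add_smear hd hν hf hc hγ).hasSum)
    refine h1.congr fun F => ?_
    simp only [Φ]
    rw [lintegral_prod_exp_system ha hi ht hf hM]
    simp only [Function.comp]
    rw [Real.exp_sum, ENNReal.ofReal_prod_of_nonneg fun _ _ => Real.exp_nonneg _]
    refine Finset.prod_congr rfl fun x _ => ?_
    rw [Real.exp_log ((Real.exp_pos _).trans_le (exp_neg_le_one_add_smear hf hM x))]
  exact tendsto_nhds_unique hlim1 hlim2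

end system

/-! ### Averaging over the initial configuration -/

section average

variable {d : ℕ} {ν : Measure (E d)} [IsProbabilityMeasure ν] {f : E d → ℝ}

theorem hasCompactSupport_exp_sub_one (hc : HasCompactSupport f) :
    HasCompactSupport fun x => Real.exp (f x) - 1 :=
  hc.comp_left (g := fun y => Real.exp y - 1) (by simp)

/-- The function g is the convolution of ν with a test function, hence smooth; to get a test
function only a cutoff is then needed. -/
theorem contDiff_smear (hf : IsTestFunction f) : ContDiff ℝ (⊤ : ℕ∞) (smear ν f) := by
  have h1 : ContDiff ℝ (⊤ : ℕ∞) fun x => Real.exp (f x) - 1 := hf.1.exp.sub contDiff_const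
  -- Convolving the constant 1 with respect to the measure `ν` gives exactly ∫ h(x - s) ν(ds) for h
  -- = e^f - 1.
  have h2 := (hasCompactSupport_exp_sub_one hf.2).contDiff_convolution_right
    (f := fun _ : E d => (1 : ℝ)) (μ := ν) (ContinuousLinearMap.lsmul ℝ ℝ)
    (integrable_const _).locallyIntegrable h1
  convert! h2 using 1
  ext x
  simp [smear, convolution]

theorem integrable_prod_comp_sub {u : E d → ℝ} (hu : Integrable u) (hum : Measurable u) :
    Integrable (fun p : E d × E d => u (p.1 - p.2)) (volume.prod ν) := by
  refine (integrable_prod_iff'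
    (hum.comp (measurable_fst.sub measurable_snd)).aestronglyMeasurable).2 ⟨ae_of_all _ fun s => hu.comp_sub_right s, ?_⟩
  exact (integrable_const (∫ x, ‖u x‖)).congr
    (ae_of_all _ fun s => (integral_sub_right_eq_self (fun x => ‖u x‖) s).symm)

theorem integrable_exp_sub_one (hf : IsTestFunction f) :
    Integrable fun x => Real.exp (f x) - 1 :=
  ((Real.continuous_exp.comp hf.1.continuous).sub continuous_const).integrable_of_hasCompactSupport
    (hasCompactSupport_exp_sub_one hf.2)

theorem measurable_exp_sub_one (hf : IsTestFunction f) : Measurable fun x => Real.exp (f x) - 1 :=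
  ((Real.continuous_exp.comp hf.1.continuous).sub continuous_const).measurable

theorem integrable_smear (hf : IsTestFunction f) : Integrable (smear ν f) :=
  (integrable_prod_comp_sub (integrable_exp_sub_one hf) (measurable_exp_sub_one hf)).integral_prod_left

/-- The logarithm of the truncated factor `1 + χ_n g`. -/
noncomputable def truncLog (ν : Measure (E d)) (f : E d → ℝ) (n : ℕ) (x : E d) : ℝ :=
  Real.log (1 + cutoff d n x * smear ν f x)

theorem one_add_smear_pos (hf : IsTestFunction f) (x : E d) : 0 < 1 + smear ν f x := by
  obtain ⟨M, -, hM⟩ := exists_abs_bound hf.1.continuous hf.2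
  exact (Real.exp_pos _).trans_le (exp_neg_le_one_add_smear hf.1.continuous hM x)

theorem one_add_cutoff_mul_smear_pos (hf : IsTestFunction f) (n : ℕ) (x : E d) :
    0 < 1 + cutoff d n x * smear ν f x := by
  have h1 := one_add_smear_pos (ν := ν) hf x
  have h2 := (cutoff d n).nonneg (x := x)
  have h3 := (cutoff d n).le_one (x := x)
  rcases h3.lt_or_eq with h | h
  · nlinarith
  · rw [h]
    linarith

theorem exp_truncLog (hf : IsTestFunction f) (n : ℕ) (x : E d) :
    Real.exp (truncLog ν f n x) - 1 = cutoff d n x * smear ν f x := by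
  rw [truncLog, Real.exp_log (one_add_cutoff_mul_smear_pos hf n x)]
  ring

/-- Makes the defining Laplace transform of the Poisson measure applicable: `truncLog` is the
logarithm for which e^{·} - 1 is the cutoff times g. -/
theorem isTestFunction_truncLog (hf : IsTestFunction f) (n : ℕ) :
    IsTestFunction (truncLog ν f n) := by
  constructor
  · exact (contDiff_const.add ((cutoff d n).contDiff.mul (contDiff_smear hf))).log
      fun x => (one_add_cutoff_mul_smear_pos hf n x).ne'
  · have h1 : HasCompactSupport fun x => cutoff d n x * smear ν f x :=
      (cutoff d n).hasCompactSupport.mul_right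
    exact h1.comp_left (g := fun y => Real.log (1 + y)) (by simp)

theorem eventually_cutoff_eq_one (x : E d) : ∀ᶠ n in atTop, cutoff d n x = 1 := by
  obtain ⟨N, hN⟩ := exists_nat_ge ‖x‖
  filter_upwards [eventually_ge_atTop N] with n hn
  refine cutoff_eq_one ?_
  have : (N : ℝ) ≤ n := by exact_mod_cast hn
  linarith

/-- The cutoff moves g towards 0 without changing its sign, and y ↦ log(1 + y) is monotone and
vanishes at 0. -/
theorem abs_truncLog_le (hf : IsTestFunction f) (n : ℕ) (x : E d) :
    |truncLog ν f n x| ≤ |Real.log (1 + smear ν f x)| := by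
  have h1 := one_add_smear_pos (ν := ν) hf x
  have h2 := (cutoff d n).nonneg (x := x)
  have h3 := (cutoff d n).le_one (x := x)
  have h4 := one_add_cutoff_mul_smear_pos (ν := ν) hf n x
  unfold truncLog
  rcases le_total 0 (smear ν f x) with h | h
  · have h5 : cutoff d n x * smear ν f x ≤ smear ν f x := mul_le_of_le_one_left h h3
    rw [abs_of_nonneg (Real.log_nonneg (by nlinarith)), abs_of_nonneg (Real.log_nonneg (by linarith))]
    exact Real.log_le_log h4 (by linarith)
  · have h5 : smear ν f x ≤ cutoff d n x * smear ν f x := by nlinarith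
    have h6 : cutoff d n x * smear ν f x ≤ 0 := mul_nonpos_of_nonneg_of_nonpos h2 h
    rw [abs_of_nonpos (Real.log_nonpos h4.le (by linarith)),
      abs_of_nonpos (Real.log_nonpos h1.le (by linarith))]
    exact neg_le_neg (Real.log_le_log h1 (by linarith))

theorem tendsto_pairing_truncLog (hd : 1 ≤ d) (hν : Integrable (fun s => ‖s‖ ^ d) ν)
    (hf : IsTestFunction f) {γ : Config d} (hγ : γ ∈ Theta d) :
    Tendsto (fun n => pairing (truncLog ν f n) γ) atTop
      (𝓝 (∑' x : γ.1, Real.log (1 + smear ν f x))) := by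
  refine tendsto_tsum_of_dominated_convergence
    (bound := fun x : γ.1 => |Real.log (1 + smear ν f x)|)
    (summable_log_one_add_smear hd hν hf.1.continuous hf.2 hγ).abs (fun x => ?_)
    (Eventually.of_forall fun n x => abs_truncLog_le hf n x)
  refine tendsto_const_nhds.congr' ?_
  filter_upwards [eventually_cutoff_eq_one (x : E d)] with n hn
  rw [truncLog, hn, one_mul]

variable {z : E d → ℝ} {π : Measure (Config d)}

theorem tendsto_integral_cutoff (hz : Measurable z) (hz0 : ∀ x, 0 ≤ z x) {C : ℝ}
    (hC : ∀ x, z x ≤ C) (hf : IsTestFunction f) :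
    Tendsto (fun n => ∫ x, (cutoff d n x * smear ν f x) * z x) atTop
      (𝓝 (∫ x, smear ν f x * z x)) := by
  have hint : Integrable fun x => smear ν f x * z x :=
    (integrable_smear hf).mul_bdd (c := C) hz.aestronglyMeasurable
      (ae_of_all _ fun x => by rw [Real.norm_of_nonneg (hz0 x)]; exact hC x)
  refine tendsto_integral_of_dominated_convergence (fun x => ‖smear ν f x * z x‖) (fun n => ?_)
    hint.norm (fun n => ae_of_all _ fun x => ?_) (ae_of_all _ fun x => ?_)
  · have h1 := (contDiff_smear (ν := ν) hf).continuous.measurable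
    have h2 := (cutoff d n).continuous.measurable
    exact ((h2.mul h1).mul hz).aestronglyMeasurable
  · rw [mul_assoc, norm_mul, Real.norm_of_nonneg (cutoff d n).nonneg]
    exact mul_le_of_le_one_left (norm_nonneg _) (cutoff d n).le_one
  · refine tendsto_const_nhds.congr' ?_
    filter_upwards [eventually_cutoff_eq_one x] with n hn
    rw [hn, one_mul]

theorem lintegral_exp_pairing_truncLog (hπ : IsPoisson z π) (hf : IsTestFunction f) (n : ℕ) :
    ∫⁻ γ, ENNReal.ofReal (Real.exp (pairing (truncLog ν f n) γ)) ∂π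
      = ENNReal.ofReal (Real.exp (∫ x, (cutoff d n x * smear ν f x) * z x)) := by
  rw [hπ.2 _ (isTestFunction_truncLog hf n)]
  simp only [exp_truncLog hf]

theorem tendsto_exp_pairing_truncLog (hd : 1 ≤ d) (hν : Integrable (fun s => ‖s‖ ^ d) ν)
    (hf : IsTestFunction f) {γ : Config d} (hγ : γ ∈ Theta d) :
    Tendsto (fun n => ENNReal.ofReal (Real.exp (pairing (truncLog ν f n) γ))) atTop
      (𝓝 (ENNReal.ofReal (Real.exp (∑' x : γ.1, Real.log (1 + smear ν f x))))) :=
  (ENNReal.continuous_ofReal.tendsto _).comp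
    ((Real.continuous_exp.tendsto _).comp (tendsto_pairing_truncLog hd hν hf hγ))

theorem measurable_exp_pairing_truncLog (hf : IsTestFunction f) (n : ℕ) :
    Measurable fun γ : Config d => ENNReal.ofReal (Real.exp (pairing (truncLog ν f n) γ)) := by
  have h := isTestFunction_truncLog (ν := ν) hf n
  have := measurable_pairing h.1.continuous h.2
  fun_prop

theorem tendsto_lintegral_exp_pairing_truncLog (hπ : IsPoisson z π) (hz : Measurable z)
    (hz0 : ∀ x, 0 ≤ z x) {C : ℝ} (hC : ∀ x, z x ≤ C) (hf : IsTestFunction f) :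
    Tendsto (fun n => ∫⁻ γ, ENNReal.ofReal (Real.exp (pairing (truncLog ν f n) γ)) ∂π) atTop
      (𝓝 (ENNReal.ofReal (Real.exp (∫ x, smear ν f x * z x)))) := by
  simp only [lintegral_exp_pairing_truncLog hπ hf]
  exact (ENNReal.continuous_ofReal.tendsto _).comp
    ((Real.continuous_exp.tendsto _).comp (tendsto_integral_cutoff hz hz0 hC hf))

/-- Fatou's lemma along the truncations. This finiteness later provides the dominating function for
the exact formula. -/
theorem lintegral_exp_tsum_ne_top (hd : 1 ≤ d) (hν : Integrable (fun s => ‖s‖ ^ d) ν)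
    (hπ : IsPoisson z π) (hz : Measurable z) (hz0 : ∀ x, 0 ≤ z x) {C : ℝ} (hC : ∀ x, z x ≤ C)
    (hf : IsTestFunction f) :
    ∫⁻ γ, ENNReal.ofReal (Real.exp (∑' x : γ.1, Real.log (1 + smear ν f x))) ∂π ≠ ⊤ := by
  have h1 : ∫⁻ γ, ENNReal.ofReal (Real.exp (∑' x : γ.1, Real.log (1 + smear ν f x))) ∂π
      = ∫⁻ γ, liminf (fun n => ENNReal.ofReal (Real.exp (pairing (truncLog ν f n) γ))) atTop ∂π := by
    refine lintegral_congr_ae ?_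
    filter_upwards [ae_mem_Theta hd hz0 hC hπ] with γ hγ
    exact (tendsto_exp_pairing_truncLog hd hν hf hγ).liminf_eq.symm
  rw [h1]
  refine ne_top_of_le_ne_top ?_ (lintegral_liminf_le (measurable_exp_pairing_truncLog hf))
  rw [(tendsto_lintegral_exp_pairing_truncLog hπ hz hz0 hC hf).liminf_eq]
  exact ENNReal.ofReal_ne_top

theorem exists_testFunction_ge (hf : IsTestFunction f) :
    ∃ w : E d → ℝ, IsTestFunction w ∧ (∀ x, 0 ≤ w x) ∧ ∀ x, f x ≤ w x := by
  obtain ⟨M, hM0, hM⟩ := exists_abs_bound hf.1.continuous hf.2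
  obtain ⟨R, hR⟩ := exists_nat_bound_support hf.2
  refine ⟨fun x => M * cutoff d R x,
    ⟨contDiff_const.mul (cutoff d R).contDiff, (cutoff d R).hasCompactSupport.mul_left⟩,
    fun x => mul_nonneg hM0 (cutoff d R).nonneg, fun x => ?_⟩
  by_cases hx : ‖x‖ ≤ R
  · beta_reduce
    rw [cutoff_eq_one (by linarith), mul_one]
    exact (le_abs_self _).trans (hM x)
  · rw [hR x (not_le.1 hx).le]
    exact mul_nonneg hM0 (cutoff d R).nonneg

/-- The Poisson average of the product `∏_{x ∈ γ} (1 + g x)`. -/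
theorem lintegral_exp_tsum_log (hd : 1 ≤ d) (hν : Integrable (fun s => ‖s‖ ^ d) ν)
    (hπ : IsPoisson z π) (hz : Measurable z) (hz0 : ∀ x, 0 ≤ z x) {C : ℝ} (hC : ∀ x, z x ≤ C)
    (hf : IsTestFunction f) :
    ∫⁻ γ, ENNReal.ofReal (Real.exp (∑' x : γ.1, Real.log (1 + smear ν f x))) ∂π
      = ENNReal.ofReal (Real.exp (∫ x, smear ν f x * z x)) := by
  -- For a test function w ≥ 0 above f, the smeared w is nonnegative and exceeds the smeared f. So
  -- all truncated logarithms of f lie below log(1 + g_w), a bound free of n and integrable after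
  -- exponentiation.
  obtain ⟨w, hw, hw0, hfw⟩ := exists_testFunction_ge hf
  obtain ⟨M, hM0, hM⟩ := exists_abs_bound hf.1.continuous hf.2
  obtain ⟨M', hM'0, hM'⟩ := exists_abs_bound hw.1.continuous hw.2
  refine tendsto_nhds_unique ?_ (tendsto_lintegral_exp_pairing_truncLog hπ hz hz0 hC hf)
  refine tendsto_lintegral_of_dominated_convergence'
    (fun γ => ENNReal.ofReal (Real.exp (∑' x : γ.1, Real.log (1 + smear ν w x))))
    (fun n => (measurable_exp_pairing_truncLog hf n).aemeasurable) (fun n => ?_)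
    (lintegral_exp_tsum_ne_top hd hν hπ hz hz0 hC hw) ?_
  · filter_upwards [ae_mem_Theta hd hz0 hC hπ] with γ hγ
    refine ENNReal.ofReal_le_ofReal (Real.exp_le_exp.2 ?_)
    refine (γ.summable (isTestFunction_truncLog hf n).2).tsum_le_tsum (fun x => ?_)
      (summable_log_one_add_smear hd hν hw.1.continuous hw.2 hγ)
    refine Real.log_le_log (one_add_cutoff_mul_smear_pos hf n x) ?_
    have h1 : smear ν f x ≤ smear ν w x := by
      have := integral_mono (integrable_exp_sub (ν := ν) hf.1.continuous hM (x : E d))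
        (integrable_exp_sub (ν := ν) hw.1.continuous hM' (x : E d))
        fun s => Real.exp_le_exp.2 (hfw _)
      rw [← one_add_smear hf.1.continuous hM, ← one_add_smear hw.1.continuous hM'] at this
      linarith
    have h0 : 0 ≤ smear ν w x := integral_nonneg fun s => by
      have := Real.one_le_exp (hw0 (x - s))
      simpa using this
    have h2 := (cutoff d n).nonneg (x := (x : E d))
    have h3 := (cutoff d n).le_one (x := (x : E d))
    have h4 : cutoff d n x * smear ν f x ≤ cutoff d n x * smear ν w x :=
      mul_le_mul_of_nonneg_left h1 h2
    have h5 : cutoff d n x * smear ν w x ≤ smear ν w x := mul_le_of_le_one_left h0 h3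
    linarith
  · filter_upwards [ae_mem_Theta hd hz0 hC hπ] with γ hγ
    exact tendsto_exp_pairing_truncLog hd hν hf hγ

end average

/-! ### Closed form of the scaled Laplace transform -/

theorem isTestFunction_scale {d : ℕ} {φ : E d → ℝ} (hφ : IsTestFunction φ) {ε : ℝ} (hε : 0 < ε) :
    IsTestFunction fun x => ε ^ d * φ (ε • x) :=
  ⟨contDiff_const.mul (hφ.1.comp (contDiff_const_smul ε)),
    (hφ.2.comp_homeomorph (Homeomorph.smulOfNeZero ε hε.ne')).mul_left⟩

theorem integrable_of_moments {d : ℕ} {a : E d → ℝ}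
    (hm : ∀ n : ℕ, Integrable (fun x => ‖x‖ ^ n * a x)) : Integrable a := by
  simpa using hm 0

theorem integrable_norm_pow_displacementLaw {d : ℕ} (hd : 1 ≤ d) {a : E d → ℝ} (ha : ∀ x, 0 ≤ a x)
    (hm : ∀ n : ℕ, Integrable (fun x => ‖x‖ ^ n * a x)) (t : ℝ) :
    Integrable (fun s => ‖s‖ ^ d) (displacementLaw a t) := by
  have hi := integrable_of_moments hm
  have := isProbabilityMeasure_stepLaw ha hi
  exact integrable_norm_pow_compoundPoisson _ _ (by lia) (integrable_norm_pow_stepLaw ha hi (hm d))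

/-- The Laplace transform of the scaled field in closed form. -/
theorem scaledLaplace_eq {d : ℕ} (hd : 1 ≤ d) {a : E d → ℝ} (ha : ∀ x, 0 ≤ a x)
    (hm : ∀ n : ℕ, Integrable (fun x => ‖x‖ ^ n * a x)) {z : E d → ℝ} (hz : Measurable z)
    (hz0 : ∀ x, 0 ≤ z x) {C : ℝ} (hC : ∀ x, z x ≤ C) (κ : ℕ) {t : ℝ} (ht : 0 ≤ t) {φ : E d → ℝ}
    (hφ : IsTestFunction φ) {ε : ℝ} (hε : 0 < ε) :
    scaledLaplace a z κ t φ ε = ENNReal.ofReal (Real.exp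
      (∫ x, smear (displacementLaw a ((ε ^ κ)⁻¹ * t)) (fun x => ε ^ d * φ (ε • x)) x
        * z (ε • x))) := by
  have hi := integrable_of_moments hm
  have ht' : 0 ≤ (ε ^ κ)⁻¹ * t := by positivity
  have := isProbabilityMeasure_displacementLaw ha hi ((ε ^ κ)⁻¹ * t)
  have hν := integrable_norm_pow_displacementLaw hd ha hm ((ε ^ κ)⁻¹ * t)
  have hf := isTestFunction_scale hφ hε
  have hz' : Measurable fun x => z (ε • x) := by fun_prop
  have hπ := isPoisson_poisson hd hz' (fun x => hz0 _) (fun x => hC _)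
  have hΘ := ae_mem_Theta hd (fun x => hz0 (ε • x)) (fun x => hC (ε • x)) hπ
  rw [scaledLaplace, Measure.restrict_eq_self_of_ae_mem hΘ,
    ← lintegral_exp_tsum_log hd hν hπ hz' (fun x => hz0 _) (fun x => hC _) hf]
  refine lintegral_congr_ae ?_
  filter_upwards [hΘ] with γ hγ
  exact lintegral_exp_kawasaki hd ha hi ht' hν hγ hf.1.continuous hf.2

/-! ### Weak convergence of the scaled displacement -/

section weak

variable {d : ℕ} {z ψ : E d → ℝ} {C : ℝ}

/-- The correlation `s ↦ ∫ z(y) ψ(y - s) dy`. -/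
noncomputable def correlation (z ψ : E d → ℝ) (s : E d) : ℝ := ∫ y, z y * ψ (y - s)

theorem integrable_mul_comp_sub (hz : Measurable z) (hz0 : ∀ x, 0 ≤ z x) (hC : ∀ x, z x ≤ C)
    (hψ : Continuous ψ) (hc : HasCompactSupport ψ) (s : E d) :
    Integrable fun y => z y * ψ (y - s) :=
  ((hψ.integrable_of_hasCompactSupport hc).comp_sub_right s).bdd_mul (c := C)
    hz.aestronglyMeasurable (ae_of_all _ fun x => by
      rw [Real.norm_of_nonneg (hz0 x)]; exact hC x)

theorem abs_correlation_le (hz : Measurable z) (hz0 : ∀ x, 0 ≤ z x) (hC : ∀ x, z x ≤ C)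
    (hψ : Continuous ψ) (hc : HasCompactSupport ψ) (s : E d) :
    |correlation z ψ s| ≤ C * ∫ y, |ψ y| := by
  calc |correlation z ψ s| ≤ ∫ y, |z y * ψ (y - s)| := abs_integral_le_integral_abs
    _ ≤ ∫ y, C * |ψ (y - s)| := by
        refine integral_mono (integrable_mul_comp_sub hz hz0 hC hψ hc s).abs
          (((hψ.integrable_of_hasCompactSupport hc).comp_sub_right s).abs.const_mul C) fun y => ?_
        simp only [abs_mul, abs_of_nonneg (hz0 y)]
        exact mul_le_mul_of_nonneg_right (hC y) (abs_nonneg _)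
    _ = C * ∫ y, |ψ y| := by
        rw [integral_const_mul, integral_sub_right_eq_self (fun y => |ψ y|) s]

/-- Convolving a locally integrable function with a continuous compactly supported one gives a
continuous function. Thus ψ supplies the regularity that z lacks. -/
theorem continuous_correlation (hz : Measurable z) (hz0 : ∀ x, 0 ≤ z x) (hC : ∀ x, z x ≤ C)
    (hψ : Continuous ψ) (hc : HasCompactSupport ψ) : Continuous (correlation z ψ) := by
  have hc' : HasCompactSupport fun y => ψ (-y) := hc.comp_homeomorph (Homeomorph.neg (E d))
  have h := hc'.continuous_convolution_right (f := z) (μ := volume) (ContinuousLinearMap.lsmul ℝ ℝ)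
    (by
      refine (locallyIntegrable_const C).mono hz.aestronglyMeasurable (ae_of_all _ fun x => ?_)
      rw [Real.norm_of_nonneg (hz0 x)]
      exact (hC x).trans (le_abs_self C)) (hψ.comp continuous_neg)
  convert! h using 1
  ext s
  simp [correlation, convolution]

/-- The exponent of the Laplace transform, as an average over the scaled displacement. -/
theorem integral_smear_eq {ν : Measure (E d)} [IsProbabilityMeasure ν]
    (hz : Measurable z) (hz0 : ∀ x, 0 ≤ z x) (hC : ∀ x, z x ≤ C) {φ : E d → ℝ}
    (hφ : IsTestFunction φ) {ε : ℝ} (hε : 0 < ε) :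
    ∫ x, smear ν (fun x => ε ^ d * φ (ε • x)) x * z (ε • x)
      = ∫ s, correlation z (fun y => (ε ^ d)⁻¹ * (Real.exp (ε ^ d * φ y) - 1)) (ε • s) ∂ν := by
  have hf := isTestFunction_scale hφ hε
  have h1 : Integrable (fun p : E d × E d =>
      (Real.exp (ε ^ d * φ (ε • (p.1 - p.2))) - 1) * z (ε • p.1)) (volume.prod ν) := by
    refine (integrable_prod_comp_sub (ν := ν) (integrable_exp_sub_one hf)
      (measurable_exp_sub_one hf)).mul_bdd (c := C) ?_ (ae_of_all _ fun p => ?_)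
    · exact (hz.comp (measurable_fst.const_smul ε)).aestronglyMeasurable
    · rw [Real.norm_of_nonneg (hz0 _)]; exact hC _
  calc ∫ x, smear ν (fun x => ε ^ d * φ (ε • x)) x * z (ε • x)
      = ∫ x, ∫ s, (Real.exp (ε ^ d * φ (ε • (x - s))) - 1) * z (ε • x) ∂ν := by
        simp only [smear, integral_mul_const]
    _ = ∫ s, (∫ x, (Real.exp (ε ^ d * φ (ε • (x - s))) - 1) * z (ε • x)) ∂ν :=
        integral_integral_swap
          (f := fun x s => (Real.exp (ε ^ d * φ (ε • (x - s))) - 1) * z (ε • x)) h1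
    _ = _ := by
        refine integral_congr_ae (ae_of_all _ fun s => ?_)
        -- The substitution y = εx; its Jacobian is the factor `(ε ^ d)⁻¹` inside the correlation.
        have := Measure.integral_comp_smul (μ := (volume : Measure (E d)))
          (fun y : E d => (Real.exp (ε ^ d * φ (y - ε • s)) - 1) * z y) ε
        simp only [finrank_euclideanSpace, Fintype.card_fin, smul_eq_mul,
          abs_of_pos (inv_pos.2 (pow_pos hε d))] at this
        simp only [smul_sub, this, correlation, ← integral_const_mul]
        refine integral_congr_ae (ae_of_all _ fun y => ?_)
        ring_nf

/-- Uses |e^u - 1 - u| ≤ u² with u = δφ; translation invariance makes the bound uniform in s. -/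
theorem abs_correlation_sub_le (hz : Measurable z) (hz0 : ∀ x, 0 ≤ z x) (hC : ∀ x, z x ≤ C)
    {φ : E d → ℝ} (hφ : IsTestFunction φ) {M δ : ℝ} (hM : ∀ x, |φ x| ≤ M) (hδ : 0 < δ)
    (hδM : δ * M ≤ 1) (s : E d) :
    |correlation z (fun y => δ⁻¹ * (Real.exp (δ * φ y) - 1)) s - correlation z φ s|
      ≤ δ * (C * ∫ y, |φ y ^ 2|) := by
  have hc2 : HasCompactSupport fun y => φ y ^ 2 :=
    hφ.2.comp_left (g := fun u : ℝ => u ^ 2) (by simp)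
  have hc1 : HasCompactSupport fun y => δ⁻¹ * (Real.exp (δ * φ y) - 1) :=
    hφ.2.comp_left (g := fun u : ℝ => δ⁻¹ * (Real.exp (δ * u) - 1)) (by simp)
  have hcont : Continuous φ := hφ.1.continuous
  have hi1 := integrable_mul_comp_sub hz hz0 hC (by fun_prop) hc1 s
  have hi0 := integrable_mul_comp_sub hz hz0 hC hcont hφ.2 s
  have hC0 : 0 ≤ C := (hz0 0).trans (hC 0)
  have hi2 : Integrable fun y => |φ (y - s) ^ 2| :=
    (((hcont.pow 2).integrable_of_hasCompactSupport hc2).comp_sub_right s).abs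
  rw [correlation, correlation, ← integral_sub hi1 hi0]
  calc _ ≤ ∫ y, |z y * (δ⁻¹ * (Real.exp (δ * φ (y - s)) - 1)) - z y * φ (y - s)| :=
        abs_integral_le_integral_abs
    _ ≤ ∫ y, δ * (C * |φ (y - s) ^ 2|) := by
        refine integral_mono (hi1.sub hi0).abs ((hi2.const_mul C).const_mul δ) fun y => ?_
        have h1 : |δ * φ (y - s)| ≤ 1 := by
          rw [abs_mul, abs_of_pos hδ]
          exact (mul_le_mul_of_nonneg_left (hM _) hδ.le).trans hδM
        have h2 := Real.abs_exp_sub_one_sub_id_le h1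
        have h3 : z y * (δ⁻¹ * (Real.exp (δ * φ (y - s)) - 1)) - z y * φ (y - s)
            = z y * (δ⁻¹ * (Real.exp (δ * φ (y - s)) - 1 - δ * φ (y - s))) := by
          field_simp
        dsimp only
        rw [h3, abs_mul, abs_mul, abs_of_nonneg (hz0 y), abs_of_pos (inv_pos.2 hδ),
          abs_of_nonneg (sq_nonneg (φ (y - s)))]
        calc z y * (δ⁻¹ * |Real.exp (δ * φ (y - s)) - 1 - δ * φ (y - s)|)
            ≤ C * (δ⁻¹ * (δ * φ (y - s)) ^ 2) := by
              gcongr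
              exact hC y
          _ = δ * (C * φ (y - s) ^ 2) := by field_simp
    _ = δ * (C * ∫ y, |φ y ^ 2|) := by
        rw [integral_const_mul, integral_const_mul,
          integral_sub_right_eq_self (fun y => |φ y ^ 2|) s]

/-- Lévy's continuity theorem for the laws of εs under `ν ε`, tested against the bounded continuous
correlation. -/
theorem tendsto_integral_correlation {ν : ℝ → Measure (E d)} {μ : Measure (E d)}
    [∀ ε, IsProbabilityMeasure (ν ε)] [IsProbabilityMeasure μ]
    (hz : Measurable z) (hz0 : ∀ x, 0 ≤ z x) (hC : ∀ x, z x ≤ C)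
    (hψ : Continuous ψ) (hc : HasCompactSupport ψ)
    (hν : ∀ k, Tendsto (fun ε => charFun (ν ε) (ε • k)) (𝓝[>] 0) (𝓝 (charFun μ k))) :
    Tendsto (fun ε => ∫ s, correlation z ψ (ε • s) ∂ν ε) (𝓝[>] 0)
      (𝓝 (∫ s, correlation z ψ s ∂μ)) := by
  have hcont := continuous_correlation hz hz0 hC hψ hc
  let g : BoundedContinuousFunction (E d) ℝ := BoundedContinuousFunction.ofNormedAddCommGroup
    (correlation z ψ) hcont _ (abs_correlation_le hz hz0 hC hψ hc)
  have hm (ε : ℝ) : Measurable fun s : E d => ε • s := measurable_id.const_smul ε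
  have hp (ε : ℝ) : IsProbabilityMeasure ((ν ε).map (ε • ·)) :=
    Measure.isProbabilityMeasure_map (hm ε).aemeasurable
  refine tendsto_of_seq_tendsto fun u hu => ?_
  let P : ℕ → ProbabilityMeasure (E d) := fun n => ⟨(ν (u n)).map (u n • ·), hp (u n)⟩
  let Q : ProbabilityMeasure (E d) := ⟨μ, inferInstance⟩
  have h1 : Tendsto P atTop (𝓝 Q) := by
    refine ProbabilityMeasure.tendsto_of_tendsto_charFun fun k => ?_
    have := (hν k).comp hu
    refine this.congr fun n => ?_
    exact (charFun_map_smul (u n) k).symm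
  have h2 := ProbabilityMeasure.tendsto_iff_forall_integral_tendsto.1 h1 g
  refine h2.congr fun n => ?_
  exact integral_map (hm (u n)).aemeasurable hcont.aestronglyMeasurable

/-- Convergence of the exponent of the Laplace transform. -/
theorem tendsto_integral_smear (hd : 1 ≤ d) {ν : ℝ → Measure (E d)} {μ : Measure (E d)}
    [∀ ε, IsProbabilityMeasure (ν ε)] [IsProbabilityMeasure μ]
    (hz : Measurable z) (hz0 : ∀ x, 0 ≤ z x) (hC : ∀ x, z x ≤ C) {φ : E d → ℝ}
    (hφ : IsTestFunction φ)
    (hν : ∀ k, Tendsto (fun ε => charFun (ν ε) (ε • k)) (𝓝[>] 0) (𝓝 (charFun μ k))) :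
    Tendsto (fun ε => ∫ x, smear (ν ε) (fun x => ε ^ d * φ (ε • x)) x * z (ε • x)) (𝓝[>] 0)
      (𝓝 (∫ s, correlation z φ s ∂μ)) := by
  have hcont : Continuous φ := hφ.1.continuous
  obtain ⟨M, hM0, hM⟩ := exists_abs_bound hcont hφ.2
  have h1 := tendsto_integral_correlation hz hz0 hC hcont hφ.2 hν
  set K := C * ∫ y, |φ y ^ 2|
  have hpow : Tendsto (fun ε : ℝ => ε ^ d) (𝓝[>] 0) (𝓝 0) := by
    have : Tendsto (fun ε : ℝ => ε ^ d) (𝓝 0) (𝓝 (0 ^ d)) := (continuous_pow d).tendsto 0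
    rw [zero_pow (by omega)] at this
    exact this.mono_left nhdsWithin_le_nhds
  have hsmall : ∀ᶠ ε : ℝ in 𝓝[>] 0, ε ^ d * M ≤ 1 := by
    have := hpow.mul_const M
    rw [zero_mul] at this
    exact (this.eventually_lt_const one_pos).mono fun _ h => h.le
  have h2 : Tendsto (fun ε => (∫ x, smear (ν ε) (fun x => ε ^ d * φ (ε • x)) x * z (ε • x))
      - ∫ s, correlation z φ (ε • s) ∂ν ε) (𝓝[>] 0) (𝓝 0) := by
    refine squeeze_zero_norm' (a := fun ε : ℝ => ε ^ d * K) ?_ (by simpa using hpow.mul_const K)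
    filter_upwards [hsmall, self_mem_nhdsWithin] with ε hε hε0
    have hε1 : 0 < ε := hε0
    have hδ : 0 < ε ^ d := pow_pos hε1 d
    have hc1 : HasCompactSupport fun y => (ε ^ d)⁻¹ * (Real.exp (ε ^ d * φ y) - 1) :=
      hφ.2.comp_left (g := fun u : ℝ => (ε ^ d)⁻¹ * (Real.exp (ε ^ d * u) - 1)) (by simp)
    have hcont1 : Continuous fun y => (ε ^ d)⁻¹ * (Real.exp (ε ^ d * φ y) - 1) := by fun_prop
    have hi {ψ : E d → ℝ} (hψ : Continuous ψ) (hc : HasCompactSupport ψ) :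
        Integrable (fun s => correlation z ψ (ε • s)) (ν ε) :=
      Integrable.of_bound ((continuous_correlation hz hz0 hC hψ hc).comp
        (continuous_const_smul ε)).aestronglyMeasurable _
        (ae_of_all _ fun s => abs_correlation_le hz hz0 hC hψ hc _)
    rw [integral_smear_eq hz hz0 hC hφ hε1, ← integral_sub (hi hcont1 hc1) (hi hcont hφ.2)]
    refine (norm_integral_le_of_norm_le_const (ae_of_all _ fun s =>
      abs_correlation_sub_le hz hz0 hC hφ hM hδ hε (ε • s))).trans ?_
    simp [K]
  simpa using h2.add h1

end weak

/-! ### Moments and the limits of the characteristic exponents -/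

section moments

variable {d : ℕ} {b : E d → ℝ}

theorem integrable_mul_of_moments (hb : ∀ n : ℕ, Integrable fun x : E d => ‖x‖ ^ n * b x)
    {g : E d → ℝ} (hg : Continuous g) {K : ℝ} {n : ℕ} (h : ∀ x, |g x| ≤ K * ‖x‖ ^ n) :
    Integrable fun x => g x * b x := by
  have h0 : AEStronglyMeasurable b volume := by simpa using (hb 0).aestronglyMeasurable
  refine ((hb n).norm.const_mul K).mono' (hg.aestronglyMeasurable.mul h0) (ae_of_all _ fun x => ?_)
  rw [norm_mul, norm_mul, norm_pow, norm_norm, ← mul_assoc]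
  exact mul_le_mul_of_nonneg_right (h x) (norm_nonneg _)

theorem integrable_inner_mul (hb : ∀ n : ℕ, Integrable fun x : E d => ‖x‖ ^ n * b x) (k : E d) :
    Integrable fun x => inner ℝ x k * b x :=
  integrable_mul_of_moments hb (by fun_prop) (K := ‖k‖) (n := 1) fun x => by
    rw [pow_one, mul_comm]; exact abs_real_inner_le_norm x k

theorem integrable_inner_sq_mul (hb : ∀ n : ℕ, Integrable fun x : E d => ‖x‖ ^ n * b x)
    (k : E d) : Integrable fun x => inner ℝ x k ^ 2 * b x :=
  integrable_mul_of_moments hb (by fun_prop) (K := ‖k‖ ^ 2) (n := 2) fun x => by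
    rw [abs_pow, mul_comm, ← mul_pow]
    exact pow_le_pow_left₀ (abs_nonneg _) (abs_real_inner_le_norm x k) 2

theorem integral_inner_mul (hb : ∀ n : ℕ, Integrable fun x : E d => ‖x‖ ^ n * b x) (k : E d) :
    ∫ x, inner ℝ x k * b x = inner ℝ (firstMoment b) k := by
  have hi (i : Fin d) : Integrable fun x : E d => x i * b x :=
    integrable_mul_of_moments hb (by fun_prop) (K := 1) (n := 1) fun x => by
      simpa using PiLp.norm_apply_le x i
  calc ∫ x, inner ℝ x k * b x = ∫ x : E d, ∑ i, k i * (x i * b x) := by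
        refine integral_congr_ae (ae_of_all _ fun x => ?_)
        simp only [PiLp.inner_apply, Finset.sum_mul, RCLike.inner_apply, conj_trivial, mul_assoc]
    _ = inner ℝ (firstMoment b) k := by
        rw [integral_finsetSum _ fun i _ => (hi i).const_mul (k i)]
        simp only [integral_const_mul, PiLp.inner_apply, firstMoment, RCLike.inner_apply,
          conj_trivial]

theorem integral_inner_sq_mul (hb : ∀ n : ℕ, Integrable fun x : E d => ‖x‖ ^ n * b x)
    (k : E d) : ∫ x, inner ℝ x k ^ 2 * b x = quadForm (secondMoment b) k := by
  have hi (i j : Fin d) : Integrable fun x : E d => x i * x j * b x :=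
    integrable_mul_of_moments hb (by fun_prop) (K := 1) (n := 2) fun x => by
      rw [one_mul, abs_mul, sq]
      exact mul_le_mul (PiLp.norm_apply_le x i) (PiLp.norm_apply_le x j) (abs_nonneg _)
        (norm_nonneg _)
  calc ∫ x, inner ℝ x k ^ 2 * b x = ∫ x : E d, ∑ i, ∑ j, k i * k j * (x i * x j * b x) := by
        refine integral_congr_ae (ae_of_all _ fun x => ?_)
        simp only [PiLp.inner_apply, RCLike.inner_apply, conj_trivial, sq, Finset.sum_mul_sum]
        rw [Finset.sum_mul]
        refine Finset.sum_congr rfl fun i _ => ?_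
        rw [Finset.sum_mul]
        exact Finset.sum_congr rfl fun j _ => by ring
    _ = quadForm (secondMoment b) k := by
        rw [integral_finsetSum _ fun i _ => integrable_finsetSum _ fun j _ =>
          (hi i j).const_mul _]
        refine Finset.sum_congr rfl fun i _ => ?_
        rw [integral_finsetSum _ fun j _ => (hi i j).const_mul _]
        refine Finset.sum_congr rfl fun j _ => ?_
        rw [integral_const_mul, secondMoment, Matrix.of_apply]
        ring

theorem dotProduct_mulVec_eq_quadForm (M : Matrix (Fin d) (Fin d) ℝ) (k : Fin d → ℝ) :
    k ⬝ᵥ M.mulVec k = quadForm M (WithLp.toLp 2 k) := by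
  simp only [dotProduct, Matrix.mulVec, quadForm, Finset.mul_sum]
  exact Finset.sum_congr rfl fun i _ => Finset.sum_congr rfl fun j _ => by ring

/-- The form is ∫ ⟨x, k⟩² b(x) dx ≥ 0, so t times this matrix is the covariance of a Gaussian for t
≥ 0. -/
theorem posSemidef_secondMoment (hb0 : ∀ x, 0 ≤ b x)
    (hb : ∀ n : ℕ, Integrable fun x : E d => ‖x‖ ^ n * b x) : (secondMoment b).PosSemidef := by
  refine Matrix.PosSemidef.of_dotProduct_mulVec_nonneg ?_ fun k => ?_
  · ext i j
    simp only [secondMoment, Matrix.conjTranspose_apply, Matrix.of_apply, star_trivial]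
    exact integral_congr_ae (ae_of_all _ fun x => by ring)
  · rw [star_trivial, dotProduct_mulVec_eq_quadForm, ← integral_inner_sq_mul hb]
    exact integral_nonneg fun x => mul_nonneg (sq_nonneg _) (hb0 x)

theorem aestronglyMeasurable_ofReal_of_moments
    (hb : ∀ n : ℕ, Integrable fun x : E d => ‖x‖ ^ n * b x) :
    AEStronglyMeasurable (fun x => (b x : ℂ)) volume := by
  have h0 : AEStronglyMeasurable b volume := by simpa using (hb 0).aestronglyMeasurable
  exact Complex.continuous_ofReal.comp_aestronglyMeasurable h0

theorem tendsto_inv_mul_exp_sub_one (u : ℝ) :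
    Tendsto (fun ε : ℝ => (ε : ℂ)⁻¹ * (Complex.exp (((ε * u : ℝ) : ℂ) * Complex.I) - 1))
      (𝓝[>] 0) (𝓝 (Complex.I * u)) := by
  have h : HasDerivAt (fun s : ℝ => Complex.exp ((s : ℂ) * (u * Complex.I)))
      (u * Complex.I) 0 := by
    have h1 : HasDerivAt (fun s : ℝ => (s : ℂ)) 1 0 := Complex.ofRealCLM.hasDerivAt
    simpa using (h1.mul_const ((u : ℂ) * Complex.I)).cexp
  have h2 := h.tendsto_slope_zero_right
  rw [mul_comm Complex.I]
  refine h2.congr fun ε => ?_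
  simp [Complex.real_smul, mul_assoc]

theorem norm_exp_mul_I_sub_one_le (x : ℝ) :
    ‖Complex.exp ((x : ℂ) * Complex.I) - 1‖ ≤ |x| := by
  rw [mul_comm]; exact Real.norm_exp_I_mul_ofReal_sub_one_le

/-- A bound valid for all x, as domination requires. The factor 2 comes from |x| > 1, where |x| +
|x| ≤ 2x². -/
theorem norm_exp_mul_I_sub_one_sub_le (x : ℝ) :
    ‖Complex.exp ((x : ℂ) * Complex.I) - 1 - x * Complex.I‖ ≤ 2 * x ^ 2 := by
  have hx : ‖(x : ℂ) * Complex.I‖ = |x| := by simp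
  rcases le_or_gt |x| 1 with h | h
  · refine (Complex.norm_exp_sub_one_sub_id_le (hx.trans_le h)).trans ?_
    rw [hx, sq_abs]
    nlinarith [sq_nonneg x]
  · refine (norm_sub_le _ _).trans ?_
    rw [hx, ← sq_abs]
    nlinarith [norm_exp_mul_I_sub_one_le x]

theorem tendsto_inv_sq_mul_exp_sub (u : ℝ) :
    Tendsto (fun ε : ℝ => ((ε : ℂ) ^ 2)⁻¹ * (Complex.exp (((ε * u : ℝ) : ℂ) * Complex.I) - 1
      - ((ε * u : ℝ) : ℂ) * Complex.I)) (𝓝[>] 0) (𝓝 (-(u : ℂ) ^ 2 / 2)) := by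
  rw [tendsto_iff_norm_sub_tendsto_zero]
  have hid : Tendsto (fun ε : ℝ => ε) (𝓝[>] 0) (𝓝 0) := nhdsWithin_le_nhds
  have hsmall : ∀ᶠ ε : ℝ in 𝓝[>] 0, ε * |u| ≤ 1 := by
    have := hid.mul_const |u|
    rw [zero_mul] at this
    exact (this.eventually_lt_const one_pos).mono fun _ h => h.le
  refine squeeze_zero' (Eventually.of_forall fun _ => norm_nonneg _)
    (g := fun ε : ℝ => ε * |u| ^ 3) ?_ (by simpa using hid.mul_const (|u| ^ 3))
  filter_upwards [hsmall, self_mem_nhdsWithin] with ε hε hε0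
  have hε1 : 0 < ε := hε0
  set w : ℂ := ((ε * u : ℝ) : ℂ) * Complex.I
  have hw : ‖w‖ = ε * |u| := by simp [w, abs_of_pos hε1]
  have h1 := Complex.exp_bound (hw.trans_le hε) (n := 3) (by norm_num)
  have hw2 : w ^ 2 = -((ε : ℂ) ^ 2 * (u : ℂ) ^ 2) := by
    simp only [w, mul_pow, Complex.I_sq]
    push_cast
    ring
  have hεc : (ε : ℂ) ≠ 0 := by exact_mod_cast hε1.ne'
  have h2 : ((ε : ℂ) ^ 2)⁻¹ * (Complex.exp w - 1 - w) - -(u : ℂ) ^ 2 / 2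
      = ((ε : ℂ) ^ 2)⁻¹ * (Complex.exp w - ∑ m ∈ Finset.range 3, w ^ m / (m.factorial : ℂ)) := by
    simp only [Finset.sum_range_succ, Finset.sum_range_zero, Nat.factorial, hw2]
    field_simp
    push_cast
    ring
  rw [h2, norm_mul, norm_inv, norm_pow, Complex.norm_real, Real.norm_of_nonneg hε1.le]
  rw [hw] at h1
  calc (ε ^ 2)⁻¹ * _ ≤ (ε ^ 2)⁻¹ * ((ε * |u|) ^ 3 *
        (((3 : ℕ).succ : ℝ) * ((Nat.factorial 3 : ℝ) * (3 : ℕ))⁻¹)) := by gcongr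
    _ = ε * |u| ^ 3 * (2 / 9) := by
        simp only [Nat.factorial]
        field_simp
        push_cast
        ring
    _ ≤ ε * |u| ^ 3 := by
        have : 0 ≤ ε * |u| ^ 3 := by positivity
        linarith

/-- Differentiation at 0 under the integral, dominated through |e^{iu} - 1| ≤ |u|. No sign of b
enters, so it applies to the odd part of a kernel. -/
theorem tendsto_first_order (hb : ∀ n : ℕ, Integrable fun x : E d => ‖x‖ ^ n * b x) (k : E d) :
    Tendsto (fun ε : ℝ => (ε : ℂ)⁻¹ *
      ∫ x, (b x : ℂ) * (Complex.exp ((inner ℝ x (ε • k) : ℝ) * Complex.I) - 1)) (𝓝[>] 0)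
      (𝓝 (Complex.I * (inner ℝ (firstMoment b) k : ℝ))) := by
  have h : Tendsto (fun ε : ℝ => ∫ x, (b x : ℂ) * ((ε : ℂ)⁻¹ *
      (Complex.exp (((ε * inner ℝ x k : ℝ) : ℂ) * Complex.I) - 1))) (𝓝[>] 0)
      (𝓝 (∫ x, (b x : ℂ) * (Complex.I * (inner ℝ x k : ℝ)))) := by
    refine tendsto_integral_filter_of_dominated_convergence (fun x => ‖inner ℝ x k * b x‖) ?_ ?_
      (integrable_inner_mul hb k).norm
      (ae_of_all _ fun x => (tendsto_inv_mul_exp_sub_one _).const_mul _)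
    · refine Eventually.of_forall fun ε => (aestronglyMeasurable_ofReal_of_moments hb).mul ?_
      exact (by fun_prop : Continuous fun x : E d => (ε : ℂ)⁻¹ *
        (Complex.exp (((ε * inner ℝ x k : ℝ) : ℂ) * Complex.I) - 1)).aestronglyMeasurable
    · filter_upwards [self_mem_nhdsWithin] with ε hε
      have hε1 : 0 < ε := hε
      refine ae_of_all _ fun x => ?_
      rw [norm_mul, norm_mul, norm_mul, norm_inv, Complex.norm_real, Complex.norm_real,
        Real.norm_of_nonneg hε1.le, mul_comm ‖inner ℝ x k‖]
      gcongr
      rw [inv_mul_le_iff₀ hε1]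
      refine (norm_exp_mul_I_sub_one_le _).trans_eq ?_
      rw [abs_mul, abs_of_pos hε1, Real.norm_eq_abs]
  have hlim : ∫ x, (b x : ℂ) * (Complex.I * (inner ℝ x k : ℝ))
      = Complex.I * (inner ℝ (firstMoment b) k : ℝ) := by
    rw [← integral_inner_mul hb, ← integral_complex_ofReal, ← integral_const_mul]
    refine integral_congr_ae (ae_of_all _ fun x => ?_)
    dsimp only
    push_cast
    ring
  rw [hlim] at h
  refine h.congr fun ε => ?_
  rw [← integral_const_mul]
  refine integral_congr_ae (ae_of_all _ fun x => ?_)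
  dsimp only
  rw [inner_smul_right]
  ring

/-- As the first moment vanishes, the linear Taylor term can be subtracted at no cost; the rest is
O(ε²⟨x, k⟩²), dominated by the second moment. -/
theorem tendsto_second_order (hb : ∀ n : ℕ, Integrable fun x : E d => ‖x‖ ^ n * b x)
    (hb1 : firstMoment b = 0) (k : E d) :
    Tendsto (fun ε : ℝ => ((ε : ℂ) ^ 2)⁻¹ *
      ∫ x, (b x : ℂ) * (Complex.exp ((inner ℝ x (ε • k) : ℝ) * Complex.I) - 1)) (𝓝[>] 0)
      (𝓝 (-((quadForm (secondMoment b) k : ℝ) : ℂ) / 2)) := by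
  have h : Tendsto (fun ε : ℝ => ∫ x, (b x : ℂ) * (((ε : ℂ) ^ 2)⁻¹ *
      (Complex.exp (((ε * inner ℝ x k : ℝ) : ℂ) * Complex.I) - 1
        - ((ε * inner ℝ x k : ℝ) : ℂ) * Complex.I))) (𝓝[>] 0)
      (𝓝 (∫ x, (b x : ℂ) * (-((inner ℝ x k : ℝ) : ℂ) ^ 2 / 2))) := by
    refine tendsto_integral_filter_of_dominated_convergence
      (fun x => 2 * ‖inner ℝ x k ^ 2 * b x‖) ?_ ?_
      ((integrable_inner_sq_mul hb k).norm.const_mul 2)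
      (ae_of_all _ fun x => (tendsto_inv_sq_mul_exp_sub _).const_mul _)
    · refine Eventually.of_forall fun ε => (aestronglyMeasurable_ofReal_of_moments hb).mul ?_
      exact (by fun_prop : Continuous fun x : E d => ((ε : ℂ) ^ 2)⁻¹ *
        (Complex.exp (((ε * inner ℝ x k : ℝ) : ℂ) * Complex.I) - 1
          - ((ε * inner ℝ x k : ℝ) : ℂ) * Complex.I)).aestronglyMeasurable
    · filter_upwards [self_mem_nhdsWithin] with ε hε
      have hε1 : 0 < ε := hε
      refine ae_of_all _ fun x => ?_
      rw [norm_mul, norm_mul, norm_mul, norm_inv, norm_pow, Complex.norm_real, Complex.norm_real,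
        Real.norm_of_nonneg hε1.le, mul_comm ‖inner ℝ x k ^ 2‖, mul_left_comm 2]
      refine mul_le_mul_of_nonneg_left ?_ (norm_nonneg _)
      rw [inv_mul_le_iff₀ (by positivity)]
      refine (norm_exp_mul_I_sub_one_sub_le _).trans_eq ?_
      rw [Real.norm_of_nonneg (sq_nonneg _)]
      ring
  have hlim : ∫ x, (b x : ℂ) * (-((inner ℝ x k : ℝ) : ℂ) ^ 2 / 2)
      = -((quadForm (secondMoment b) k : ℝ) : ℂ) / 2 := by
    rw [← integral_inner_sq_mul hb, ← integral_complex_ofReal, neg_div, ← integral_div,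
      ← integral_neg]
    refine integral_congr_ae (ae_of_all _ fun x => ?_)
    dsimp only
    push_cast
    ring
  rw [hlim] at h
  refine h.congr fun ε => ?_
  have hzero : ∫ x, (b x : ℂ) * ((inner ℝ x (ε • k) : ℝ) * Complex.I) = 0 := by
    have h1 : ∫ x, ((inner ℝ x (ε • k) * b x : ℝ) : ℂ) = 0 := by
      rw [integral_complex_ofReal, integral_inner_mul hb, hb1, inner_zero_left, Complex.ofReal_zero]
    calc _ = ∫ x, ((inner ℝ x (ε • k) * b x : ℝ) : ℂ) * Complex.I := by
          refine integral_congr_ae (ae_of_all _ fun x => ?_)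
          dsimp only
          push_cast
          ring
      _ = 0 := by rw [integral_mul_const, h1, zero_mul]
  have hi1 : Integrable fun x : E d => (b x : ℂ) * ((inner ℝ x (ε • k) : ℝ) * Complex.I) := by
    refine ((integrable_inner_mul hb (ε • k)).ofReal (𝕜 := ℂ)).mul_const Complex.I |>.congr
      (ae_of_all _ fun x => ?_)
    simp only [RCLike.ofReal_mul, Complex.coe_algebraMap]
    ring
  have hi2 : Integrable fun x : E d => (b x : ℂ) *
      (Complex.exp ((inner ℝ x (ε • k) : ℝ) * Complex.I) - 1) := by
    refine (integrable_inner_mul hb (ε • k)).norm.mono'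
      ((aestronglyMeasurable_ofReal_of_moments hb).mul (by fun_prop : Continuous fun x : E d =>
        Complex.exp ((inner ℝ x (ε • k) : ℝ) * Complex.I) - 1).aestronglyMeasurable)
      (ae_of_all _ fun x => ?_)
    rw [norm_mul, norm_mul, mul_comm, Complex.norm_real]
    exact mul_le_mul_of_nonneg_right (norm_exp_mul_I_sub_one_le _) (norm_nonneg _)
  calc _ = ((ε : ℂ) ^ 2)⁻¹ * ((∫ x, (b x : ℂ) *
      (Complex.exp ((inner ℝ x (ε • k) : ℝ) * Complex.I) - 1))
        - ∫ x, (b x : ℂ) * ((inner ℝ x (ε • k) : ℝ) * Complex.I)) := by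
        rw [← integral_sub hi2 hi1, ← integral_const_mul]
        refine integral_congr_ae (ae_of_all _ fun x => ?_)
        dsimp only
        rw [inner_smul_right]
        ring
    _ = _ := by rw [hzero, sub_zero]

end moments

/-! ### Fourier inversion and the Gaussian pairing -/

section fourier

open scoped FourierTransform

variable {d : ℕ} {φ : E d → ℝ}

theorem isTestFunction_ofReal (hφ : IsTestFunction φ) :
    ContDiff ℝ (⊤ : ℕ∞) (fun x => (φ x : ℂ)) ∧ HasCompactSupport fun x => (φ x : ℂ) :=
  ⟨Complex.ofRealCLM.contDiff.comp hφ.1, hφ.2.comp_left (g := fun x : ℝ => (x : ℂ)) (by simp)⟩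

theorem integrable_fourier (hφ : IsTestFunction φ) :
    Integrable (𝓕 fun x : E d => (φ x : ℂ)) :=
  (𝓕 ((isTestFunction_ofReal hφ).2.toSchwartzMap (isTestFunction_ofReal hφ).1)).integrable

/-- Translates between the unitary normalisation and the transform `𝓕` with 2π in the exponent. -/
theorem fourierHat_eq (k : E d) :
    fourierHat φ k = (((2 * Real.pi) ^ (-(d : ℝ) / 2) : ℝ) : ℂ) *
      𝓕 (fun x : E d => (φ x : ℂ)) ((2 * Real.pi)⁻¹ • k) := by
  rw [fourierHat, Real.fourier_eq']
  congr 1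
  refine integral_congr_ae (ae_of_all _ fun x => ?_)
  simp only [smul_eq_mul, inner_smul_right]
  congr 2
  have : (-2 * Real.pi * ((2 * Real.pi)⁻¹ * inner ℝ x k) : ℝ) = -inner ℝ x k := by
    have := Real.pi_ne_zero
    field_simp
  rw [this]
  push_cast
  ring

theorem integrable_fourierHat (hφ : IsTestFunction φ) : Integrable (fourierHat φ) := by
  have h := ((integrable_fourier hφ).comp_smul (R := (2 * Real.pi)⁻¹)
    (by positivity)).const_mul (((2 * Real.pi) ^ (-(d : ℝ) / 2) : ℝ) : ℂ)
  exact h.congr (ae_of_all _ fun k => (fourierHat_eq k).symm)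

/-- Fourier inversion for test functions. -/
theorem fourierHat_inversion (hφ : IsTestFunction φ) (x : E d) :
    (((2 * Real.pi) ^ (-(d : ℝ) / 2) : ℝ) : ℂ) *
      ∫ k : E d, Complex.exp (Complex.I * (inner ℝ k x : ℝ)) * fourierHat φ k = φ x := by
  have hφ' := isTestFunction_ofReal hφ
  have h1 := congrFun (hφ'.1.continuous.fourierInv_fourier_eq
    (hφ'.1.continuous.integrable_of_hasCompactSupport hφ'.2) (integrable_fourier hφ)) x
  rw [Real.fourierInv_eq'] at h1
  set F := 𝓕 (fun x : E d => (φ x : ℂ))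
  have h2 := Measure.integral_comp_smul (μ := (volume : Measure (E d)))
    (fun w : E d => Complex.exp (((2 * Real.pi * inner ℝ w x : ℝ) : ℂ) * Complex.I) • F w)
    (2 * Real.pi)⁻¹
  rw [h1] at h2
  have hpos : 0 < 2 * Real.pi := by positivity
  -- The two normalising constants cancel the Jacobian (2π)^d of the rescaling of k.
  have h3 : (((2 * Real.pi) ^ (-(d : ℝ) / 2) : ℝ) : ℂ) * (((2 * Real.pi) ^ (-(d : ℝ) / 2) : ℝ) : ℂ)
      * (((2 * Real.pi) ^ d : ℝ) : ℂ) = 1 := by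
    rw [← Complex.ofReal_mul, ← Complex.ofReal_mul, ← Real.rpow_natCast, ← Real.rpow_add hpos,
      ← Real.rpow_add hpos]
    simp
  calc _ = (((2 * Real.pi) ^ (-(d : ℝ) / 2) : ℝ) : ℂ) * ∫ k : E d,
        (((2 * Real.pi) ^ (-(d : ℝ) / 2) : ℝ) : ℂ) *
        (Complex.exp (((2 * Real.pi * inner ℝ ((2 * Real.pi)⁻¹ • k) x : ℝ) : ℂ) * Complex.I) •
          F ((2 * Real.pi)⁻¹ • k)) := by
        congr 1
        refine integral_congr_ae (ae_of_all _ fun k => ?_)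
        simp only [fourierHat_eq, real_inner_smul_left, smul_eq_mul,
          mul_inv_cancel_left₀ hpos.ne']
        rw [mul_comm Complex.I]
        ring
    _ = (((2 * Real.pi) ^ (-(d : ℝ) / 2) : ℝ) : ℂ) * (((2 * Real.pi) ^ (-(d : ℝ) / 2) : ℝ) : ℂ)
      * (((2 * Real.pi) ^ d : ℝ) : ℂ) * φ x := by
        rw [integral_const_mul, h2, finrank_euclideanSpace, Fintype.card_fin, inv_pow, inv_inv,
          abs_of_pos (pow_pos hpos d), Complex.real_smul]
        ring
    _ = φ x := by rw [h3, one_mul]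

/-- The Gaussian pairing is an average of the correlation over the Gaussian displacement. -/
theorem gaussianPairing_eq {z : E d → ℝ} {C : ℝ} (hz : Measurable z) (hz0 : ∀ x, 0 ≤ z x)
    (hC : ∀ x, z x ≤ C) (hφ : IsTestFunction φ) {μ : Measure (E d)} [IsProbabilityMeasure μ]
    {b : E d} {M : Matrix (Fin d) (Fin d) ℝ} {t : ℝ}
    (hμ : ∀ k, charFun μ k = Complex.exp (Complex.I * t * (inner ℝ b k : ℝ)
      - (t / 2) * (quadForm M k : ℝ))) :
    gaussianPairing z b M t φ = (∫ s, correlation z φ s ∂μ : ℝ) := by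
  set c : ℂ := (((2 * Real.pi) ^ (-(d : ℝ) / 2) : ℝ) : ℂ)
  have hcont : Continuous φ := hφ.1.continuous
  have hQ (k : E d) : quadForm M (-k) = quadForm M k := by simp [quadForm]
  have hinner (x : E d) : c * ∫ k : E d, Complex.exp (Complex.I * (inner ℝ k x : ℝ)) *
      Complex.exp (-Complex.I * t * (inner ℝ b k : ℝ) - (t / 2) * (quadForm M k : ℝ)) *
        fourierHat φ k = ∫ s, (φ (x - s) : ℂ) ∂μ := by
    have h1 : Integrable (fun p : E d × E d =>
        Complex.exp (Complex.I * (inner ℝ p.1 (x - p.2) : ℝ)) * fourierHat φ p.1)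
        (volume.prod μ) := by
      refine ((integrable_fourierHat hφ).comp_fst μ).bdd_mul (c := 1) ?_ (ae_of_all _ fun p => ?_)
      · exact (by fun_prop : Continuous fun p : E d × E d =>
          Complex.exp (Complex.I * (inner ℝ p.1 (x - p.2) : ℝ))).aestronglyMeasurable
      · rw [mul_comm, Complex.norm_exp_ofReal_mul_I]
    calc c * ∫ k : E d, Complex.exp (Complex.I * (inner ℝ k x : ℝ)) *
          Complex.exp (-Complex.I * t * (inner ℝ b k : ℝ) - (t / 2) * (quadForm M k : ℝ)) *
          fourierHat φ k
        = c * ∫ k : E d, (∫ s, Complex.exp (Complex.I * (inner ℝ k (x - s) : ℝ)) *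
            fourierHat φ k ∂μ) := by
          congr 1
          refine integral_congr_ae (ae_of_all _ fun k => ?_)
          -- The pairing contains e^{-it⟨b,k⟩}, which is the characteristic function of μ at -k.
          -- Combined with e^{i⟨k,x⟩} it shifts x to x - s.
          have h2 := hμ (-k)
          rw [charFun_apply, hQ, inner_neg_right] at h2
          have h3 : Complex.exp (-Complex.I * t * (inner ℝ b k : ℝ) - (t / 2) * (quadForm M k : ℝ))
              = ∫ s, Complex.exp ((inner ℝ s (-k) : ℝ) * Complex.I) ∂μ := by
            rw [h2]
            congr 1
            push_cast
            ring
          dsimp only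
          rw [integral_mul_const, h3, ← integral_const_mul]
          congr 2
          ext s
          rw [← Complex.exp_add, inner_sub_right, inner_neg_right, real_inner_comm]
          congr 1
          rw [real_inner_comm s k]
          push_cast
          ring
      _ = c * ∫ s, (∫ k : E d, Complex.exp (Complex.I * (inner ℝ k (x - s) : ℝ)) *
            fourierHat φ k) ∂μ := by
          congr 1
          exact integral_integral_swap (f := fun k s =>
            Complex.exp (Complex.I * (inner ℝ k (x - s) : ℝ)) * fourierHat φ k) h1
      _ = ∫ s, (φ (x - s) : ℂ) ∂μ := by
          rw [← integral_const_mul]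
          exact integral_congr_ae (ae_of_all _ fun s => fourierHat_inversion hφ (x - s))
  have h4 : Integrable (fun p : E d × E d => z p.1 * φ (p.1 - p.2)) (volume.prod μ) := by
    refine (integrable_prod_comp_sub (ν := μ) (hcont.integrable_of_hasCompactSupport hφ.2)
      hcont.measurable).bdd_mul (c := C) ?_ (ae_of_all _ fun p => ?_)
    · exact (hz.comp measurable_fst).aestronglyMeasurable
    · rw [Real.norm_of_nonneg (hz0 _)]; exact hC _
  calc gaussianPairing z b M t φ = ∫ x : E d, (z x : ℂ) * ∫ s, (φ (x - s) : ℂ) ∂μ := by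
        rw [gaussianPairing, ← integral_const_mul]
        refine integral_congr_ae (ae_of_all _ fun x => ?_)
        dsimp only
        rw [← hinner x]
        ring
    _ = ((∫ x : E d, ∫ s, z x * φ (x - s) ∂μ : ℝ) : ℂ) := by
        rw [← integral_complex_ofReal]
        refine integral_congr_ae (ae_of_all _ fun x => ?_)
        dsimp only
        rw [integral_const_mul, Complex.ofReal_mul, integral_complex_ofReal]
    _ = (∫ s, correlation z φ s ∂μ : ℝ) := by
        rw [integral_integral_swap (f := fun x s => z x * φ (x - s)) h4]
        rfl

end fourier

/-! ### The scaling limits -/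

section limits

variable {d : ℕ} {a z φ : E d → ℝ} {C t : ℝ}

/-- Reduces all three regimes to the limit `L` of the rescaled exponent and a probability measure
with characteristic function e^{tL}. The kernel may depend on ε, as weak asymmetry requires. -/
theorem tendsto_toReal_scaledLaplace (hd : 1 ≤ d) {A : ℝ → E d → ℝ} (hA0 : ∀ ε x, 0 ≤ A ε x)
    (hA : ∀ ε, ∀ n : ℕ, Integrable (fun x => ‖x‖ ^ n * A ε x)) (hz : Measurable z)
    (hz0 : ∀ x, 0 ≤ z x) (hC : ∀ x, z x ≤ C) (κ : ℕ) (ht : 0 ≤ t) (hφ : IsTestFunction φ)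
    {μ : Measure (E d)} [IsProbabilityMeasure μ] {L : E d → ℂ}
    (hμ : ∀ k, charFun μ k = Complex.exp (t * L k))
    (hL : ∀ k, Tendsto (fun ε : ℝ => ((ε : ℂ) ^ κ)⁻¹ * ∫ x, (A ε x : ℂ) *
      (Complex.exp ((inner ℝ x (ε • k) : ℝ) * Complex.I) - 1)) (𝓝[>] 0) (𝓝 (L k))) :
    Tendsto (fun ε : ℝ => (scaledLaplace (A ε) z κ t φ ε).toReal) (𝓝[>] 0)
      (𝓝 (Real.exp (∫ s, correlation z φ s ∂μ))) := by
  have hi (ε : ℝ) := integrable_of_moments (hA ε)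
  have hprob (ε : ℝ) : IsProbabilityMeasure (displacementLaw (A ε) ((ε ^ κ)⁻¹ * t)) :=
    isProbabilityMeasure_displacementLaw (hA0 ε) (hi ε) _
  have hlim (k : E d) : Tendsto
      (fun ε : ℝ => charFun (displacementLaw (A ε) ((ε ^ κ)⁻¹ * t)) (ε • k)) (𝓝[>] 0)
      (𝓝 (charFun μ k)) := by
    rw [hμ]
    refine (((hL k).const_mul (t : ℂ)).cexp).congr' ?_
    filter_upwards [self_mem_nhdsWithin] with ε hε
    have hε1 : 0 < ε := hε
    rw [charFun_displacementLaw (hA0 ε) (hi ε) (by positivity)]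
    congr 1
    push_cast
    ring
  have h1 := tendsto_integral_smear (ν := fun ε => displacementLaw (A ε) ((ε ^ κ)⁻¹ * t))
    hd hz hz0 hC hφ hlim
  refine ((Real.continuous_exp.tendsto _).comp h1).congr' ?_
  filter_upwards [self_mem_nhdsWithin] with ε hε
  have hε1 : 0 < ε := hε
  rw [scaledLaplace_eq hd (hA0 ε) (hA ε) hz hz0 hC κ ht hφ hε1,
    ENNReal.toReal_ofReal (Real.exp_pos _).le]
  rfl

/-- The law of the Gaussian displacement with drift `b` and diffusion matrix `M` at time `t`. -/
noncomputable def gaussianDisplacement (b : E d) (M : Matrix (Fin d) (Fin d) ℝ) (t : ℝ) :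
    Measure (E d) :=
  multivariateGaussian (t • b) (t • M)

instance (b : E d) (M : Matrix (Fin d) (Fin d) ℝ) (t : ℝ) :
    IsProbabilityMeasure (gaussianDisplacement b M t) := by
  unfold gaussianDisplacement; infer_instance

theorem charFun_gaussianDisplacement {M : Matrix (Fin d) (Fin d) ℝ} (hM : M.PosSemidef)
    (ht : 0 ≤ t) (b k : E d) : charFun (gaussianDisplacement b M t) k
      = Complex.exp (t * (Complex.I * (inner ℝ b k : ℝ) - (quadForm M k : ℝ) / 2)) := by
  rw [gaussianDisplacement, charFun_multivariateGaussian (hM.smul ht), Matrix.smul_mulVec,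
    dotProduct_smul, dotProduct_mulVec_eq_quadForm, inner_smul_right, real_inner_comm]
  congr 1
  push_cast [smul_eq_mul]
  ring

theorem integral_correlation_gaussianDisplacement (hz : Measurable z) (hz0 : ∀ x, 0 ≤ z x)
    (hC : ∀ x, z x ≤ C) (hφ : IsTestFunction φ) {M : Matrix (Fin d) (Fin d) ℝ}
    (hM : M.PosSemidef) (ht : 0 ≤ t) (b : E d) :
    gaussianPairing z b M t φ
      = (∫ s, correlation z φ s ∂gaussianDisplacement b M t : ℝ) := by
  refine gaussianPairing_eq hz hz0 hC hφ fun k => ?_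
  rw [charFun_gaussianDisplacement hM ht]
  congr 1
  ring

theorem tendsto_ballistic (hd : 1 ≤ d) (ha : ∀ x, 0 ≤ a x)
    (hm : ∀ n : ℕ, Integrable (fun x => ‖x‖ ^ n * a x)) (hz : Measurable z)
    (hz0 : ∀ x, 0 ≤ z x) (hC : ∀ x, z x ≤ C) (ht : 0 ≤ t) (hφ : IsTestFunction φ) :
    Tendsto (fun ε : ℝ => (scaledLaplace a z 1 t φ ε).toReal) (𝓝[>] 0)
      (𝓝 (Real.exp (∫ x, z (x + t • firstMoment a) * φ x))) := by
  have h := tendsto_toReal_scaledLaplace (A := fun _ => a) hd (fun _ => ha) (fun _ => hm) hz hz0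
    hC 1 ht hφ (μ := Measure.dirac (t • firstMoment a))
    (L := fun k => Complex.I * (inner ℝ (firstMoment a) k : ℝ)) (fun k => by
      rw [charFun_dirac, real_inner_smul_left]
      congr 1
      push_cast
      ring) (fun k => by simpa only [pow_one] using tendsto_first_order hm k)
  rw [integral_dirac' _ _ (continuous_correlation hz hz0 hC hφ.1.continuous
    hφ.2).stronglyMeasurable] at h
  convert! h using 3
  -- Translation by the limiting displacement moves the shift from φ to z.
  rw [correlation, ← integral_sub_right_eq_self _ (t • firstMoment a)]
  simp

theorem tendsto_diffusive (hd : 1 ≤ d) (ha : ∀ x, 0 ≤ a x)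
    (hm : ∀ n : ℕ, Integrable (fun x => ‖x‖ ^ n * a x)) (h1 : firstMoment a = 0)
    (hz : Measurable z) (hz0 : ∀ x, 0 ≤ z x) (hC : ∀ x, z x ≤ C) (ht : 0 ≤ t)
    (hφ : IsTestFunction φ) :
    Tendsto (fun ε : ℝ => ((scaledLaplace a z 2 t φ ε).toReal : ℂ)) (𝓝[>] 0)
      (𝓝 (Complex.exp (gaussianPairing z 0 (secondMoment a) t φ))) := by
  have hM := posSemidef_secondMoment ha hm
  rw [integral_correlation_gaussianDisplacement hz hz0 hC hφ hM ht, ← Complex.ofReal_exp]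
  refine (Complex.continuous_ofReal.tendsto _).comp ?_
  refine tendsto_toReal_scaledLaplace (A := fun _ => a) hd (fun _ => ha) (fun _ => hm) hz hz0
    hC 2 ht hφ (charFun_gaussianDisplacement hM ht 0) fun k => ?_
  convert! tendsto_second_order hm h1 k using 2
  rw [inner_zero_left]
  push_cast
  ring

/-! ### Even and odd parts, and weak asymmetry -/

theorem integrable_moments_comp_neg (hm : ∀ n : ℕ, Integrable (fun x => ‖x‖ ^ n * a x)) (n : ℕ) :
    Integrable fun x => ‖x‖ ^ n * a (-x) := by
  simpa using (hm n).comp_neg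

theorem integrable_moments_evenPart (hm : ∀ n : ℕ, Integrable (fun x => ‖x‖ ^ n * a x)) (n : ℕ) :
    Integrable fun x => ‖x‖ ^ n * evenPart a x := by
  refine (((hm n).add (integrable_moments_comp_neg hm n)).div_const 2).congr
    (ae_of_all _ fun x => ?_)
  simp only [evenPart, Pi.add_apply]
  ring

theorem integrable_moments_oddPart (hm : ∀ n : ℕ, Integrable (fun x => ‖x‖ ^ n * a x)) (n : ℕ) :
    Integrable fun x => ‖x‖ ^ n * oddPart a x := by
  refine (((hm n).sub (integrable_moments_comp_neg hm n)).div_const 2).congr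
    (ae_of_all _ fun x => ?_)
  simp only [oddPart, Pi.sub_apply]
  ring

theorem integrable_moments_weakKernel (hm : ∀ n : ℕ, Integrable (fun x => ‖x‖ ^ n * a x)) (ε : ℝ)
    (n : ℕ) : Integrable fun x => ‖x‖ ^ n * weakKernel a ε x := by
  refine ((integrable_moments_evenPart hm n).add
    ((integrable_moments_oddPart hm n).const_mul ε)).congr (ae_of_all _ fun x => ?_)
  simp only [weakKernel, Pi.add_apply]
  ring

theorem weakKernel_nonneg (ha : ∀ x, 0 ≤ a x) {ε : ℝ} (h0 : 0 ≤ ε) (h1 : ε ≤ 1) (x : E d) :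
    0 ≤ weakKernel a ε x := by
  simp only [weakKernel, evenPart, oddPart]
  nlinarith [ha x, ha (-x)]

theorem firstMoment_evenPart (a : E d → ℝ) : firstMoment (evenPart a) = 0 := by
  ext i
  have h := integral_neg_eq_self (fun x : E d => x i * evenPart a x) volume
  have h2 (x : E d) : (-x) i * evenPart a (-x) = -(x i * evenPart a x) := by
    simp only [evenPart, neg_neg, PiLp.neg_apply]
    ring
  simp only [h2, integral_neg] at h
  simp only [firstMoment, PiLp.zero_apply]
  linarith

theorem firstMoment_oddPart (hm : ∀ n : ℕ, Integrable (fun x => ‖x‖ ^ n * a x)) :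
    firstMoment (oddPart a) = firstMoment a := by
  ext i
  have hi : Integrable fun x : E d => x i * a x :=
    integrable_mul_of_moments hm (by fun_prop) (K := 1) (n := 1) fun x => by
      simpa using PiLp.norm_apply_le x i
  have hi' : Integrable fun x : E d => x i * a (-x) := by simpa using hi.comp_neg.neg
  have h := integral_neg_eq_self (fun x : E d => x i * a x) volume
  simp only [PiLp.neg_apply, neg_mul, integral_neg] at h
  simp only [firstMoment, oddPart]
  calc ∫ x : E d, x i * ((a x - a (-x)) / 2) = ∫ x : E d, (x i * a x - x i * a (-x)) / 2 :=
        integral_congr_ae (ae_of_all _ fun x => by ring)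
    _ = ∫ x : E d, x i * a x := by
        rw [integral_div, integral_sub hi hi', ← h]
        linarith

theorem secondMoment_evenPart (hm : ∀ n : ℕ, Integrable (fun x => ‖x‖ ^ n * a x)) :
    secondMoment (evenPart a) = secondMoment a := by
  ext i j
  have hi : Integrable fun x : E d => x i * x j * a x :=
    integrable_mul_of_moments hm (by fun_prop) (K := 1) (n := 2) fun x => by
      rw [one_mul, abs_mul, sq]
      exact mul_le_mul (PiLp.norm_apply_le x i) (PiLp.norm_apply_le x j) (abs_nonneg _)
        (norm_nonneg _)
  have hi' : Integrable fun x : E d => x i * x j * a (-x) := by simpa using hi.comp_neg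
  have h := integral_neg_eq_self (fun x : E d => x i * x j * a x) volume
  simp only [PiLp.neg_apply, neg_mul_neg] at h
  simp only [secondMoment, evenPart, Matrix.of_apply]
  calc ∫ x : E d, x i * x j * ((a x + a (-x)) / 2)
      = ∫ x : E d, (x i * x j * a x + x i * x j * a (-x)) / 2 :=
        integral_congr_ae (ae_of_all _ fun x => by ring)
    _ = ∫ x : E d, x i * x j * a x := by
        rw [integral_div, integral_add hi hi', h]
        linarith

theorem integrable_mul_exp_sub_one (hm : ∀ n : ℕ, Integrable (fun x => ‖x‖ ^ n * a x)) (k : E d) :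
    Integrable fun x : E d => (a x : ℂ) * (Complex.exp ((inner ℝ x k : ℝ) * Complex.I) - 1) := by
  refine (integrable_inner_mul hm k).norm.mono'
    ((aestronglyMeasurable_ofReal_of_moments hm).mul (by fun_prop : Continuous fun x : E d =>
      Complex.exp ((inner ℝ x k : ℝ) * Complex.I) - 1).aestronglyMeasurable)
    (ae_of_all _ fun x => ?_)
  rw [norm_mul, norm_mul, mul_comm, Complex.norm_real]
  exact mul_le_mul_of_nonneg_right (norm_exp_mul_I_sub_one_le _) (norm_nonneg _)

/-- The even part has zero first moment and contributes the diffusive term. The odd part enters with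
ε · ε^{-2} = ε^{-1}, which is the ballistic scaling, and contributes the drift. -/
theorem tendsto_weakKernel_exponent (hm : ∀ n : ℕ, Integrable (fun x => ‖x‖ ^ n * a x))
    (k : E d) :
    Tendsto (fun ε : ℝ => ((ε : ℂ) ^ 2)⁻¹ * ∫ x, (weakKernel a ε x : ℂ) *
      (Complex.exp ((inner ℝ x (ε • k) : ℝ) * Complex.I) - 1)) (𝓝[>] 0)
      (𝓝 (Complex.I * (inner ℝ (firstMoment a) k : ℝ)
        - (quadForm (secondMoment a) k : ℝ) / 2)) := by
  have hp := integrable_moments_evenPart hm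
  have hq := integrable_moments_oddPart hm
  have h1 := tendsto_first_order hq k
  have h2 := tendsto_second_order hp (firstMoment_evenPart a) k
  rw [firstMoment_oddPart hm] at h1
  rw [secondMoment_evenPart hm] at h2
  have h3 := h1.add h2
  rw [neg_div, ← sub_eq_add_neg] at h3
  refine h3.congr' ?_
  filter_upwards [self_mem_nhdsWithin] with ε hε
  have hε1 : (ε : ℂ) ≠ 0 := by exact_mod_cast (ne_of_gt hε)
  have h4 : ∫ x, (weakKernel a ε x : ℂ) *
      (Complex.exp ((inner ℝ x (ε • k) : ℝ) * Complex.I) - 1)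
      = (∫ x, (evenPart a x : ℂ) * (Complex.exp ((inner ℝ x (ε • k) : ℝ) * Complex.I) - 1))
        + ε * ∫ x, (oddPart a x : ℂ) *
          (Complex.exp ((inner ℝ x (ε • k) : ℝ) * Complex.I) - 1) := by
    rw [← integral_const_mul, ← integral_add (integrable_mul_exp_sub_one hp _)
      ((integrable_mul_exp_sub_one hq _).const_mul _)]
    refine integral_congr_ae (ae_of_all _ fun x => ?_)
    simp only [weakKernel]
    push_cast
    ring
  have h5 (u v : ℂ) : (ε : ℂ)⁻¹ * v + ((ε : ℂ) ^ 2)⁻¹ * u = ((ε : ℂ) ^ 2)⁻¹ * (u + ε * v) := by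
    field_simp
    rw [add_comm]
  rw [h4]
  exact h5 _ _

theorem tendsto_weakly_asymmetric (hd : 1 ≤ d) (ha : ∀ x, 0 ≤ a x)
    (hm : ∀ n : ℕ, Integrable (fun x => ‖x‖ ^ n * a x))
    (hz : Measurable z) (hz0 : ∀ x, 0 ≤ z x) (hC : ∀ x, z x ≤ C) (ht : 0 ≤ t)
    (hφ : IsTestFunction φ) :
    Tendsto (fun ε : ℝ => ((scaledLaplace (weakKernel a ε) z 2 t φ ε).toReal : ℂ)) (𝓝[>] 0)
      (𝓝 (Complex.exp (gaussianPairing z (firstMoment a) (secondMoment a) t φ))) := by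
  have hM := posSemidef_secondMoment ha hm
  rw [integral_correlation_gaussianDisplacement hz hz0 hC hφ hM ht, ← Complex.ofReal_exp]
  refine (Complex.continuous_ofReal.tendsto _).comp ?_
  -- `p + ε q` is guaranteed nonnegative only for 0 ≤ ε ≤ 1. Clamping ε to [0, 1] gives a family of
  -- admissible kernels for all real ε, unchanged near 0 from the right.
  have hev : ∀ᶠ ε : ℝ in 𝓝[>] 0, max 0 (min ε 1) = ε := by
    filter_upwards [Ioc_mem_nhdsGT (zero_lt_one' ℝ)] with ε hε
    rw [min_eq_left hε.2, max_eq_right hε.1.le]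
  refine (tendsto_toReal_scaledLaplace (A := fun ε => weakKernel a (max 0 (min ε 1))) hd
    (fun ε => weakKernel_nonneg ha (le_max_left _ _)
      (max_le zero_le_one (min_le_right _ _))) (fun ε => integrable_moments_weakKernel hm _) hz hz0
    hC 2 ht hφ (charFun_gaussianDisplacement hM ht (firstMoment a)) fun k => ?_).congr' ?_
  · refine (tendsto_weakKernel_exponent hm k).congr' ?_
    filter_upwards [hev] with ε hε
    rw [hε]
  · filter_upwards [hev] with ε hε
    rw [hε]

theorem scaledLaplace_ne_top (hd : 1 ≤ d) (ha : ∀ x, 0 ≤ a x)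
    (hm : ∀ n : ℕ, Integrable (fun x => ‖x‖ ^ n * a x)) (hz : Measurable z)
    (hz0 : ∀ x, 0 ≤ z x) (hC : ∀ x, z x ≤ C) (κ : ℕ) (ht : 0 ≤ t) (hφ : IsTestFunction φ)
    {ε : ℝ} (hε : 0 < ε) : scaledLaplace a z κ t φ ε ≠ ⊤ := by
  rw [scaledLaplace_eq hd ha hm hz hz0 hC κ ht hφ hε]
  exact ENNReal.ofReal_ne_top

end limits

end Kawasaki

theorem mainTheorem5 (d : ℕ) (hd : 1 ≤ d)
    (a : EuclideanSpace ℝ (Fin d) → ℝ) (ha : ∀ x, 0 ≤ a x)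
    (ha_moments : ∀ n : ℕ, Integrable (fun x => ‖x‖ ^ n * a x))
    (z : EuclideanSpace ℝ (Fin d) → ℝ) (hz : Measurable z) (hz_nonneg : ∀ x, 0 ≤ z x)
    (hz_bdd : ∃ C : ℝ, ∀ x, z x ≤ C) :
    (firstMoment a ≠ 0 →
      ∀ t : ℝ, 0 ≤ t → ∀ φ : EuclideanSpace ℝ (Fin d) → ℝ, IsTestFunction φ →
        (∀ ε : ℝ, 0 < ε → scaledLaplace a z 1 t φ ε ≠ ⊤) ∧
        Tendsto (fun ε : ℝ => (scaledLaplace a z 1 t φ ε).toReal) (𝓝[>] 0)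
          (𝓝 (Real.exp (∫ x, z (x + t • firstMoment a) * φ x)))) ∧
    (firstMoment a = 0 →
      ∀ t : ℝ, 0 ≤ t → ∀ φ : EuclideanSpace ℝ (Fin d) → ℝ, IsTestFunction φ →
        (∀ ε : ℝ, 0 < ε → scaledLaplace a z 2 t φ ε ≠ ⊤) ∧
        Tendsto (fun ε : ℝ => ((scaledLaplace a z 2 t φ ε).toReal : ℂ)) (𝓝[>] 0)
          (𝓝 (Complex.exp (gaussianPairing z 0 (secondMoment a) t φ)))) ∧
    (firstMoment a ≠ 0 →
      ∀ t : ℝ, 0 ≤ t → ∀ φ : EuclideanSpace ℝ (Fin d) → ℝ, IsTestFunction φ →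
        (∀ ε : ℝ, 0 < ε → ε ≤ 1 → scaledLaplace (weakKernel a ε) z 2 t φ ε ≠ ⊤) ∧
        Tendsto (fun ε : ℝ => ((scaledLaplace (weakKernel a ε) z 2 t φ ε).toReal : ℂ)) (𝓝[>] 0)
          (𝓝 (Complex.exp (gaussianPairing z (firstMoment a) (secondMoment a) t φ)))) := by
  obtain ⟨C, hC⟩ := hz_bdd
  refine ⟨fun _ t ht φ hφ => ⟨fun ε hε => ?_, ?_⟩, fun h t ht φ hφ => ⟨fun ε hε => ?_, ?_⟩,
    fun _ t ht φ hφ => ⟨fun ε hε hε1 => ?_, ?_⟩⟩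
  · exact scaledLaplace_ne_top hd ha ha_moments hz hz_nonneg hC 1 ht hφ hε
  · exact tendsto_ballistic hd ha ha_moments hz hz_nonneg hC ht hφ
  · exact scaledLaplace_ne_top hd ha ha_moments hz hz_nonneg hC 2 ht hφ hε
  · exact tendsto_diffusive hd ha ha_moments h hz hz_nonneg hC ht hφ
  · exact scaledLaplace_ne_top hd (weakKernel_nonneg ha hε.le hε1)
      (integrable_moments_weakKernel ha_moments ε) hz hz_nonneg hC 2 ht hφ hε
  · exact tendsto_weakly_asymmetric hd ha ha_moments hz hz_nonneg hC ht hφ
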